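/- **Notation.** For $d\ge 1$, $\theta=(\theta_1,\dots,\theta_d)\in\mathbf T^d=(\mathbf R/\mathbf Z)^d$, a real $\varepsilon>0$ and an integer $N\ge 1$, the Bohr set of dimension $d$ is $\Lambda_{\theta,\varepsilon,N}=\{n\in\mathbf Z: |n|\le N,\ \|n\theta_j\|<\varepsilon \text{ for } j=1,\dots,d\}$, where $\|\cdot\|$ is the distance to the nearest integer; a Bohr set is regarded as given together with $\theta,\varepsilon,N$. It is *regular* if for every $\kappa\in(0,1)$, every real $\varepsilon'$ and every integer $N'\ge 0$ with $|\varepsilon-\varepsilon'|<\frac{\kappa}{100d}\varepsilon$ and $|N-N'|<\frac{\kappa}{100d}N$ one has $1-\kappa<|\Lambda_{\theta,\varepsilon',N'}|/|\Lambda_{\theta,\varepsilon,N}|<1+\kappa$. For $\eta\in(0,1]$, a regular Bohr set $\Lambda_{\theta',\varepsilon',N'}$ is an *$\eta$ attendant* of $\Lambda_{\theta,\varepsilon,N}$ if $\theta'=(\theta_1,\dots,\theta_d,\theta_{d+1},\dots,\theta_{d+k})$ for some $k\ge0$, $\eta\varepsilon/2\le\varepsilon'\le\eta\varepsilon$ and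 $\eta N/2\le N'\le\eta N$. Write $\Lambda_{\theta_1,\varepsilon_1,N_1}\le\Lambda_{\theta_2,\varepsilon_2,N_2}$ if $\theta_1=\theta_2$, $\varepsilon_1\le\varepsilon_2$, $N_1\le N_2$. We write $S(\cdot)$ for the characteristic function of a set $S$, $\delta_S(Q)=|S\cap Q|/|S|$, and $\|\widehat g\|_\infty=\sup_{x}|\sum_{s\in\mathbf Z}g(s)e^{-2\pi i s x}|$. **Uniform sets.** Let $\Lambda,M$ be Bohr sets, $Q\subseteq\Lambda$, $|Q|=\beta|\Lambda|$. The set $Q$ is *$\alpha$-uniform in $\Lambda$ with respect to $M$* if 1. $\bigl|\{m\in\Lambda:\ \|(Q\cap(M+m)-\beta(M+m))^{\wedge}\|_\infty\ge\alpha|M|\}\bigr|\le\alpha|\Lambda|$, 2. $\frac1{|\Lambda|}\sum_{m\in\Lambda}|\delta_{M+m}(Q)-\beta|^2\le\alpha^2$, 3. $\|(Q-\beta\Lambda)^{\wedge}\|_\infty\le\alpha|\Lambda|$. **Rectilinearly uniform sets.** For a finitely supported $f:\mathbf Z^2\to\mathbf R$ write $f[r,m]=f(r,-m)$. For Bohr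 sets $L_1,L_2,L'$ put $$\|f\|^4_{L_1\times L_2;L'}=\sum_{i\in L_1}\sum_{j\in L_2}\sum_{k,m,u\in\mathbf Z}L'(m-k-i)\,L'(u-k-i)\Bigl|\sum_{r\in\mathbf Z}L'(k+r-j)f[r,m]f[r,u]\Bigr|^2 .$$ Let $\Lambda_1\le\Lambda_2$, $E_1\subseteq\Lambda_1$, $E_2\subseteq\Lambda_2$, $|E_i|=\beta_i|\Lambda_i|$, $A\subseteq E_1\times E_2$, $|A|=\delta|E_1||E_2|$, and let $\Lambda'$ be an $\varepsilon$ attendant of $\Lambda_1$ and $\Lambda''$ an $\varepsilon$ attendant of $\Lambda'$, both with the same generative vector as $\Lambda_1$. Let $f=A-\delta\cdot(E_1\times E_2)$ and $f_l(s_1,s_2)=f(s_1+l,s_2)\Lambda'(s_1)$. The set $A$ is *rectilinearly $(\alpha,\alpha_1,\varepsilon)$-uniform* (with respect to $\Lambda',\Lambda''$) if $$\bigl|\{l\in\Lambda_1:\ \|f_l\|^4_{\Lambda'\times\Lambda_2;\Lambda''}>\alpha\beta_1^2\beta_2^2|\Lambda''|^4|\Lambda'|^2|\Lambda_2|\}\bigr|\le\alpha_1|\Lambda_1|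 .$$ **Theorem 3.15.** Let $\Lambda_1=\Lambda_{\theta,\varepsilon_1,N_1}\le\Lambda_2$ be regular Bohr sets, $\theta\in\mathbf T^d$, $d\ge1$. Let $E_1\subseteq\Lambda_1$, $E_2\subseteq\Lambda_2$, $|E_1|=\beta_1|\Lambda_1|$, $|E_2|=\beta_2|\Lambda_2|$, and let $A\subseteq E_1\times E_2$ have cardinality $\delta|E_1||E_2|$. Put $$\alpha_0=2^{-2000}\delta^{96}\beta_1^{48}\beta_2^{48},\qquad \varepsilon=\frac{2^{-100}\alpha_0^2}{100d}.$$ Suppose that $E_1$ and $E_2$ are $(\alpha_0,2^{-10}\varepsilon^2)$-uniform, that is, there are $2^{-10}\varepsilon^2$ attendants $M_1,M_2$ of $\Lambda_1$ such that $E_1$ is $\alpha_0$-uniform in $\Lambda_1$ with respect to $M_1$ and $E_2$ is $\alpha_0$-uniform in $\Lambda_2$ with respect to $M_2$. Suppose that $A$ is rectilinearly $(\alpha,\alpha_1,\varepsilon)$-uniform (with respect to some $\Lambda',\Lambda''$ as above), where $\alpha=2^{-100}\delta^{12}$ and $\alpha_1=2^{-7}\delta$, and that $$\log N_1\ge 2^{10}d\log\frac1{\varepsilon_1\varepsilon}.$$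 Then $A$ contains a triple $\{(k,m),(k+t,m),(k,m+t)\}$ with integers $k,m,t$, $t\neq0$. -/

import Mathlib

open scoped BigOperators

noncomputable section

/-- The integers `n` with `|n| ≤ N` and `‖n θ_j‖ < ε` for all `j`. The norm on `UnitAddCircle = ℝ/ℤ`
is the distance to the nearest integer. -/
def bohrPoints {d : ℕ} (θ : Fin d → UnitAddCircle) (ε : ℝ) (N : ℕ) : Finset ℤ :=
  open Classical in
  (Finset.Icc (-(N : ℤ)) (N : ℤ)).filter (fun n => ∀ j, ‖n • θ j‖ < ε)

theorem mem_bohrPoints {d : ℕ} {θ : Fin d → UnitAddCircle} {ε : ℝ} {N : ℕ} {n : ℤ} :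
    n ∈ bohrPoints θ ε N ↔ |n| ≤ (N : ℤ) ∧ ∀ j, ‖n • θ j‖ < ε := by
  simp [bohrPoints, abs_le]

/-- A Bohr set of dimension `d`, given by its generative vector `θ`, its width `ε > 0` and its
length `N`, a positive integer. -/
structure BohrSet (d : ℕ) where
  θ : Fin d → UnitAddCircle
  ε : ℝ
  N : ℕ
  ε_pos : 0 < ε
  N_pos : 0 < N

namespace BohrSet

/-- The underlying finite set of integers. -/
def points {d : ℕ} (Λ : BohrSet d) : Finset ℤ := bohrPoints Λ.θ Λ.ε Λ.N

/-- The number of elements, as a real number. -/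
def size {d : ℕ} (Λ : BohrSet d) : ℝ := (Λ.points.card : ℝ)

/-- Regularity: a small relative change of the width and of the length changes the cardinality
by a small proportion only, at every scale `κ`. -/
def IsRegular {d : ℕ} (Λ : BohrSet d) : Prop :=
  ∀ κ : ℝ, 0 < κ → κ < 1 → ∀ (ε' : ℝ) (N' : ℕ),
    |Λ.ε - ε'| < κ / (100 * d) * Λ.ε →
    |(Λ.N : ℝ) - (N' : ℝ)| < κ / (100 * d) * Λ.N →
    1 - κ < ((bohrPoints Λ.θ ε' N').card : ℝ) / Λ.size ∧
      ((bohrPoints Λ.θ ε' N').card : ℝ) / Λ.size < 1 + κ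

/-- `Λ₁ ≤ Λ₂`: the same generative vector, smaller width and smaller length. -/
instance {d : ℕ} : LE (BohrSet d) where
  le Λ₁ Λ₂ := Λ₁.θ = Λ₂.θ ∧ Λ₁.ε ≤ Λ₂.ε ∧ Λ₁.N ≤ Λ₂.N

/-- `Λ'` is an `η` attendant of `Λ`. The generative vector of `Λ'` extends that of `Λ`; if both
have the same dimension, then the two generative vectors are equal. -/
structure IsAttendant {d d' : ℕ} (η : ℝ) (Λ : BohrSet d) (Λ' : BohrSet d') : Prop where
  pos : 0 < η
  le_one : η ≤ 1
  regular : Λ'.IsRegular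
  extends_θ : ∃ h : d ≤ d', ∀ j : Fin d, Λ'.θ (Fin.castLE h j) = Λ.θ j
  le_ε : η * Λ.ε / 2 ≤ Λ'.ε
  ε_le : Λ'.ε ≤ η * Λ.ε
  le_N : η * Λ.N / 2 ≤ (Λ'.N : ℝ)
  N_le : (Λ'.N : ℝ) ≤ η * Λ.N

end BohrSet

/-- The characteristic function of a finite set. -/
def charFn {X : Type} (S : Finset X) (x : X) : ℝ :=
  open Classical in if x ∈ S then 1 else 0

/-- The translate `S + m`. -/
def intTranslate (S : Finset ℤ) (m : ℤ) : Finset ℤ := S.map (addRightEmbedding m)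

/-- The relative density `|S ∩ Q| / |S|` of `Q` in `S`. -/
def relDensity (S Q : Finset ℤ) : ℝ := ((S ∩ Q).card : ℝ) / (S.card : ℝ)

/-- The Fourier transform `x ↦ ∑ g(s) e(-s x)`, where `e(t) = exp(2 π i t)`. It is used for
functions of finite support only. -/
def fourierTransform (g : ℤ → ℝ) (x : ℝ) : ℂ :=
  ∑' s : ℤ, (g s : ℂ) * Complex.exp (-(2 * Real.pi * Complex.I * (s : ℂ) * (x : ℂ)))

/-- The supremum norm of the Fourier transform. -/
def fourierSup (g : ℤ → ℝ) : ℝ := ⨆ x : ℝ, ‖fourierTransform g x‖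

/-- The set `Q ⊆ Λ` is `α`-uniform at the scale of the (smaller) Bohr set `Λ'`: the restrictions of
`Q` to almost all translates of `Λ'` have small Fourier coefficients after subtraction of the
density of `Q` in `Λ`, the densities of `Q` in these translates have small variance, and `Q`
has small Fourier coefficients in `Λ`. It is called `(α, η)`-uniform if `Λ'` is an `η` attendant. -/
structure IsUniformAt {d d' : ℕ} (α : ℝ) (Λ : BohrSet d) (Λ' : BohrSet d') (Q : Finset ℤ) :
    Prop where
  subset : Q ⊆ Λ.points
  fourier_local :
    (open Classical in
      ((Λ.points.filter (fun m =>
        α * Λ'.size ≤ fourierSup (fun n =>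
          charFn (Q ∩ intTranslate Λ'.points m) n
            - relDensity Λ.points Q * charFn (intTranslate Λ'.points m) n))).card : ℝ))
      ≤ α * Λ.size
  variance :
    (1 / Λ.size) * ∑ m ∈ Λ.points,
      |relDensity (intTranslate Λ'.points m) Q - relDensity Λ.points Q| ^ 2 ≤ α ^ 2
  fourier_global :
    fourierSup (fun n =>
      charFn (Q ∩ Λ.points) n - relDensity Λ.points Q * charFn Λ.points n) ≤ α * Λ.size

/-- The fourth power of the local rectilinear norm of `f` on `L₁ × L₂` at the scale of `L'`. Here
`f(r, m)` stands for the value of `f` at `r e₁ + m e₂` with `e₁ = (1, 0)` and `e₂ = (0, -1)`, that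
is, at the point `(r, -m)`. All sums are finite for functions of finite support. -/
def rectNorm4 (L₁ L₂ L' : Finset ℤ) (f : ℤ × ℤ → ℝ) : ℝ :=
  ∑ i ∈ L₁, ∑ j ∈ L₂, ∑' k : ℤ, ∑' m : ℤ, ∑' u : ℤ,
    charFn L' (m - k - i) * charFn L' (u - k - i) *
      |∑' r : ℤ, charFn L' (k + r - j) * f (r, -m) * f (r, -u)| ^ 2

/-- The balanced function `A - δ (E₁ × E₂)`, where `δ = |A| / (|E₁| |E₂|)`. -/
def balanced (E₁ E₂ : Finset ℤ) (A : Finset (ℤ × ℤ)) (s : ℤ × ℤ) : ℝ :=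
  charFn A s - (A.card : ℝ) / ((E₁.card : ℝ) * (E₂.card : ℝ)) * charFn (E₁ ×ˢ E₂) s

/-- `f_l(s) = f(s₁ + l, s₂) L'(s₁)`. -/
def localize (f : ℤ × ℤ → ℝ) (L' : Finset ℤ) (l : ℤ) (s : ℤ × ℤ) : ℝ :=
  f (s.1 + l, s.2) * charFn L' s.1

/-- `A ⊆ E₁ × E₂ ⊆ Λ₁ × Λ₂` is rectilinearly `(α, α₁, η)`-uniform, with respect to an `η` attendant
`Λ'` of `Λ₁` and an `η` attendant `Λ''` of `Λ'` (of the same dimension). -/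
structure IsRectUniform {d : ℕ} (α α₁ η : ℝ) (Λ₁ Λ₂ Λ' Λ'' : BohrSet d) (E₁ E₂ : Finset ℤ)
    (A : Finset (ℤ × ℤ)) : Prop where
  attendant : BohrSet.IsAttendant η Λ₁ Λ'
  attendant' : BohrSet.IsAttendant η Λ' Λ''
  card_le :
    (open Classical in
      ((Λ₁.points.filter (fun l =>
        α * (relDensity Λ₁.points E₁) ^ 2 * (relDensity Λ₂.points E₂) ^ 2 *
            Λ''.size ^ 4 * Λ'.size ^ 2 * Λ₂.size
          < rectNorm4 Λ'.points Λ₂.points Λ''.points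
              (localize (balanced E₁ E₂ A) Λ'.points l))).card : ℝ))
      ≤ α₁ * Λ₁.size

end

/-! ### Parseval's identity and bilinear forms with Fourier-uniform kernels -/

noncomputable section

/-! Write `b = β₁ β₂`, `L = Λ'`, `W = Λ''`, and let `ω` be the eighth root of `α₀`. The proof works
in a single strip `(L + l) × Λ₂` that is typical in three respects: the local rectilinear norm of
the balanced function `f = A - δ (E₁ × E₂)` is small, almost all windows `M₁ + n` seen from `L + l`
are Fourier-uniform for `E₁`, and `A` has `D ≥ (δ b / 2) |L| |Λ₂|` points there. Averaging over `l`
provides such a strip (`LocalFrame.exists_good_strip`).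

In the strip the corners `(x, y), (s, y), (x, y + s - x)` are counted, and `A` is split at the
vertex `(x, y)` as `δ (E₁ × E₂) + f`. If the two other points lie in `A`, the vertex lies in `E₁ ×
E₂`, so the main term is `δ` times the number of pairs of points of `A` on a common antidiagonal. By
Cauchy–Schwarz it is at least `δ D² / |Y|`, where `Y` is a slight enlargement of `Λ₂`.

The term with `f` is an error. After averaging over small shifts, two applications of Cauchy–Schwarz
bound its fourth power by a box form of `f` weighted by `E₁` and `E₂` (`cornerSum_pow_four_le`). The
weights may be replaced by `β₁` and `β₂`, because a bilinear form with kernel `E_i - β_i` is small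
(`abs_bilinear_le`, `weighted_box_le`). The shifts run over `W + M₁ + M₂`: the norm of `f` is known
at the scale of `W`, the uniformity of `E_i` at the scale of `M_i`, and enlarging the scale of a box
form costs nothing (`sum_box_coarse_le`).

If `A` has trivial corners only, the corner sum equals `D`, and comparison with the main term gives
`δ² b |L| ≤ 8`. So either there is a nontrivial corner or `L` is short. In the second case `M₁`,
`M₂` and `W`, which lie in `L`, are short too. A short window cannot be Fourier-uniform to the
precision `ω⁸` unless the density is within `ω` of `0` or `1`, so `β₁` and `β₂` are close to `1`. A
box form is at least the fourth power of the function, so a small norm of `f` forces `δ` close to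
`1`. Now `A` fills `7/8` of `Λ₁ × Λ₂`. Dirichlet's theorem gives a nonzero `t` whose translation
almost preserves `Λ₁` and `Λ₂`, and a union bound gives a corner of side `t`. The lower bound for
`log N₁` enters only in the choice of this `t`. -/

/-- The exponential `x ↦ exp (-2 π i n x)`. -/
def expNeg (n : ℤ) (x : ℝ) : ℂ :=
  Complex.exp (-(2 * Real.pi * Complex.I * (n : ℂ) * (x : ℂ)))

theorem expNeg_add (m n : ℤ) (x : ℝ) : expNeg (m + n) x = expNeg m x * expNeg n x := by
  unfold expNeg
  rw [← Complex.exp_add]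
  congr 1
  push_cast
  ring

theorem expNeg_eq (n : ℤ) (x : ℝ) :
    expNeg n x = Complex.exp (((-(2 * Real.pi * n * x) : ℝ) : ℂ) * Complex.I) := by
  unfold expNeg
  congr 1
  push_cast
  ring

theorem norm_expNeg (n : ℤ) (x : ℝ) : ‖expNeg n x‖ = 1 := by
  rw [expNeg_eq, Complex.norm_exp_ofReal_mul_I]

theorem conj_expNeg (n : ℤ) (x : ℝ) : (starRingEnd ℂ) (expNeg n x) = expNeg (-n) x := by
  unfold expNeg
  rw [← Complex.exp_conj]
  congr 1
  simp [Complex.conj_ofNat]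

theorem continuous_expNeg (n : ℤ) : Continuous (expNeg n) := by
  unfold expNeg
  fun_prop

theorem integral_expNeg (n : ℤ) : ∫ x in (0:ℝ)..1, expNeg n x = if n = 0 then 1 else 0 := by
  split_ifs with h
  · subst h
    simp [expNeg]
  · have hc : (-(2 * Real.pi * Complex.I * (n : ℂ)) : ℂ) ≠ 0 := by
      simp [Real.pi_ne_zero, h]
    have h1 := integral_exp_mul_complex (a := 0) (b := 1) hc
    have h2 : ∀ x : ℝ, expNeg n x = Complex.exp ((-(2 * Real.pi * Complex.I * (n : ℂ))) * x) := by
      intro x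
      unfold expNeg
      congr 1
      ring
    simp_rw [h2]
    rw [h1]
    have h3 : Complex.exp (-(2 * Real.pi * Complex.I * (n : ℂ)) * ((1 : ℝ) : ℂ)) = 1 := by
      rw [Complex.exp_eq_one_iff]
      exact ⟨-n, by push_cast; ring⟩
    rw [h3]
    simp

/-- Parseval's identity for a trigonometric polynomial with real coefficients. -/
theorem integral_trigPoly_sq (F : Finset ℤ) (a : ℤ → ℝ) :
    ∫ x in (0:ℝ)..1, ‖∑ n ∈ F, (a n : ℂ) * expNeg n x‖ ^ 2 = ∑ n ∈ F, a n ^ 2 := by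
  have key : ∀ x : ℝ, ((‖∑ n ∈ F, (a n : ℂ) * expNeg n x‖ ^ 2 : ℝ) : ℂ)
      = ∑ n ∈ F, ∑ m ∈ F, (a n * a m : ℂ) * expNeg (n - m) x := by
    intro x
    push_cast
    rw [← Complex.mul_conj', map_sum, Finset.sum_mul_sum]
    refine Finset.sum_congr rfl fun n _ => Finset.sum_congr rfl fun m _ => ?_
    rw [map_mul, conj_expNeg, Complex.conj_ofReal, sub_eq_add_neg, expNeg_add]
    ring
  have h1 : ((∫ x in (0:ℝ)..1, ‖∑ n ∈ F, (a n : ℂ) * expNeg n x‖ ^ 2 : ℝ) : ℂ)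
      = ((∑ n ∈ F, a n ^ 2 : ℝ) : ℂ) := by
    rw [← intervalIntegral.integral_ofReal]
    simp_rw [key]
    rw [intervalIntegral.integral_finsetSum]
    · push_cast
      refine Finset.sum_congr rfl fun n hn => ?_
      rw [intervalIntegral.integral_finsetSum]
      · simp_rw [intervalIntegral.integral_const_mul, integral_expNeg, sub_eq_zero]
        simp [hn, sq]
      · intro m _
        exact (continuous_const.mul (continuous_expNeg _)).intervalIntegrable _ _
    · intro n _
      exact (continuous_finsetSum _ fun m _ =>
        continuous_const.mul (continuous_expNeg _)).intervalIntegrable _ _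
  exact_mod_cast h1

/-- Convolution with a function that has small Fourier transform is small in `ℓ²`. -/
theorem sum_conv_sq_le (A M S : Finset ℤ) (G c : ℤ → ℝ) (K : ℝ)
    (hc : ∀ x : ℝ, ‖∑ m ∈ M, (c m : ℂ) * expNeg m x‖ ≤ K)
    (hS : ∀ s ∈ S, ∀ m ∈ M, s - m ∈ A) :
    ∑ s ∈ S, (∑ m ∈ M, G (s - m) * c m) ^ 2 ≤ K ^ 2 * ∑ u ∈ A, G u ^ 2 := by
  classical
  -- `T` contains the support of the full convolution `v` as well as `S`; the sum over `S` is then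
  -- part of the sum to which Parseval applies.
  set T : Finset ℤ := S ∪ (A ×ˢ M).image (fun q => q.1 + q.2) with hT
  set v : ℤ → ℝ := fun s => ∑ q ∈ (A ×ˢ M).filter (fun q => q.1 + q.2 = s), G q.1 * c q.2 with hv
  have hvS : ∀ s ∈ S, v s = ∑ m ∈ M, G (s - m) * c m := by
    intro s hs
    rw [hv]
    refine Finset.sum_bij' (fun q _ => q.2) (fun m _ => (s - m, m)) ?_ ?_ ?_ ?_ ?_
    · intro q hq
      simp only [Finset.mem_filter, Finset.mem_product] at hq
      exact hq.1.2
    · intro m hm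
      simp [hm, hS s hs m hm]
    · rintro ⟨q1, q2⟩ hq
      simp only [Finset.mem_filter, Finset.mem_product] at hq
      simp [← hq.2]
    · intro m _
      rfl
    · rintro ⟨q1, q2⟩ hq
      simp only [Finset.mem_filter, Finset.mem_product] at hq
      simp [← hq.2]
  have hprod : ∀ x : ℝ, ∑ s ∈ T, (v s : ℂ) * expNeg s x
      = (∑ u ∈ A, (G u : ℂ) * expNeg u x) * ∑ m ∈ M, (c m : ℂ) * expNeg m x := by
    intro x
    rw [Finset.sum_mul_sum, ← Finset.sum_product',
      ← Finset.sum_fiberwise_of_maps_to (s := A ×ˢ M) (t := T) (g := fun q => q.1 + q.2)]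
    · refine Finset.sum_congr rfl fun s _ => ?_
      rw [hv]
      push_cast
      rw [Finset.sum_mul]
      refine Finset.sum_congr rfl fun q hq => ?_
      rw [← (Finset.mem_filter.1 hq).2, expNeg_add]
      ring
    · intro q hq
      exact Finset.mem_union_right _ (Finset.mem_image_of_mem _ hq)
  calc ∑ s ∈ S, (∑ m ∈ M, G (s - m) * c m) ^ 2 = ∑ s ∈ S, v s ^ 2 :=
        Finset.sum_congr rfl fun s hs => by rw [hvS s hs]
    _ ≤ ∑ s ∈ T, v s ^ 2 :=
        Finset.sum_le_sum_of_subset_of_nonneg Finset.subset_union_left fun _ _ _ => sq_nonneg _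
    _ = ∫ x in (0:ℝ)..1, ‖∑ s ∈ T, (v s : ℂ) * expNeg s x‖ ^ 2 :=
        (integral_trigPoly_sq T v).symm
    _ ≤ ∫ x in (0:ℝ)..1, K ^ 2 * ‖∑ u ∈ A, (G u : ℂ) * expNeg u x‖ ^ 2 := by
        have hcont : ∀ (F : Finset ℤ) (a : ℤ → ℝ),
            Continuous fun x : ℝ => ‖∑ n ∈ F, (a n : ℂ) * expNeg n x‖ ^ 2 := fun F a =>
          (continuous_finsetSum _ fun m _ =>
            continuous_const.mul (continuous_expNeg _)).norm.pow 2
        refine intervalIntegral.integral_mono_on zero_le_one ((hcont _ _).intervalIntegrable _ _)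
          ((continuous_const.mul (hcont _ _)).intervalIntegrable _ _) fun x _ => ?_
        rw [hprod, norm_mul, mul_pow, mul_comm]
        gcongr
        exact hc x
    _ = K ^ 2 * ∑ u ∈ A, G u ^ 2 := by
        rw [intervalIntegral.integral_const_mul, integral_trigPoly_sq]

/-- The convolution of `c` with its reflection has the value `∑ c²` at `0`, so the preceding bound
at this one point reads `(∑ c²)² ≤ K² ∑ c²`. -/
theorem sum_sq_le_of_fourier_le (M : Finset ℤ) (c : ℤ → ℝ) (K : ℝ)
    (hc : ∀ x : ℝ, ‖∑ m ∈ M, (c m : ℂ) * expNeg m x‖ ≤ K) :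
    ∑ m ∈ M, c m ^ 2 ≤ K ^ 2 := by
  classical
  have h := sum_conv_sq_le (M.image fun m => -m) M {0} (fun u => c (-u)) c K hc (by
    intro s hs m hm
    rw [Finset.mem_singleton] at hs
    subst hs
    exact Finset.mem_image.2 ⟨m, hm, by ring⟩)
  rw [Finset.sum_image (by intro a _ b _ hab; simpa using hab)] at h
  simp only [Finset.sum_singleton, zero_sub, neg_neg] at h
  have h2 : ∑ m ∈ M, c m * c m = ∑ m ∈ M, c m ^ 2 :=
    Finset.sum_congr rfl fun m _ => by ring
  rw [h2] at h
  have h3 : 0 ≤ ∑ m ∈ M, c m ^ 2 := Finset.sum_nonneg fun _ _ => sq_nonneg _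
  rcases h3.eq_or_lt with h4 | h4
  · rw [← h4]
    positivity
  · nlinarith

/-- A bilinear form with kernel `g (n₀ + s - m)` is small when `g` has small Fourier transform on
most windows `n₀ + s - M`. -/
theorem bilinear_pow_four_le (g : ℤ → ℝ) (hg : ∀ n, |g n| ≤ 1) (M S A : Finset ℤ) (good : Set ℤ)
    (α : ℝ) (hgood : ∀ n ∈ good, ∀ x : ℝ,
      ‖∑ m ∈ M, ((g (n - m) : ℝ) : ℂ) * expNeg m x‖ ≤ α * M.card)
    (n₀ : ℤ) (hA : ∀ s ∈ S, ∀ m ∈ M, s - m ∈ A) (hAcard : (A.card : ℝ) ≤ 2 * S.card)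
    (b : ℝ) (hb : (open Classical in ((S.filter fun s => n₀ + s ∉ good).card : ℝ)) ≤ b)
    (h c : ℤ → ℝ) (hh : ∀ s, |h s| ≤ 1) (hc : ∀ m, |c m| ≤ 1) :
    (∑ s ∈ S, ∑ m ∈ M, g (n₀ + s - m) * h s * c m) ^ 4
      ≤ (M.card : ℝ) ^ 4 * (S.card : ℝ) ^ 3 * (2 * α ^ 2 * S.card + b) := by
  classical
  set X := ∑ s ∈ S, ∑ m ∈ M, g (n₀ + s - m) * h s * c m with hX
  set R : ℤ → ℤ → ℝ := fun s s' => ∑ m ∈ M, g (n₀ + s - m) * g (n₀ + s' - m) with hR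
  have hgsq : ∀ n, g n ^ 2 ≤ 1 := fun n => by
    rw [← sq_abs]
    exact pow_le_one₀ (abs_nonneg _) (hg n)
  have hRle : ∀ s s', R s s' ^ 2 ≤ (M.card : ℝ) ^ 2 := by
    intro s s'
    rw [← sq_abs]
    refine pow_le_pow_left₀ (abs_nonneg _) ?_ 2
    refine (Finset.abs_sum_le_sum_abs _ _).trans ?_
    refine (Finset.sum_le_card_nsmul _ _ 1 fun m _ => ?_).trans (by simp)
    rw [abs_mul]
    exact mul_le_one₀ (hg _) (abs_nonneg _) (hg _)
  -- Cauchy–Schwarz in `m` removes `c`, and a second one in `(s, s')` removes `h`. There remains the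
  -- mean square of the correlations `R s s'`; for fixed `s'` these are convolutions of `g` with its
  -- own window at `n₀ + s'`.
  have h1 : X ^ 2 ≤ (M.card : ℝ) * ∑ s ∈ S, ∑ s' ∈ S, h s * h s' * R s s' := by
    have e1 : X = ∑ m ∈ M, c m * ∑ s ∈ S, g (n₀ + s - m) * h s := by
      rw [hX, Finset.sum_comm]
      refine Finset.sum_congr rfl fun m _ => ?_
      rw [Finset.mul_sum]
      refine Finset.sum_congr rfl fun s _ => ?_
      ring
    have e2 : ∑ s ∈ S, ∑ s' ∈ S, h s * h s' * R s s'
        = ∑ m ∈ M, (∑ s ∈ S, g (n₀ + s - m) * h s) ^ 2 := by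
      simp_rw [sq, Finset.sum_mul_sum]
      rw [Finset.sum_comm (s := M)]
      refine Finset.sum_congr rfl fun s _ => ?_
      rw [Finset.sum_comm (s := M)]
      refine Finset.sum_congr rfl fun s' _ => ?_
      rw [hR, Finset.mul_sum]
      refine Finset.sum_congr rfl fun m _ => ?_
      ring
    rw [e1, e2]
    refine (Finset.sum_mul_sq_le_sq_mul_sq _ _ _).trans ?_
    refine mul_le_mul_of_nonneg_right ?_ (Finset.sum_nonneg fun _ _ => sq_nonneg _)
    refine (Finset.sum_le_card_nsmul _ _ 1 fun m _ => ?_).trans (by simp)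
    rw [← sq_abs]
    exact pow_le_one₀ (abs_nonneg _) (hc m)
  have h2 : (∑ s ∈ S, ∑ s' ∈ S, h s * h s' * R s s') ^ 2
      ≤ (S.card : ℝ) ^ 2 * ∑ s' ∈ S, ∑ s ∈ S, R s s' ^ 2 := by
    rw [Finset.sum_comm (f := fun s' s => R s s' ^ 2), ← Finset.sum_product',
      ← Finset.sum_product']
    refine (Finset.sum_mul_sq_le_sq_mul_sq _ _ _).trans ?_
    refine mul_le_mul_of_nonneg_right ?_ (Finset.sum_nonneg fun _ _ => sq_nonneg _)
    refine (Finset.sum_le_card_nsmul _ _ 1 fun m _ => ?_).trans (by simp [sq])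
    rw [← sq_abs, abs_mul]
    exact pow_le_one₀ (by positivity) (mul_le_one₀ (hh _) (abs_nonneg _) (hh _))
  have h3 : ∀ s' ∈ S, ∑ s ∈ S, R s s' ^ 2 ≤ (M.card : ℝ) ^ 2 * (2 * α ^ 2 * S.card)
      + (M.card : ℝ) ^ 2 * S.card * (if n₀ + s' ∉ good then 1 else 0) := by
    intro s' _
    -- For a good window the convolution is small in `ℓ²`, and `|A| ≤ 2 |S|` produces the factor
    -- `2`. The bad windows get the trivial bound and are counted by `b`.
    by_cases hs' : n₀ + s' ∈ good
    · have h4 := sum_conv_sq_le A M S (fun u => g (n₀ + u)) (fun m => g (n₀ + s' - m)) _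
        (hgood _ hs') hA
      have h5 : ∑ u ∈ A, g (n₀ + u) ^ 2 ≤ 2 * S.card :=
        (Finset.sum_le_card_nsmul _ _ 1 fun m _ => hgsq _).trans (by simpa using hAcard)
      have h6 : ∑ s ∈ S, R s s' ^ 2
          = ∑ s ∈ S, (∑ m ∈ M, g (n₀ + (s - m)) * g (n₀ + s' - m)) ^ 2 := by
        simp_rw [hR, ← add_sub_assoc]
      simp only [hs', not_true, if_false, mul_zero, add_zero, h6]
      refine h4.trans ?_
      calc (α * (M.card : ℝ)) ^ 2 * ∑ u ∈ A, g (n₀ + u) ^ 2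
          ≤ (α * (M.card : ℝ)) ^ 2 * (2 * S.card) := by gcongr
        _ = _ := by ring
    · simp only [hs', not_false_iff, if_true, mul_one]
      have h7 : ∑ s ∈ S, R s s' ^ 2 ≤ S.card * (M.card : ℝ) ^ 2 :=
        (Finset.sum_le_card_nsmul _ _ _ fun s _ => hRle s s').trans (by simp)
      have h8 : 0 ≤ (M.card : ℝ) ^ 2 * (2 * α ^ 2 * S.card) := by positivity
      linarith
  have h4 : ∑ s' ∈ S, ∑ s ∈ S, R s s' ^ 2
      ≤ (M.card : ℝ) ^ 2 * S.card * (2 * α ^ 2 * S.card + b) := by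
    refine (Finset.sum_le_sum h3).trans ?_
    rw [Finset.sum_add_distrib, Finset.sum_const, nsmul_eq_mul, ← Finset.mul_sum,
      Finset.sum_boole]
    have h9 : (M.card : ℝ) ^ 2 * S.card * ((S.filter fun s => n₀ + s ∉ good).card : ℝ)
        ≤ (M.card : ℝ) ^ 2 * S.card * b := by
      gcongr
    linarith
  calc X ^ 4 = (X ^ 2) ^ 2 := by ring
    _ ≤ ((M.card : ℝ) * ∑ s ∈ S, ∑ s' ∈ S, h s * h s' * R s s') ^ 2 := by gcongr
    _ = (M.card : ℝ) ^ 2 * (∑ s ∈ S, ∑ s' ∈ S, h s * h s' * R s s') ^ 2 := by ring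
    _ ≤ (M.card : ℝ) ^ 2 * ((S.card : ℝ) ^ 2 *
          ((M.card : ℝ) ^ 2 * S.card * (2 * α ^ 2 * S.card + b))) := by
        gcongr
        exact h2.trans (by gcongr)
    _ = _ := by ring

/-- A linearised form of `bilinear_pow_four_le`. -/
theorem abs_bilinear_le (g : ℤ → ℝ) (hg : ∀ n, |g n| ≤ 1) (M S A : Finset ℤ) (good : Set ℤ)
    (ω : ℝ) (hω : 0 < ω) (hω' : 2 * ω ^ 12 ≤ 1) (hgood : ∀ n ∈ good, ∀ x : ℝ,
      ‖∑ m ∈ M, ((g (n - m) : ℝ) : ℂ) * expNeg m x‖ ≤ ω ^ 8 * M.card)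
    (n₀ : ℤ) (hA : ∀ s ∈ S, ∀ m ∈ M, s - m ∈ A) (hAcard : (A.card : ℝ) ≤ 2 * S.card)
    (b : ℝ) (hb : (open Classical in ((S.filter fun s => n₀ + s ∉ good).card : ℝ)) ≤ b)
    (h c : ℤ → ℝ) (hh : ∀ s, |h s| ≤ 1) (hc : ∀ m, |c m| ≤ 1) :
    |∑ s ∈ S, ∑ m ∈ M, g (n₀ + s - m) * h s * c m|
      ≤ M.card * (2 * ω * S.card + b / ω ^ 3) := by
  have h1 := bilinear_pow_four_le g hg M S A good (ω ^ 8) hgood n₀ hA hAcard b hb h c hh hc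
  set X := ∑ s ∈ S, ∑ m ∈ M, g (n₀ + s - m) * h s * c m
  have hb0 : 0 ≤ b := le_trans (Nat.cast_nonneg _) hb
  -- With `b = t ω³` the fourth powers compare as `ω⁴ k⁴ + (ω k)³ t ≤ (2 ω k + t)⁴`: both terms on
  -- the left occur in the binomial expansion on the right.
  obtain ⟨t, ht⟩ : ∃ t, t = b / ω ^ 3 := ⟨_, rfl⟩
  have ht0 : 0 ≤ t := by rw [ht]; positivity
  have hbt : b = t * ω ^ 3 := by rw [ht]; field_simp
  rw [← ht]
  have hk : (0 : ℝ) ≤ (S.card : ℝ) := Nat.cast_nonneg _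
  have hm : (0 : ℝ) ≤ (M.card : ℝ) := Nat.cast_nonneg _
  generalize (S.card : ℝ) = k at *
  generalize (M.card : ℝ) = m at *
  refine le_of_pow_le_pow_left₀ (n := 4) (by norm_num) (by positivity) ?_
  rw [← abs_pow, abs_of_nonneg (by positivity), mul_pow]
  refine h1.trans ?_
  rw [mul_assoc]
  refine mul_le_mul_of_nonneg_left ?_ (by positivity)
  have h2 : 2 * (ω ^ 8) ^ 2 ≤ ω ^ 4 := by
    have : ω ^ 4 * (2 * ω ^ 12) ≤ ω ^ 4 * 1 := by gcongr
    linarith [this]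
  calc k ^ 3 * (2 * (ω ^ 8) ^ 2 * k + b) ≤ k ^ 3 * (ω ^ 4 * k + t * ω ^ 3) := by
        rw [hbt]; gcongr
    _ = (ω * k) ^ 4 + (ω * k) ^ 3 * t := by ring
    _ ≤ (2 * ω * k + t) ^ 4 := by
        have hx : 0 ≤ ω * k := by positivity
        have : (2 * ω * k + t) = (2 * (ω * k) + t) := by ring
        rw [this]
        generalize ω * k = y at hx
        have : (2 * y + t) ^ 4 = 16 * y ^ 4 + 32 * (y ^ 3 * t) + 24 * (y ^ 2 * t ^ 2)
          + 8 * (y * t ^ 3) + t ^ 4 := by ring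
        rw [this]
        have a1 : 0 ≤ y ^ 4 := by positivity
        have a2 : 0 ≤ y ^ 3 * t := by positivity
        have a3 : 0 ≤ y ^ 2 * t ^ 2 := by positivity
        have a4 : 0 ≤ y * t ^ 3 := by positivity
        have a5 : 0 ≤ t ^ 4 := by positivity
        linarith

end

/-! ### Weighted box forms and change of scale -/

noncomputable section

theorem abs_sum_le_card_mul {ι : Type*} (S : Finset ι) (F : ι → ℝ) (C : ℝ)
    (hF : ∀ s ∈ S, |F s| ≤ C) : |∑ s ∈ S, F s| ≤ S.card * C :=
  (Finset.abs_sum_le_sum_abs _ _).trans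
    ((Finset.sum_le_card_nsmul _ _ C hF).trans (by simp))

/-- The bilinear form with kernel `k` is bounded by `η` on functions bounded by one. -/
def BilinearBound {σ ι : Type*} (S : Finset σ) (P : Finset ι) (k : σ → ι → ℝ) (η : ℝ) : Prop :=
  ∀ (h : σ → ℝ) (c : ι → ℝ), (∀ s, |h s| ≤ 1) → (∀ p, |c p| ≤ 1) →
    |∑ s ∈ S, ∑ p ∈ P, k s p * h s * c p| ≤ η

theorem BilinearBound.scaled {σ ι : Type*} {S : Finset σ} {P : Finset ι} {k : σ → ι → ℝ} {η : ℝ}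
    (hk : BilinearBound S P k η) {h : σ → ℝ} {c : ι → ℝ} {H C : ℝ} (hH : 0 < H) (hC : 0 < C)
    (hh : ∀ s, |h s| ≤ H) (hc : ∀ p, |c p| ≤ C) :
    |∑ s ∈ S, ∑ p ∈ P, k s p * h s * c p| ≤ H * C * η := by
  have h1 := hk (fun s => h s / H) (fun p => c p / C)
    (fun s => by rw [abs_div, abs_of_pos hH]; exact div_le_one_of_le₀ (hh s) hH.le)
    (fun p => by rw [abs_div, abs_of_pos hC]; exact div_le_one_of_le₀ (hc p) hC.le)
  have h2 : ∑ s ∈ S, ∑ p ∈ P, k s p * h s * c p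
      = H * C * ∑ s ∈ S, ∑ p ∈ P, k s p * (h s / H) * (c p / C) := by
    simp_rw [Finset.mul_sum]
    refine Finset.sum_congr rfl fun s _ => Finset.sum_congr rfl fun p _ => ?_
    field_simp
  rw [h2, abs_mul, abs_of_pos (mul_pos hH hC)]
  gcongr

/-- In a weighted second moment a kernel may be replaced by its mean `β`. -/
theorem sum_mul_sq_le_of_bilinear {σ ι : Type*} (S : Finset σ) (P : Finset ι) (b : σ → ι → ℝ)
    (hP : 0 < P.card) (hb : ∀ s p, |b s p| ≤ 1) (β η : ℝ) (hβ : |β| ≤ 1)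
    (hB : BilinearBound S P (fun s p => b s p - β) η) (h₀ : σ → ℝ) (hh₀ : ∀ s, |h₀ s| ≤ 1)
    (v : ι → ℝ) (hv : ∀ p, |v p| ≤ 1) :
    ∑ s ∈ S, h₀ s * (∑ p ∈ P, b s p * v p) ^ 2
      ≤ ∑ s ∈ S, h₀ s * (β ^ 2 * (∑ p ∈ P, v p) ^ 2) + 2 * P.card * η := by
  have hP' : (0 : ℝ) < P.card := by exact_mod_cast hP
  have hbd : ∀ s, |h₀ s * (∑ p ∈ P, b s p * v p + β * ∑ p ∈ P, v p)| ≤ 2 * P.card := by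
    intro s
    rw [abs_mul]
    have h1 : |∑ p ∈ P, b s p * v p| ≤ P.card * 1 := abs_sum_le_card_mul _ _ _ fun p _ => by
      rw [abs_mul]; exact mul_le_one₀ (hb s p) (abs_nonneg _) (hv p)
    have h2 : |∑ p ∈ P, v p| ≤ P.card * 1 := abs_sum_le_card_mul _ _ _ fun p _ => hv p
    have h3 : |β * ∑ p ∈ P, v p| ≤ P.card := by
      rw [abs_mul]
      calc |β| * |∑ p ∈ P, v p| ≤ 1 * (P.card * 1) := by gcongr
        _ = _ := by ring
    have h4 := abs_add_le (∑ p ∈ P, b s p * v p) (β * ∑ p ∈ P, v p)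
    calc |h₀ s| * |∑ p ∈ P, b s p * v p + β * ∑ p ∈ P, v p| ≤ 1 * (2 * P.card) := by
          gcongr
          · exact hh₀ s
          · linarith
      _ = _ := by ring
  have h1 := hB.scaled (by positivity) one_pos hbd hv
  -- A difference of squares: one factor is linear in the kernel `b - β`, the other depends on `s`
  -- alone, is at most `2 |P|`, and serves as test function.
  have h2 : ∑ s ∈ S, ∑ p ∈ P, (b s p - β) *
      (h₀ s * (∑ p ∈ P, b s p * v p + β * ∑ p ∈ P, v p)) * v p
      = ∑ s ∈ S, h₀ s * (∑ p ∈ P, b s p * v p) ^ 2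
        - ∑ s ∈ S, h₀ s * (β ^ 2 * (∑ p ∈ P, v p) ^ 2) := by
    rw [← Finset.sum_sub_distrib]
    refine Finset.sum_congr rfl fun s _ => ?_
    have h3 : ∑ p ∈ P, (b s p - β) * (h₀ s * (∑ p ∈ P, b s p * v p + β * ∑ p ∈ P, v p)) * v p
        = (h₀ s * (∑ p ∈ P, b s p * v p + β * ∑ p ∈ P, v p))
          * (∑ p ∈ P, b s p * v p - β * ∑ p ∈ P, v p) := by
      rw [Finset.mul_sum (f := v) (a := β), ← Finset.sum_sub_distrib, Finset.mul_sum]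
      refine Finset.sum_congr rfl fun p _ => ?_
      ring
    rw [h3]
    ring
  rw [h2] at h1
  have := (abs_le.1 h1).2
  linarith

/-- A weighted box form is at most the unweighted one, multiplied by the means of the weights, up to
an error controlled by the bilinear norms of the balanced weights. -/
theorem weighted_box_le {σ ι : Type*} (S : Finset σ) (P : Finset ι) (hP : 0 < P.card)
    (a b : σ → ι → ℝ) (u : ι → ι → ℝ) (ha : ∀ s p, |a s p| ≤ 1) (hb : ∀ s p, |b s p| ≤ 1)
    (hu : ∀ p q, |u p q| ≤ 1) (β₁ β₂ η₁ η₂ : ℝ) (hβ₁ : |β₁| ≤ 1) (hβ₂ : |β₂| ≤ 1)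
    (hA : BilinearBound S P (fun s p => a s p - β₁) η₁)
    (hB : BilinearBound S P (fun s p => b s p - β₂) η₂) :
    ∑ s ∈ S, ∑ q ∈ P, ∑ q' ∈ P, a s q * a s q' * (∑ p ∈ P, b s p * (u p q * u p q')) ^ 2
      ≤ β₁ ^ 2 * β₂ ^ 2 * S.card * ∑ q ∈ P, ∑ q' ∈ P, (∑ p ∈ P, u p q * u p q') ^ 2
        + (P.card : ℝ) ^ 3 * (2 * η₁ + 2 * η₂) := by
  have hP' : (0 : ℝ) < P.card := by exact_mod_cast hP
  set V : ι → ι → ℝ := fun q q' => (∑ p ∈ P, u p q * u p q') ^ 2 with hV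
  have hVle : ∀ q q', |V q q'| ≤ (P.card : ℝ) ^ 2 := by
    intro q q'
    rw [hV, abs_pow]
    refine pow_le_pow_left₀ (abs_nonneg _) ?_ 2
    refine (abs_sum_le_card_mul _ _ 1 fun p _ => ?_).trans (by simp)
    rw [abs_mul]
    exact mul_le_one₀ (hu _ _) (abs_nonneg _) (hu _ _)
  have hη₁ : 0 ≤ η₁ := (abs_nonneg _).trans (hA (fun _ => 0) (fun _ => 0) (by simp) (by simp))
  -- With `q, q'` frozen, the weight `b` under the square is replaced by `β₂`. Afterwards `h4` and
  -- `h6` replace the two factors `a` one at a time, each time with the other index frozen.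
  have h1 : ∑ s ∈ S, ∑ q ∈ P, ∑ q' ∈ P,
        a s q * a s q' * (∑ p ∈ P, b s p * (u p q * u p q')) ^ 2
      ≤ ∑ s ∈ S, ∑ q ∈ P, ∑ q' ∈ P, a s q * a s q' * (β₂ ^ 2 * V q q')
        + (P.card : ℝ) ^ 3 * (2 * η₂) := by
    rw [Finset.sum_comm, Finset.sum_comm (s := S)]
    have h2 : ∀ q ∈ P, ∑ s ∈ S, ∑ q' ∈ P,
          a s q * a s q' * (∑ p ∈ P, b s p * (u p q * u p q')) ^ 2
        ≤ ∑ s ∈ S, ∑ q' ∈ P, a s q * a s q' * (β₂ ^ 2 * V q q')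
          + (P.card : ℝ) ^ 2 * (2 * η₂) := by
      intro q _
      rw [Finset.sum_comm, Finset.sum_comm (s := S)]
      have h3 : ∀ q' ∈ P, ∑ s ∈ S,
            a s q * a s q' * (∑ p ∈ P, b s p * (u p q * u p q')) ^ 2
          ≤ ∑ s ∈ S, a s q * a s q' * (β₂ ^ 2 * V q q') + 2 * P.card * η₂ := fun q' _ =>
        sum_mul_sq_le_of_bilinear S P b hP hb β₂ η₂ hβ₂ hB (fun s => a s q * a s q')
          (fun s => by rw [abs_mul]; exact mul_le_one₀ (ha _ _) (abs_nonneg _) (ha _ _))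
          (fun p => u p q * u p q')
          (fun s => by rw [abs_mul]; exact mul_le_one₀ (hu _ _) (abs_nonneg _) (hu _ _))
      refine (Finset.sum_le_sum h3).trans ?_
      rw [Finset.sum_add_distrib, Finset.sum_const, nsmul_eq_mul]
      apply le_of_eq
      ring
    refine (Finset.sum_le_sum h2).trans ?_
    rw [Finset.sum_add_distrib, Finset.sum_const, nsmul_eq_mul]
    apply le_of_eq
    ring
  have h4 : |∑ s ∈ S, ∑ q ∈ P, ∑ q' ∈ P, (a s q - β₁) * a s q' * V q q'|
      ≤ (P.card : ℝ) ^ 3 * η₁ := by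
    have h5 : ∑ s ∈ S, ∑ q ∈ P, ∑ q' ∈ P, (a s q - β₁) * a s q' * V q q'
        = ∑ q' ∈ P, ∑ s ∈ S, ∑ q ∈ P, (a s q - β₁) * a s q' * V q q' := by
      rw [Finset.sum_comm (s := P)]
      refine Finset.sum_congr rfl fun s _ => ?_
      rw [Finset.sum_comm]
    rw [h5]
    refine (abs_sum_le_card_mul _ _ (1 * (P.card : ℝ) ^ 2 * η₁) fun q' _ => ?_).trans
      (le_of_eq (by ring))
    exact hA.scaled one_pos (by positivity) (fun s => ha s q') (fun q => hVle q q')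
  have h6 : |∑ s ∈ S, ∑ q ∈ P, ∑ q' ∈ P, (a s q' - β₁) * 1 * V q q'|
      ≤ (P.card : ℝ) ^ 3 * η₁ := by
    rw [Finset.sum_comm]
    refine (abs_sum_le_card_mul _ _ (1 * (P.card : ℝ) ^ 2 * η₁) fun q _ => ?_).trans
      (le_of_eq (by ring))
    exact hA.scaled one_pos (by positivity) (fun s => by simp) (fun q' => hVle q q')
  have h7 : ∑ s ∈ S, ∑ q ∈ P, ∑ q' ∈ P, a s q * a s q' * (β₂ ^ 2 * V q q')
      = β₂ ^ 2 * (∑ s ∈ S, ∑ q ∈ P, ∑ q' ∈ P, (a s q - β₁) * a s q' * V q q'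
        + β₁ * ∑ s ∈ S, ∑ q ∈ P, ∑ q' ∈ P, (a s q' - β₁) * 1 * V q q'
        + β₁ ^ 2 * (S.card * ∑ q ∈ P, ∑ q' ∈ P, V q q')) := by
    rw [← nsmul_eq_mul, ← Finset.sum_const]
    simp_rw [Finset.mul_sum, ← Finset.sum_add_distrib, Finset.mul_sum]
    refine Finset.sum_congr rfl fun s _ => Finset.sum_congr rfl fun q _ =>
      Finset.sum_congr rfl fun q' _ => ?_
    ring
  rw [h7] at h1
  obtain ⟨X, hX⟩ : ∃ X, X = ∑ s ∈ S, ∑ q ∈ P, ∑ q' ∈ P, (a s q - β₁) * a s q' * V q q' := ⟨_, rfl⟩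
  obtain ⟨Z, hZ⟩ : ∃ Z, Z = ∑ s ∈ S, ∑ q ∈ P, ∑ q' ∈ P, (a s q' - β₁) * 1 * V q q' := ⟨_, rfl⟩
  rw [← hX] at h4 h1
  rw [← hZ] at h6 h1
  have hb2 : β₂ ^ 2 ≤ 1 := by
    rw [← sq_abs]; exact pow_le_one₀ (abs_nonneg _) hβ₂
  have h8 : X + β₁ * Z ≤ (P.card : ℝ) ^ 3 * (2 * η₁) := by
    have e1 : β₁ * Z ≤ |β₁| * |Z| := by rw [← abs_mul]; exact le_abs_self _
    have e2 : |β₁| * |Z| ≤ 1 * ((P.card : ℝ) ^ 3 * η₁) := by gcongr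
    have e3 := le_abs_self X
    linarith
  have h9 : β₂ ^ 2 * (X + β₁ * Z) ≤ (P.card : ℝ) ^ 3 * (2 * η₁) := by
    have e4 : 0 ≤ (P.card : ℝ) ^ 3 * (2 * η₁) := by positivity
    calc β₂ ^ 2 * (X + β₁ * Z) ≤ β₂ ^ 2 * ((P.card : ℝ) ^ 3 * (2 * η₁)) := by gcongr
      _ ≤ 1 * ((P.card : ℝ) ^ 3 * (2 * η₁)) := by gcongr
      _ = _ := by ring
  refine h1.trans ?_
  linarith

/-- Both sides are the sum over `(w, w', q, q')` of the product of `A` over the four vertices of a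
rectangle, which is symmetric in the two coordinates. It lets an estimate in one coordinate be used
in the other. -/
theorem sum_sum_sq_comm {ι κ : Type*} (Q : Finset ι) (W : Finset κ) (A : κ → ι → ℝ) :
    ∑ q ∈ Q, ∑ q' ∈ Q, (∑ w ∈ W, A w q * A w q') ^ 2
      = ∑ w ∈ W, ∑ w' ∈ W, (∑ q ∈ Q, A w q * A w' q) ^ 2 := by
  simp_rw [sq, Finset.sum_mul_sum]
  calc ∑ q ∈ Q, ∑ q' ∈ Q, ∑ w ∈ W, ∑ w' ∈ W, A w q * A w q' * (A w' q * A w' q')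
      = ∑ q ∈ Q, ∑ w ∈ W, ∑ w' ∈ W, ∑ q' ∈ Q, A w q * A w q' * (A w' q * A w' q') := by
        refine Finset.sum_congr rfl fun q _ => ?_
        rw [Finset.sum_comm]
        refine Finset.sum_congr rfl fun w _ => ?_
        rw [Finset.sum_comm]
    _ = ∑ w ∈ W, ∑ w' ∈ W, ∑ q ∈ Q, ∑ q' ∈ Q, A w q * A w q' * (A w' q * A w' q') := by
        rw [Finset.sum_comm]
        refine Finset.sum_congr rfl fun w _ => ?_
        rw [Finset.sum_comm]
    _ = _ := by
        refine Finset.sum_congr rfl fun w _ => Finset.sum_congr rfl fun w' _ =>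
          Finset.sum_congr rfl fun q _ => Finset.sum_congr rfl fun q' _ => ?_
        ring

/-- The local box form of `f` at the point `(x, y)` at the scale of `W`. -/
def boxForm (W : Finset ℤ) (f : ℤ → ℤ → ℝ) (x y : ℤ) : ℝ :=
  ∑ v ∈ W, ∑ v' ∈ W, (∑ w ∈ W, f (x + w) (y + v) * f (x + w) (y + v')) ^ 2

theorem boxForm_nonneg (W : Finset ℤ) (f : ℤ → ℤ → ℝ) (x y : ℤ) : 0 ≤ boxForm W f x y :=
  Finset.sum_nonneg fun _ _ => Finset.sum_nonneg fun _ _ => sq_nonneg _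

theorem boxForm_le (W : Finset ℤ) (f : ℤ → ℤ → ℝ) (hf : ∀ x y, |f x y| ≤ 1) (x y : ℤ) :
    boxForm W f x y ≤ (W.card : ℝ) ^ 4 := by
  unfold boxForm
  refine (Finset.sum_le_card_nsmul _ _ ((W.card : ℝ) ^ 3) fun v _ => ?_).trans
    (le_of_eq (by rw [nsmul_eq_mul]; ring))
  refine (Finset.sum_le_card_nsmul _ _ ((W.card : ℝ) ^ 2) fun v' _ => ?_).trans
    (le_of_eq (by rw [nsmul_eq_mul]; ring))
  rw [← sq_abs]
  refine pow_le_pow_left₀ (abs_nonneg _) ?_ 2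
  refine (abs_sum_le_card_mul _ _ 1 fun p _ => ?_).trans (by simp)
  rw [abs_mul]
  exact mul_le_one₀ (hf _ _) (abs_nonneg _) (hf _ _)

theorem sum_shift_le (S S' : Finset ℤ) (t : ℤ) (h : ∀ x ∈ S, x + t ∈ S') (G : ℤ → ℝ)
    (hG : ∀ x, 0 ≤ G x) : ∑ x ∈ S, G (x + t) ≤ ∑ x ∈ S', G x := by
  classical
  rw [← Finset.sum_image (s := S) (g := fun x => x + t) (f := G)
    (by intro a _ b _ hab; simpa using hab)]
  refine Finset.sum_le_sum_of_subset_of_nonneg ?_ fun _ _ _ => hG _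
  intro y hy
  obtain ⟨x, hx, rfl⟩ := Finset.mem_image.1 hy
  exact h x hx

/-- Averaging over translates does not increase a sum of squares. -/
theorem sum_sq_translates_le {κ : Type*} (W : Finset ℤ) (N : Finset κ) (ν : κ → ℤ)
    (S S' : Finset ℤ) (h : ∀ x ∈ S, ∀ n ∈ N, x + ν n ∈ S') (φ : ℤ → ℝ) :
    ∑ x ∈ S, (∑ p ∈ W ×ˢ N, φ (x + (p.1 + ν p.2))) ^ 2
      ≤ (N.card : ℝ) ^ 2 * ∑ x ∈ S', (∑ w ∈ W, φ (x + w)) ^ 2 := by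
  have h1 : ∀ x ∈ S, (∑ p ∈ W ×ˢ N, φ (x + (p.1 + ν p.2))) ^ 2
      ≤ N.card * ∑ n ∈ N, (∑ w ∈ W, φ (x + ν n + w)) ^ 2 := by
    intro x _
    rw [Finset.sum_product_right]
    refine (sq_sum_le_card_mul_sum_sq).trans (le_of_eq ?_)
    congr 1
    refine Finset.sum_congr rfl fun n _ => ?_
    congr 1
    refine Finset.sum_congr rfl fun w _ => ?_
    congr 1
    ring
  refine (Finset.sum_le_sum h1).trans ?_
  rw [← Finset.mul_sum, Finset.sum_comm, sq, mul_assoc]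
  refine mul_le_mul_of_nonneg_left ?_ (Nat.cast_nonneg _)
  refine (Finset.sum_le_card_nsmul _ _ _ fun n hn => ?_).trans (le_of_eq (nsmul_eq_mul _ _))
  exact sum_shift_le S S' (ν n) (fun x hx => h x hx n hn)
    (fun x => (∑ w ∈ W, φ (x + w)) ^ 2) fun _ => sq_nonneg _

/-- The box form at a coarse scale `W + ν N` is dominated by the box forms at the fine scale `W`. -/
theorem sum_box_coarse_le {κ : Type*} (W : Finset ℤ) (N : Finset κ) (ν : κ → ℤ)
    (S S' Y Y' : Finset ℤ) (hS : ∀ x ∈ S, ∀ n ∈ N, x + ν n ∈ S')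
    (hY : ∀ y ∈ Y, ∀ n ∈ N, y + ν n ∈ Y') (f : ℤ → ℤ → ℝ) :
    ∑ x ∈ S, ∑ y ∈ Y, ∑ q ∈ W ×ˢ N, ∑ q' ∈ W ×ˢ N,
        (∑ p ∈ W ×ˢ N, f (x + (p.1 + ν p.2)) (y + (q.1 + ν q.2))
          * f (x + (p.1 + ν p.2)) (y + (q'.1 + ν q'.2))) ^ 2
      ≤ (N.card : ℝ) ^ 4 * ∑ x ∈ S', ∑ y ∈ Y', boxForm W f x y := by
  calc ∑ x ∈ S, ∑ y ∈ Y, ∑ q ∈ W ×ˢ N, ∑ q' ∈ W ×ˢ N,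
        (∑ p ∈ W ×ˢ N, f (x + (p.1 + ν p.2)) (y + (q.1 + ν q.2))
          * f (x + (p.1 + ν p.2)) (y + (q'.1 + ν q'.2))) ^ 2
      = ∑ y ∈ Y, ∑ q ∈ W ×ˢ N, ∑ q' ∈ W ×ˢ N, ∑ x ∈ S,
        (∑ p ∈ W ×ˢ N, f (x + (p.1 + ν p.2)) (y + (q.1 + ν q.2))
          * f (x + (p.1 + ν p.2)) (y + (q'.1 + ν q'.2))) ^ 2 := by
        rw [Finset.sum_comm]
        refine Finset.sum_congr rfl fun y _ => ?_
        rw [Finset.sum_comm]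
        refine Finset.sum_congr rfl fun q _ => ?_
        rw [Finset.sum_comm]
    -- The shifts `ν n` of the first coordinate are averaged out; the two values in the second
    -- coordinate are fixed meanwhile.
    _ ≤ ∑ y ∈ Y, ∑ q ∈ W ×ˢ N, ∑ q' ∈ W ×ˢ N, (N.card : ℝ) ^ 2 * ∑ x ∈ S',
        (∑ w ∈ W, f (x + w) (y + (q.1 + ν q.2)) * f (x + w) (y + (q'.1 + ν q'.2))) ^ 2 :=
        Finset.sum_le_sum fun y _ => Finset.sum_le_sum fun q _ => Finset.sum_le_sum fun q' _ =>
          sum_sq_translates_le W N ν S S' hS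
            (fun x => f x (y + (q.1 + ν q.2)) * f x (y + (q'.1 + ν q'.2)))
    _ = (N.card : ℝ) ^ 2 * ∑ x ∈ S', ∑ y ∈ Y, ∑ q ∈ W ×ˢ N, ∑ q' ∈ W ×ˢ N,
        (∑ w ∈ W, f (x + w) (y + (q.1 + ν q.2)) * f (x + w) (y + (q'.1 + ν q'.2))) ^ 2 := by
        simp_rw [← Finset.mul_sum]
        congr 1
        rw [Finset.sum_comm (s := S')]
        refine Finset.sum_congr rfl fun y _ => ?_
        rw [Finset.sum_comm (s := S')]
        refine Finset.sum_congr rfl fun q _ => ?_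
        rw [Finset.sum_comm (s := S')]
    -- The rectangle symmetry puts the second coordinate under the square, so that its shifts can be
    -- averaged out in the same way.
    _ = (N.card : ℝ) ^ 2 * ∑ x ∈ S', ∑ w ∈ W, ∑ w' ∈ W, ∑ y ∈ Y,
        (∑ q ∈ W ×ˢ N, f (x + w) (y + (q.1 + ν q.2)) * f (x + w') (y + (q.1 + ν q.2))) ^ 2 := by
        congr 1
        refine Finset.sum_congr rfl fun x _ => ?_
        calc _ = ∑ y ∈ Y, ∑ w ∈ W, ∑ w' ∈ W, (∑ q ∈ W ×ˢ N,
              f (x + w) (y + (q.1 + ν q.2)) * f (x + w') (y + (q.1 + ν q.2))) ^ 2 :=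
              Finset.sum_congr rfl fun y _ => sum_sum_sq_comm (W ×ˢ N) W
                (fun w q => f (x + w) (y + (q.1 + ν q.2)))
          _ = _ := by
              rw [Finset.sum_comm]
              refine Finset.sum_congr rfl fun w _ => ?_
              rw [Finset.sum_comm]
    _ ≤ (N.card : ℝ) ^ 2 * ∑ x ∈ S', ∑ w ∈ W, ∑ w' ∈ W, (N.card : ℝ) ^ 2 * ∑ y ∈ Y',
        (∑ v ∈ W, f (x + w) (y + v) * f (x + w') (y + v)) ^ 2 := by
        refine mul_le_mul_of_nonneg_left ?_ (by positivity)
        exact Finset.sum_le_sum fun x _ => Finset.sum_le_sum fun w _ =>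
          Finset.sum_le_sum fun w' _ =>
            sum_sq_translates_le W N ν Y Y' hY (fun y => f (x + w) y * f (x + w') y)
    _ = (N.card : ℝ) ^ 4 * ∑ x ∈ S', ∑ y ∈ Y', boxForm W f x y := by
        simp_rw [← Finset.mul_sum]
        rw [← mul_assoc]
        congr 1
        · ring
        refine Finset.sum_congr rfl fun x _ => ?_
        calc _ = ∑ y ∈ Y', ∑ w ∈ W, ∑ w' ∈ W,
              (∑ v ∈ W, f (x + w) (y + v) * f (x + w') (y + v)) ^ 2 := by
              rw [Finset.sum_comm (s := Y')]
              refine Finset.sum_congr rfl fun w _ => ?_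
              rw [Finset.sum_comm (s := Y')]
          _ = _ := Finset.sum_congr rfl fun y _ =>
              (sum_sum_sq_comm W W (fun w v => f (x + w) (y + v))).symm

end

/-! ### Corner sums and the two applications of Cauchy–Schwarz -/

noncomputable section

theorem sum_shift_eq (S T : Finset ℤ) (t : ℤ) (G : ℤ → ℝ) (hG : ∀ x, G x ≠ 0 → x ∈ T)
    (h : ∀ x ∈ T, x - t ∈ S) : ∑ x ∈ S, G (x + t) = ∑ x ∈ T, G x := by
  classical
  rw [← Finset.sum_image (s := S) (g := fun x => x + t) (f := G)
    (by intro a _ b _ hab; simpa using hab)]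
  symm
  refine Finset.sum_subset (fun x hx => Finset.mem_image.2 ⟨x - t, h x hx, by ring⟩) ?_
  intro x _ hx
  by_contra hne
  exact hx (hG x hne)

/-- The Cauchy–Schwarz inequality for a sum whose first factor is dominated by a weight. -/
theorem sum_mul_sq_le_weight {ι : Type*} (S : Finset ι) (h k u : ι → ℝ)
    (hk : ∀ i ∈ S, |h i| ≤ k i) :
    (∑ i ∈ S, h i * u i) ^ 2 ≤ (∑ i ∈ S, k i) * ∑ i ∈ S, k i * u i ^ 2 := by
  have hk0 : ∀ i ∈ S, 0 ≤ k i := fun i hi => (abs_nonneg _).trans (hk i hi)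
  have h1 : |∑ i ∈ S, h i * u i| ≤ ∑ i ∈ S, √(k i) * (√(k i) * |u i|) := by
    refine (Finset.abs_sum_le_sum_abs _ _).trans (Finset.sum_le_sum fun i hi => ?_)
    rw [abs_mul, ← mul_assoc, Real.mul_self_sqrt (hk0 i hi)]
    exact mul_le_mul_of_nonneg_right (hk i hi) (abs_nonneg _)
  rw [← sq_abs]
  refine (pow_le_pow_left₀ (abs_nonneg _) h1 2).trans
    ((Finset.sum_mul_sq_le_sq_mul_sq _ _ _).trans (le_of_eq ?_))
  congr 1
  · exact Finset.sum_congr rfl fun i hi => Real.sq_sqrt (hk0 i hi)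
  · refine Finset.sum_congr rfl fun i hi => ?_
    rw [mul_pow, Real.sq_sqrt (hk0 i hi), sq_abs]

/-- The weighted count of the corners `(x, y), (s, y), (x, y + s - x)`, with weights `f` and `a`. -/
def cornerSum (L L₂ : Finset ℤ) (f a : ℤ → ℤ → ℝ) : ℝ :=
  ∑ x ∈ L, ∑ y ∈ L₂, ∑ s ∈ L, f x y * a s y * a x (y + s - x)

/-- The corner sum may be averaged over translates of its three variables. -/
theorem card_sq_mul_cornerSum {ι : Type*} (L L₂ S Y : Finset ℤ) (P : Finset ι) (o : ι → ℤ)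
    (f a : ℤ → ℤ → ℝ) (hf : ∀ x y, f x y ≠ 0 → x ∈ L ∧ y ∈ L₂)
    (ha : ∀ x y, a x y ≠ 0 → x ∈ L ∧ y ∈ L₂)
    (hS : ∀ x ∈ L, ∀ p ∈ P, x - o p ∈ S) (hS' : ∀ x ∈ L, ∀ p ∈ P, x + o p ∈ S)
    (hY : ∀ y ∈ L₂, ∀ p ∈ P, y - o p ∈ Y) :
    (P.card : ℝ) ^ 2 * cornerSum L L₂ f a
      = ∑ x ∈ S, ∑ s ∈ S, ∑ y ∈ Y, ∑ p ∈ P, ∑ q ∈ P,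
          f (x + o p) (y + o q) * a (s - o q) (y + o q) * a (x + o p) (y + s - x - o p) := by
  -- The substitution `x + o p`, `s - o q`, `y + o q` is chosen so that the point `(s, y)` does not
  -- depend on `p` and the point `(x, y + s - x)` does not depend on `q`. This is what permits the
  -- two applications of Cauchy–Schwarz.
  have key : ∀ p ∈ P, ∀ q ∈ P, ∑ x ∈ S, ∑ s ∈ S, ∑ y ∈ Y,
      f (x + o p) (y + o q) * a (s - o q) (y + o q) * a (x + o p) (y + s - x - o p)
      = cornerSum L L₂ f a := by
    intro p hp q hq
    have e1 : ∀ x s y : ℤ,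
        f (x + o p) (y + o q) * a (s - o q) (y + o q) * a (x + o p) (y + s - x - o p)
        = (fun x' s' y' => f x' y' * a s' y' * a x' (y' + s' - x'))
          (x + o p) (s + -o q) (y + o q) := by
      intro x s y
      simp only [← sub_eq_add_neg]
      congr 2
      ring
    simp_rw [e1]
    rw [sum_shift_eq S L (o p) (fun x' => ∑ s ∈ S, ∑ y ∈ Y,
      (fun x' s' y' => f x' y' * a s' y' * a x' (y' + s' - x')) x' (s + -o q) (y + o q))]
    · unfold cornerSum
      refine Finset.sum_congr rfl fun x _ => ?_
      rw [sum_shift_eq S L (-o q) (fun s' => ∑ y ∈ Y,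
        (fun x' s' y' => f x' y' * a s' y' * a x' (y' + s' - x')) x s' (y + o q))]
      · rw [Finset.sum_comm]
        rw [sum_shift_eq Y L₂ (o q) (fun y' => ∑ s ∈ L,
          (fun x' s' y' => f x' y' * a s' y' * a x' (y' + s' - x')) x s y')]
        · intro y hy
          by_contra hne
          refine hy (Finset.sum_eq_zero fun s _ => ?_)
          have : f x y = 0 := by
            by_contra h
            exact hne (hf x y h).2
          simp [this]
        · exact fun y hy => hY y hy q hq
      · intro s hs
        by_contra hne
        refine hs (Finset.sum_eq_zero fun y _ => ?_)
        have : a s (y + o q) = 0 := by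
          by_contra h
          exact hne (ha _ _ h).1
        simp [this]
      · intro s hs
        rw [sub_neg_eq_add]
        exact hS' s hs q hq
    · intro x hx
      by_contra hne
      refine hx (Finset.sum_eq_zero fun s _ => Finset.sum_eq_zero fun y _ => ?_)
      have : f x (y + o q) = 0 := by
        by_contra h
        exact hne (hf _ _ h).1
      simp [this]
    · exact fun x hx => hS x hx p hp
  calc (P.card : ℝ) ^ 2 * cornerSum L L₂ f a
      = ∑ p ∈ P, ∑ q ∈ P, cornerSum L L₂ f a := by
        simp only [Finset.sum_const, nsmul_eq_mul]
        ring
    _ = ∑ p ∈ P, ∑ q ∈ P, ∑ x ∈ S, ∑ s ∈ S, ∑ y ∈ Y,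
          f (x + o p) (y + o q) * a (s - o q) (y + o q) * a (x + o p) (y + s - x - o p) :=
        Finset.sum_congr rfl fun p hp => Finset.sum_congr rfl fun q hq => (key p hp q hq).symm
    _ = ∑ t ∈ P ×ˢ P, ∑ r ∈ S ×ˢ S ×ˢ Y,
          f (r.1 + o t.1) (r.2.2 + o t.2) * a (r.2.1 - o t.2) (r.2.2 + o t.2)
            * a (r.1 + o t.1) (r.2.2 + r.2.1 - r.1 - o t.1) := by
        simp_rw [Finset.sum_product]
    _ = _ := by
        rw [Finset.sum_comm]
        simp_rw [Finset.sum_product]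

/-- The relative generalised von Neumann inequality: two applications of the Cauchy–Schwarz
inequality bound the corner sum by a weighted box form. -/
theorem cornerSum_pow_four_le {ι : Type*} (L L₂ S Y : Finset ℤ) (P : Finset ι) (o : ι → ℤ)
    (f a : ℤ → ℤ → ℝ) (e₁ e₂ : ℤ → ℝ) (hf : ∀ x y, f x y ≠ 0 → x ∈ L ∧ y ∈ L₂)
    (ha : ∀ x y, a x y ≠ 0 → x ∈ L ∧ y ∈ L₂)
    (he₁ : ∀ x, 0 ≤ e₁ x) (he₂ : ∀ x, 0 ≤ e₂ x) (he₁' : ∀ x, e₁ x ≤ 1)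
    (he₂' : ∀ x, e₂ x ≤ 1)
    (he₂L : ∀ y, e₂ y ≠ 0 → y ∈ L₂)
    (hae : ∀ x y, |a x y| ≤ e₁ x * e₂ y)
    (hS : ∀ x ∈ L, ∀ p ∈ P, x - o p ∈ S) (hS' : ∀ x ∈ L, ∀ p ∈ P, x + o p ∈ S)
    (hY : ∀ y ∈ L₂, ∀ p ∈ P, y - o p ∈ Y) :
    ((P.card : ℝ) ^ 2 * cornerSum L L₂ f a) ^ 4
      ≤ (P.card * (S.card * ((∑ x ∈ L, e₁ x) * ∑ y ∈ L₂, e₂ y))) ^ 2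
        * (S.card * ∑ y ∈ Y, ∑ s ∈ S, (∑ q ∈ P, e₁ (s - o q) * e₂ (y + o q)) ^ 2)
        * ∑ x ∈ S, ∑ y ∈ Y, ∑ s ∈ S, ∑ q ∈ P, ∑ q' ∈ P, e₁ (s - o q) * e₁ (s - o q')
          * (∑ p ∈ P, e₂ (y + s - x - o p)
            * (f (x + o p) (y + o q) * f (x + o p) (y + o q'))) ^ 2 := by
  classical
  set X := (P.card : ℝ) ^ 2 * cornerSum L L₂ f a with hX
  -- The weight `e₁` is cut off at `L`, since its sum over the larger set `S` would otherwise exceed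
  -- the sum over `L`.
  set lam : ℤ → ℝ := fun x => if x ∈ L then e₁ x else 0 with hlam
  have hlam0 : ∀ x, 0 ≤ lam x := fun x => by
    simp only [hlam]; split_ifs <;> simp [he₁]
  have hlam1 : ∀ x, lam x ≤ 1 := fun x => by
    simp only [hlam]; split_ifs <;> simp [he₁']
  have hal : ∀ x y, |a x y| ≤ lam x * e₂ y := by
    intro x y
    by_cases hx : x ∈ L
    · simpa [hlam, hx] using hae x y
    · have : a x y = 0 := by
        by_contra h
        exact hx (ha x y h).1
      simp [hlam, hx, this]
  -- The first Cauchy–Schwarz runs over `(x, s, y, p)`, because the third point of the corner is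
  -- free of `q`. Its majorant `lam * e₂` stays as a weight in the first factor; in the second only
  -- `e₂` is kept.
  set Q1 := ∑ x ∈ S, ∑ s ∈ S, ∑ y ∈ Y, ∑ p ∈ P, e₂ (y + s - x - o p)
    * (∑ q ∈ P, f (x + o p) (y + o q) * a (s - o q) (y + o q)) ^ 2 with hQ1
  have h1 : X ^ 2 ≤ (P.card * (S.card * ((∑ x ∈ L, e₁ x) * ∑ y ∈ L₂, e₂ y))) * Q1 := by
    rw [hX, card_sq_mul_cornerSum L L₂ S Y P o f a hf ha hS hS' hY]
    have e1 : ∑ x ∈ S, ∑ s ∈ S, ∑ y ∈ Y, ∑ p ∈ P, ∑ q ∈ P,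
          f (x + o p) (y + o q) * a (s - o q) (y + o q) * a (x + o p) (y + s - x - o p)
        = ∑ i ∈ S ×ˢ S ×ˢ Y ×ˢ P, a (i.1 + o i.2.2.2) (i.2.2.1 + i.2.1 - i.1 - o i.2.2.2)
          * ∑ q ∈ P, f (i.1 + o i.2.2.2) (i.2.2.1 + o q) * a (i.2.1 - o q) (i.2.2.1 + o q) := by
      simp_rw [Finset.sum_product, Finset.mul_sum]
      refine Finset.sum_congr rfl fun x _ => Finset.sum_congr rfl fun s _ =>
        Finset.sum_congr rfl fun y _ => Finset.sum_congr rfl fun p _ =>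
          Finset.sum_congr rfl fun q _ => ?_
      ring
    rw [e1]
    refine (sum_mul_sq_le_weight _ _
      (fun i : ℤ × ℤ × ℤ × ι => lam (i.1 + o i.2.2.2) * e₂ (i.2.2.1 + i.2.1 - i.1 - o i.2.2.2)) _
      fun i _ => hal _ _).trans ?_
    refine mul_le_mul ?_ ?_ (Finset.sum_nonneg fun i _ =>
      mul_nonneg (mul_nonneg (hlam0 _) (he₂ _)) (sq_nonneg _)) ?_
    · simp_rw [Finset.sum_product]
      have e2 : ∑ x ∈ S, ∑ s ∈ S, ∑ y ∈ Y, ∑ p ∈ P, lam (x + o p) * e₂ (y + s - x - o p)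
          = ∑ p ∈ P, ∑ s ∈ S, ∑ x ∈ S, lam (x + o p) * ∑ y ∈ Y, e₂ (y + (s - x - o p)) := by
        calc _ = ∑ x ∈ S, ∑ s ∈ S, ∑ p ∈ P, ∑ y ∈ Y, lam (x + o p) * e₂ (y + s - x - o p) :=
              Finset.sum_congr rfl fun x _ => Finset.sum_congr rfl fun s _ => Finset.sum_comm
          _ = ∑ s ∈ S, ∑ p ∈ P, ∑ x ∈ S, ∑ y ∈ Y, lam (x + o p) * e₂ (y + s - x - o p) := by
              rw [Finset.sum_comm]
              exact Finset.sum_congr rfl fun s _ => Finset.sum_comm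
          _ = _ := by
              rw [Finset.sum_comm]
              refine Finset.sum_congr rfl fun p _ => Finset.sum_congr rfl fun s _ =>
                Finset.sum_congr rfl fun x _ => ?_
              rw [Finset.mul_sum]
              refine Finset.sum_congr rfl fun y _ => ?_
              congr 2
              ring
      rw [e2]
      have e3 : ∀ t : ℤ, ∑ y ∈ Y, e₂ (y + t) ≤ ∑ y ∈ L₂, e₂ y := by
        intro t
        rw [← Finset.sum_filter_of_ne (s := Y) (p := fun y => y + t ∈ L₂)
          (fun y _ h => he₂L _ h)]
        exact sum_shift_le _ L₂ t (fun y hy => (Finset.mem_filter.1 hy).2) e₂ he₂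
      have e4 : ∀ p ∈ P, ∑ x ∈ S, lam (x + o p) = ∑ x ∈ L, e₁ x := by
        intro p hp
        rw [sum_shift_eq S L (o p) lam]
        · exact Finset.sum_congr rfl fun x hx => by simp [hlam, hx]
        · intro x hx
          by_contra h
          exact hx (by simp [hlam, h])
        · exact fun x hx => hS x hx p hp
      refine (Finset.sum_le_card_nsmul _ _ (S.card * ((∑ x ∈ L, e₁ x) * ∑ y ∈ L₂, e₂ y))
        fun p hp => ?_).trans (le_of_eq (nsmul_eq_mul _ _))
      refine (Finset.sum_le_card_nsmul _ _ ((∑ x ∈ L, e₁ x) * ∑ y ∈ L₂, e₂ y)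
        fun s _ => ?_).trans (le_of_eq (nsmul_eq_mul _ _))
      rw [← e4 p hp, Finset.sum_mul]
      exact Finset.sum_le_sum fun x _ => mul_le_mul_of_nonneg_left (e3 _) (hlam0 _)
    · rw [hQ1]
      simp_rw [Finset.sum_product]
      refine Finset.sum_le_sum fun x _ => Finset.sum_le_sum fun s _ =>
        Finset.sum_le_sum fun y _ => Finset.sum_le_sum fun p _ => ?_
      refine mul_le_mul_of_nonneg_right ?_ (sq_nonneg _)
      exact mul_le_of_le_one_left (he₂ _) (hlam1 _)
    · have : 0 ≤ ∑ x ∈ L, e₁ x := Finset.sum_nonneg fun _ _ => he₁ _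
      have : 0 ≤ ∑ x ∈ L₂, e₂ x := Finset.sum_nonneg fun _ _ => he₂ _
      positivity
  -- Opening the square in `q` leaves the product of `a` at `(s - o q, y + o q)` and `(s - o q', y +
  -- o q')`, which is free of `p`. The second Cauchy–Schwarz removes it and leaves the weights `e₁`.
  have h2 : Q1 ^ 2 ≤ (S.card * ∑ y ∈ Y, ∑ s ∈ S, (∑ q ∈ P, e₁ (s - o q) * e₂ (y + o q)) ^ 2)
        * ∑ x ∈ S, ∑ y ∈ Y, ∑ s ∈ S, ∑ q ∈ P, ∑ q' ∈ P, e₁ (s - o q) * e₁ (s - o q')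
          * (∑ p ∈ P, e₂ (y + s - x - o p)
            * (f (x + o p) (y + o q) * f (x + o p) (y + o q'))) ^ 2 := by
    have e1 : Q1 = ∑ i ∈ S ×ˢ Y ×ˢ S ×ˢ P ×ˢ P,
        (a (i.2.2.1 - o i.2.2.2.1) (i.2.1 + o i.2.2.2.1)
          * a (i.2.2.1 - o i.2.2.2.2) (i.2.1 + o i.2.2.2.2))
        * ∑ p ∈ P, e₂ (i.2.1 + i.2.2.1 - i.1 - o p)
          * (f (i.1 + o p) (i.2.1 + o i.2.2.2.1) * f (i.1 + o p) (i.2.1 + o i.2.2.2.2)) := by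
      rw [hQ1]
      simp_rw [Finset.sum_product]
      refine Finset.sum_congr rfl fun x _ => ?_
      rw [Finset.sum_comm]
      refine Finset.sum_congr rfl fun y _ => Finset.sum_congr rfl fun s _ => ?_
      simp_rw [sq, Finset.sum_mul_sum, Finset.mul_sum]
      rw [Finset.sum_comm]
      refine Finset.sum_congr rfl fun q _ => ?_
      rw [Finset.sum_comm]
      refine Finset.sum_congr rfl fun q' _ => Finset.sum_congr rfl fun p _ => ?_
      ring
    rw [e1]
    refine (sum_mul_sq_le_weight _ _
      (fun i : ℤ × ℤ × ℤ × ι × ι => (e₁ (i.2.2.1 - o i.2.2.2.1) * e₂ (i.2.1 + o i.2.2.2.1))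
        * (e₁ (i.2.2.1 - o i.2.2.2.2) * e₂ (i.2.1 + o i.2.2.2.2))) _ fun i _ => ?_).trans ?_
    · rw [abs_mul]
      exact mul_le_mul (hae _ _) (hae _ _) (abs_nonneg _) (mul_nonneg (he₁ _) (he₂ _))
    refine mul_le_mul ?_ ?_ (Finset.sum_nonneg fun i _ => mul_nonneg (mul_nonneg
      (mul_nonneg (he₁ _) (he₂ _)) (mul_nonneg (he₁ _) (he₂ _))) (sq_nonneg _)) ?_
    · simp_rw [Finset.sum_product, sq, Finset.sum_mul_sum, Finset.sum_const, nsmul_eq_mul]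
      exact le_rfl
    · simp_rw [Finset.sum_product]
      refine Finset.sum_le_sum fun x _ => Finset.sum_le_sum fun y _ =>
        Finset.sum_le_sum fun s _ => Finset.sum_le_sum fun q _ => Finset.sum_le_sum fun q' _ => ?_
      refine mul_le_mul_of_nonneg_right ?_ (sq_nonneg _)
      exact mul_le_mul (mul_le_of_le_one_right (he₁ _) (he₂' _))
        (mul_le_of_le_one_right (he₁ _) (he₂' _)) (mul_nonneg (he₁ _) (he₂ _)) (he₁ _)
    · refine mul_nonneg (Nat.cast_nonneg _) (Finset.sum_nonneg fun _ _ =>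
        Finset.sum_nonneg fun _ _ => sq_nonneg _)
  have h3 : 0 ≤ P.card * (S.card * ((∑ x ∈ L, e₁ x) * ∑ y ∈ L₂, e₂ y)) := by
    have : 0 ≤ ∑ x ∈ L, e₁ x := Finset.sum_nonneg fun _ _ => he₁ _
    have : 0 ≤ ∑ x ∈ L₂, e₂ x := Finset.sum_nonneg fun _ _ => he₂ _
    positivity
  calc X ^ 4 = (X ^ 2) ^ 2 := by ring
    _ ≤ ((P.card * (S.card * ((∑ x ∈ L, e₁ x) * ∑ y ∈ L₂, e₂ y))) * Q1) ^ 2 := by gcongr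
    _ = (P.card * (S.card * ((∑ x ∈ L, e₁ x) * ∑ y ∈ L₂, e₂ y))) ^ 2 * Q1 ^ 2 := by ring
    _ ≤ _ := by
        rw [mul_assoc]
        gcongr

end

/-! ### The von Neumann inequality relative to uniform weights -/

noncomputable section

theorem sum_sum_linear (S Y : Finset ℤ) (G ζ : ℤ → ℤ → ℝ) (c d k m : ℝ) :
    ∑ x ∈ S, ∑ y ∈ Y, (c * G x y + d * (k + 2 * (m * ζ x y)))
      = c * ∑ x ∈ S, ∑ y ∈ Y, G x y
        + d * (S.card * Y.card * k + 2 * m * ∑ x ∈ S, ∑ y ∈ Y, ζ x y) := by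
  simp only [Finset.sum_add_distrib, ← Finset.mul_sum, Finset.sum_const, nsmul_eq_mul]
  ring

set_option maxHeartbeats 1000000 in
/-- The corner sum of a function with small box form at the scale of `W`, relative to sets that are
uniform at the scale of `W + ν N`. -/
theorem cornerSum_pow_four_le_of_uniform {κ : Type*} (W : Finset ℤ) (N : Finset κ) (ν : κ → ℤ)
    (hW : 0 < W.card) (hN : 0 < N.card)
    (L L₂ S S' Y Y' : Finset ℤ)
    (f a : ℤ → ℤ → ℝ) (e₁ e₂ : ℤ → ℝ) (hf : ∀ x y, f x y ≠ 0 → x ∈ L ∧ y ∈ L₂)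
    (hf1 : ∀ x y, |f x y| ≤ 1)
    (ha : ∀ x y, a x y ≠ 0 → x ∈ L ∧ y ∈ L₂)
    (he₁ : ∀ x, 0 ≤ e₁ x) (he₂ : ∀ x, 0 ≤ e₂ x) (he₁' : ∀ x, e₁ x ≤ 1) (he₂' : ∀ x, e₂ x ≤ 1)
    (he₂L : ∀ y, e₂ y ≠ 0 → y ∈ L₂)
    (hae : ∀ x y, |a x y| ≤ e₁ x * e₂ y)
    (hS : ∀ x ∈ L, ∀ w ∈ W, ∀ n ∈ N, x - (w + ν n) ∈ S)
    (hS' : ∀ x ∈ L, ∀ w ∈ W, ∀ n ∈ N, x + (w + ν n) ∈ S)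
    (hY : ∀ y ∈ L₂, ∀ w ∈ W, ∀ n ∈ N, y - (w + ν n) ∈ Y)
    (hSN : ∀ x ∈ S, ∀ n ∈ N, x + ν n ∈ S') (hYN : ∀ y ∈ Y, ∀ n ∈ N, y + ν n ∈ Y')
    (β₁ β₂ η B K₁ K₂ : ℝ) (hβ₁ : 0 ≤ β₁) (hβ₁' : β₁ ≤ 1) (hβ₂ : 0 ≤ β₂) (hβ₂' : β₂ ≤ 1)
    (hη : 0 ≤ η) (hK₁ : ∑ x ∈ L, e₁ x ≤ K₁) (hK₂ : ∑ y ∈ L₂, e₂ y ≤ K₂)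
    (hU₁ : BilinearBound S (W ×ˢ N) (fun s q => e₁ (s - (q.1 + ν q.2)) - β₁)
      (η * S.card * (W ×ˢ N).card))
    (ζ : ℤ → ℤ → ℝ)
    (hU₂ : ∀ x ∈ S, ∀ y ∈ Y, BilinearBound S (W ×ˢ N)
      (fun s q => e₂ (y + s - x - (q.1 + ν q.2)) - β₂) ((W ×ˢ N).card * ζ x y))
    (hζ : ∑ x ∈ S, ∑ y ∈ Y, ζ x y ≤ η * (S.card : ℝ) ^ 2 * Y.card)
    (hU₃ : ∑ y ∈ Y, |∑ q ∈ W ×ˢ N, (e₂ (y + (q.1 + ν q.2)) - β₂)|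
      ≤ η * (W ×ˢ N).card * Y.card)
    (hB : ∑ x ∈ S', ∑ y ∈ Y', boxForm W f x y ≤ (W.card : ℝ) ^ 4 * B) :
    cornerSum L L₂ f a ^ 4 ≤ (S.card * (K₁ * K₂)) ^ 2
      * ((S.card : ℝ) ^ 2 * Y.card * (β₁ ^ 2 * β₂ ^ 2 + 5 * η))
      * (β₁ ^ 2 * β₂ ^ 2 * S.card * B + 4 * η * (S.card : ℝ) ^ 2 * Y.card) := by
  have hmain := cornerSum_pow_four_le L L₂ S Y (W ×ˢ N) (fun q => q.1 + ν q.2) f a e₁ e₂ hf ha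
    he₁ he₂ he₁' he₂' he₂L hae
    (fun x hx p hp => hS x hx _ (Finset.mem_product.1 hp).1 _ (Finset.mem_product.1 hp).2)
    (fun x hx p hp => hS' x hx _ (Finset.mem_product.1 hp).1 _ (Finset.mem_product.1 hp).2)
    (fun x hx p hp => hY x hx _ (Finset.mem_product.1 hp).1 _ (Finset.mem_product.1 hp).2)
  have hcard : ((W ×ˢ N).card : ℝ) = W.card * N.card := by
    rw [Finset.card_product]; push_cast; ring
  have hPn : 0 < (W ×ˢ N).card := by
    rw [Finset.card_product]; positivity
  have hP : (0 : ℝ) < ((W ×ˢ N).card : ℝ) := by exact_mod_cast hPn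
  have habs1 : |β₁| ≤ 1 := by rw [abs_of_nonneg hβ₁]; exact hβ₁'
  have habs2 : |β₂| ≤ 1 := by rw [abs_of_nonneg hβ₂]; exact hβ₂'
  have he₁a : ∀ x, |e₁ x| ≤ 1 := fun x => by rw [abs_of_nonneg (he₁ x)]; exact he₁' x
  have he₂a : ∀ x, |e₂ x| ≤ 1 := fun x => by rw [abs_of_nonneg (he₂ x)]; exact he₂' x
  set P := W ×ˢ N with hPdef
  -- the second factor
  have hN2 : ∑ y ∈ Y, ∑ s ∈ S, (∑ q ∈ P, e₁ (s - (q.1 + ν q.2)) * e₂ (y + (q.1 + ν q.2))) ^ 2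
      ≤ (P.card : ℝ) ^ 2 * (S.card * Y.card * (β₁ ^ 2 * β₂ ^ 2 + 5 * η)) := by
    have h1 : ∀ y ∈ Y,
        ∑ s ∈ S, (∑ q ∈ P, e₁ (s - (q.1 + ν q.2)) * e₂ (y + (q.1 + ν q.2))) ^ 2
        ≤ S.card * (β₁ ^ 2 * β₂ ^ 2 + 2 * η) * (P.card : ℝ) ^ 2
          + 3 * S.card * P.card * |∑ q ∈ P, (e₂ (y + (q.1 + ν q.2)) - β₂)| := by
      intro y _
      have h2 := sum_mul_sq_le_of_bilinear S P (fun s q => e₁ (s - (q.1 + ν q.2))) hPn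
        (fun s q => he₁a _) β₁ _ habs1 hU₁ (fun _ => 1) (fun _ => by simp)
        (fun q => e₂ (y + (q.1 + ν q.2))) (fun q => he₂a _)
      simp only [one_mul, Finset.sum_const, nsmul_eq_mul] at h2
      refine h2.trans ?_
      have h3 : ∑ q ∈ P, e₂ (y + (q.1 + ν q.2))
          = β₂ * P.card + ∑ q ∈ P, (e₂ (y + (q.1 + ν q.2)) - β₂) := by
        rw [Finset.sum_sub_distrib, Finset.sum_const, nsmul_eq_mul]
        ring
      rw [h3]
      obtain ⟨D, hD⟩ : ∃ D, D = ∑ q ∈ P, (e₂ (y + (q.1 + ν q.2)) - β₂) := ⟨_, rfl⟩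
      have h4 : |D| ≤ P.card := by
        rw [hD]
        refine (abs_sum_le_card_mul _ _ 1 fun q _ => ?_).trans (by simp)
        rw [abs_le]
        constructor <;> linarith [he₂ (y + (q.1 + ν q.2)), he₂' (y + (q.1 + ν q.2))]
      rw [← hD]
      have h5 : (β₂ * P.card + D) ^ 2 ≤ β₂ ^ 2 * (P.card : ℝ) ^ 2 + 3 * P.card * |D| := by
        have h6 : D ^ 2 ≤ P.card * |D| := by
          rw [← sq_abs, sq]
          exact mul_le_mul_of_nonneg_right h4 (abs_nonneg _)
        have h7 : β₂ * (P.card * D) ≤ 1 * (P.card * |D|) := by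
          have : P.card * D ≤ P.card * |D| := by gcongr; exact le_abs_self D
          calc β₂ * (P.card * D) ≤ β₂ * (P.card * |D|) := by gcongr
            _ ≤ 1 * (P.card * |D|) := by gcongr
        nlinarith
      have h8 : β₁ ^ 2 ≤ 1 := pow_le_one₀ hβ₁ hβ₁'
      have h9 : β₁ ^ 2 * (β₂ * P.card + D) ^ 2
          ≤ β₁ ^ 2 * β₂ ^ 2 * (P.card : ℝ) ^ 2 + 3 * P.card * |D| := by
        calc β₁ ^ 2 * (β₂ * P.card + D) ^ 2
            ≤ β₁ ^ 2 * (β₂ ^ 2 * (P.card : ℝ) ^ 2 + 3 * P.card * |D|) := by gcongr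
          _ = β₁ ^ 2 * β₂ ^ 2 * (P.card : ℝ) ^ 2 + β₁ ^ 2 * (3 * P.card * |D|) := by ring
          _ ≤ β₁ ^ 2 * β₂ ^ 2 * (P.card : ℝ) ^ 2 + 1 * (3 * P.card * |D|) := by gcongr
          _ = _ := by ring
      calc (S.card : ℝ) * (β₁ ^ 2 * (β₂ * P.card + D) ^ 2)
            + 2 * P.card * (η * S.card * P.card)
          ≤ (S.card : ℝ) * (β₁ ^ 2 * β₂ ^ 2 * (P.card : ℝ) ^ 2 + 3 * P.card * |D|)
            + 2 * P.card * (η * S.card * P.card) := by gcongr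
        _ = _ := by ring
    refine (Finset.sum_le_sum h1).trans ?_
    rw [Finset.sum_add_distrib, Finset.sum_const, nsmul_eq_mul, ← Finset.mul_sum]
    calc (Y.card : ℝ) * (S.card * (β₁ ^ 2 * β₂ ^ 2 + 2 * η) * (P.card : ℝ) ^ 2)
          + 3 * S.card * P.card * ∑ y ∈ Y, |∑ q ∈ P, (e₂ (y + (q.1 + ν q.2)) - β₂)|
        ≤ (Y.card : ℝ) * (S.card * (β₁ ^ 2 * β₂ ^ 2 + 2 * η) * (P.card : ℝ) ^ 2)
          + 3 * S.card * P.card * (η * P.card * Y.card) := by gcongr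
      _ = _ := by ring
  -- the third factor
  have hQ2 : ∑ x ∈ S, ∑ y ∈ Y, ∑ s ∈ S, ∑ q ∈ P, ∑ q' ∈ P,
        e₁ (s - (q.1 + ν q.2)) * e₁ (s - (q'.1 + ν q'.2))
          * (∑ p ∈ P, e₂ (y + s - x - (p.1 + ν p.2))
            * (f (x + (p.1 + ν p.2)) (y + (q.1 + ν q.2))
              * f (x + (p.1 + ν p.2)) (y + (q'.1 + ν q'.2)))) ^ 2
      ≤ (P.card : ℝ) ^ 4
        * (β₁ ^ 2 * β₂ ^ 2 * S.card * B + 4 * η * (S.card : ℝ) ^ 2 * Y.card) := by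
    have h1 : ∀ x ∈ S, ∀ y ∈ Y, ∑ s ∈ S, ∑ q ∈ P, ∑ q' ∈ P,
        e₁ (s - (q.1 + ν q.2)) * e₁ (s - (q'.1 + ν q'.2))
          * (∑ p ∈ P, e₂ (y + s - x - (p.1 + ν p.2))
            * (f (x + (p.1 + ν p.2)) (y + (q.1 + ν q.2))
              * f (x + (p.1 + ν p.2)) (y + (q'.1 + ν q'.2)))) ^ 2
        ≤ β₁ ^ 2 * β₂ ^ 2 * S.card * ∑ q ∈ P, ∑ q' ∈ P,
            (∑ p ∈ P, f (x + (p.1 + ν p.2)) (y + (q.1 + ν q.2))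
              * f (x + (p.1 + ν p.2)) (y + (q'.1 + ν q'.2))) ^ 2
          + (P.card : ℝ) ^ 3 * (2 * (η * S.card * P.card) + 2 * (P.card * ζ x y)) :=
      fun x hx y hy => weighted_box_le S P hPn (fun s q => e₁ (s - (q.1 + ν q.2)))
        (fun s p => e₂ (y + s - x - (p.1 + ν p.2)))
        (fun p q => f (x + (p.1 + ν p.2)) (y + (q.1 + ν q.2))) (fun _ _ => he₁a _)
        (fun _ _ => he₂a _) (fun _ _ => hf1 _ _) β₁ β₂ _ _ habs1 habs2 hU₁ (hU₂ x hx y hy)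
    refine (Finset.sum_le_sum fun x hx => Finset.sum_le_sum fun y hy => h1 x hx y hy).trans ?_
    have h2 := sum_box_coarse_le W N ν S S' Y Y' hSN hYN f
    have h3 : ∑ x ∈ S, ∑ y ∈ Y, (β₁ ^ 2 * β₂ ^ 2 * S.card * ∑ q ∈ P, ∑ q' ∈ P,
            (∑ p ∈ P, f (x + (p.1 + ν p.2)) (y + (q.1 + ν q.2))
              * f (x + (p.1 + ν p.2)) (y + (q'.1 + ν q'.2))) ^ 2
          + (P.card : ℝ) ^ 3 * (2 * (η * S.card * P.card) + 2 * (P.card * ζ x y)))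
        = β₁ ^ 2 * β₂ ^ 2 * S.card * (∑ x ∈ S, ∑ y ∈ Y, ∑ q ∈ P, ∑ q' ∈ P,
            (∑ p ∈ P, f (x + (p.1 + ν p.2)) (y + (q.1 + ν q.2))
              * f (x + (p.1 + ν p.2)) (y + (q'.1 + ν q'.2))) ^ 2)
          + (P.card : ℝ) ^ 4 * (2 * η * (S.card : ℝ) ^ 2 * Y.card
            + 2 * ∑ x ∈ S, ∑ y ∈ Y, ζ x y) := by
      rw [sum_sum_linear]
      ring
    rw [h3]
    calc _ ≤ β₁ ^ 2 * β₂ ^ 2 * S.card * ((N.card : ℝ) ^ 4 * ((W.card : ℝ) ^ 4 * B))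
          + (P.card : ℝ) ^ 4 * (2 * η * (S.card : ℝ) ^ 2 * Y.card
            + 2 * (η * (S.card : ℝ) ^ 2 * Y.card)) := by
          refine add_le_add ?_ (by gcongr)
          refine mul_le_mul_of_nonneg_left (h2.trans ?_) (by positivity)
          gcongr
      _ = _ := by
          rw [hcard]
          ring
  have hK₁0 : 0 ≤ ∑ x ∈ L, e₁ x := Finset.sum_nonneg fun _ _ => he₁ _
  have hK₂0 : 0 ≤ ∑ x ∈ L₂, e₂ x := Finset.sum_nonneg fun _ _ => he₂ _
  have hQ0 : 0 ≤ ∑ x ∈ S, ∑ y ∈ Y, ∑ s ∈ S, ∑ q ∈ P, ∑ q' ∈ P,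
        e₁ (s - (q.1 + ν q.2)) * e₁ (s - (q'.1 + ν q'.2))
          * (∑ p ∈ P, e₂ (y + s - x - (p.1 + ν p.2))
            * (f (x + (p.1 + ν p.2)) (y + (q.1 + ν q.2))
              * f (x + (p.1 + ν p.2)) (y + (q'.1 + ν q'.2)))) ^ 2 :=
    Finset.sum_nonneg fun _ _ => Finset.sum_nonneg fun _ _ => Finset.sum_nonneg fun _ _ =>
      Finset.sum_nonneg fun _ _ => Finset.sum_nonneg fun _ _ =>
        mul_nonneg (mul_nonneg (he₁ _) (he₁ _)) (sq_nonneg _)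
  have hK₁nn : 0 ≤ K₁ := hK₁0.trans hK₁
  -- The averaging over `P` disappears: the three factors on the right carry `|P|²`, `|P|²` and
  -- `|P|⁴`.
  have hfin : (P.card : ℝ) ^ 8 * cornerSum L L₂ f a ^ 4 ≤ (P.card : ℝ) ^ 8 *
      ((S.card * (K₁ * K₂)) ^ 2
      * ((S.card : ℝ) ^ 2 * Y.card * (β₁ ^ 2 * β₂ ^ 2 + 5 * η))
      * (β₁ ^ 2 * β₂ ^ 2 * S.card * B + 4 * η * (S.card : ℝ) ^ 2 * Y.card)) := by
    calc (P.card : ℝ) ^ 8 * cornerSum L L₂ f a ^ 4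
        = ((P.card : ℝ) ^ 2 * cornerSum L L₂ f a) ^ 4 := by ring
      _ ≤ _ := hmain
      _ ≤ (P.card * (S.card * (K₁ * K₂))) ^ 2
          * (S.card * ((P.card : ℝ) ^ 2 * (S.card * Y.card * (β₁ ^ 2 * β₂ ^ 2 + 5 * η))))
          * ((P.card : ℝ) ^ 4
            * (β₁ ^ 2 * β₂ ^ 2 * S.card * B + 4 * η * (S.card : ℝ) ^ 2 * Y.card)) := by
          gcongr
      _ = _ := by ring
  exact le_of_mul_le_mul_left hfin (by positivity)

end

/-! ### Bohr sets, uniform windows, and the rectilinear norm as a sum of box forms -/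

noncomputable section

section Bohr

variable {d : ℕ} {θ : Fin d → UnitAddCircle} {e e' : ℝ} {n n' : ℕ} {a b : ℤ}

theorem bohrPoints_add (ha : a ∈ bohrPoints θ e n) (hb : b ∈ bohrPoints θ e' n') :
    a + b ∈ bohrPoints θ (e + e') (n + n') := by
  rw [mem_bohrPoints] at *
  refine ⟨?_, fun j => ?_⟩
  · push_cast
    exact (abs_add_le a b).trans (add_le_add ha.1 hb.1)
  · rw [add_smul]
    exact (norm_add_le _ _).trans_lt (add_lt_add (ha.2 j) (hb.2 j))

theorem bohrPoints_neg (ha : a ∈ bohrPoints θ e n) : -a ∈ bohrPoints θ e n := by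
  rw [mem_bohrPoints] at *
  exact ⟨by rw [abs_neg]; exact ha.1, fun j => by rw [neg_smul, norm_neg]; exact ha.2 j⟩

theorem bohrPoints_mono (he : e ≤ e') (hn : n ≤ n') : bohrPoints θ e n ⊆ bohrPoints θ e' n' := by
  intro a ha
  rw [mem_bohrPoints] at *
  exact ⟨ha.1.trans (by exact_mod_cast hn), fun j => (ha.2 j).trans_le he⟩

theorem bohrPoints_zero_mem (he : 0 < e) : (0 : ℤ) ∈ bohrPoints θ e n := by
  rw [mem_bohrPoints]
  simpa using fun _ => he

theorem BohrSet.card_points_pos {d : ℕ} (Λ : BohrSet d) : 0 < Λ.points.card :=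
  Finset.card_pos.2 ⟨0, bohrPoints_zero_mem Λ.ε_pos⟩

theorem BohrSet.size_pos {d : ℕ} (Λ : BohrSet d) : 0 < Λ.size := by
  unfold BohrSet.size
  exact_mod_cast Λ.card_points_pos

theorem BohrSet.neg_mem_points {d : ℕ} (Λ : BohrSet d) {m : ℤ} (h : m ∈ Λ.points) :
    -m ∈ Λ.points := bohrPoints_neg h

theorem BohrSet.IsRegular.card_le {d : ℕ} {Λ : BohrSet d} (h : Λ.IsRegular)
    {κ : ℝ} (hκ : 0 < κ) (hκ' : κ < 1) {e : ℝ} {n : ℕ} (he0 : 0 ≤ e)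
    (he : e < κ / (100 * d) * Λ.ε) (hn : (n : ℝ) < κ / (100 * d) * Λ.N) :
    ((bohrPoints Λ.θ (Λ.ε + e) (Λ.N + n)).card : ℝ) ≤ (1 + κ) * Λ.size := by
  have h1 := (h κ hκ hκ' (Λ.ε + e) (Λ.N + n)
    (by rw [sub_add_cancel_left, abs_neg, abs_of_nonneg he0]; exact he)
    (by push_cast; rw [sub_add_cancel_left, abs_neg, abs_of_nonneg (Nat.cast_nonneg _)]
        exact hn)).2
  rw [div_lt_iff₀ Λ.size_pos] at h1
  exact h1.le

theorem BohrSet.IsRegular.le_card {d : ℕ} {Λ : BohrSet d} (h : Λ.IsRegular)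
    {κ : ℝ} (hκ : 0 < κ) (hκ' : κ < 1) {e : ℝ} {n : ℕ} (he0 : 0 ≤ e) (hnN : n ≤ Λ.N)
    (he : e < κ / (100 * d) * Λ.ε) (hn : (n : ℝ) < κ / (100 * d) * Λ.N) :
    (1 - κ) * Λ.size ≤ ((bohrPoints Λ.θ (Λ.ε - e) (Λ.N - n)).card : ℝ) := by
  have h1 := (h κ hκ hκ' (Λ.ε - e) (Λ.N - n)
    (by rw [sub_sub_cancel, abs_of_nonneg he0]; exact he)
    (by rw [Nat.cast_sub hnN, sub_sub_cancel, abs_of_nonneg (Nat.cast_nonneg _)]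
        exact hn)).1
  rw [lt_div_iff₀ Λ.size_pos] at h1
  exact h1.le

/-- The points of an attendant satisfy the Bohr conditions for the original generative vector. -/
theorem BohrSet.IsAttendant.points_subset {d d' : ℕ} {η : ℝ} {Λ : BohrSet d} {Λ' : BohrSet d'}
    (h : BohrSet.IsAttendant η Λ Λ') : Λ'.points ⊆ bohrPoints Λ.θ Λ'.ε Λ'.N := by
  intro m hm
  obtain ⟨hle, hθ⟩ := h.extends_θ
  unfold BohrSet.points at hm
  rw [mem_bohrPoints] at *
  exact ⟨hm.1, fun j => by rw [← hθ j]; exact hm.2 _⟩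

theorem BohrSet.IsAttendant.θ_eq {d : ℕ} {η : ℝ} {Λ Λ' : BohrSet d}
    (h : BohrSet.IsAttendant η Λ Λ') : Λ'.θ = Λ.θ := by
  obtain ⟨hle, hθ⟩ := h.extends_θ
  funext j
  exact hθ j

end Bohr

theorem charFn_nonneg {X : Type} (S : Finset X) (x : X) : 0 ≤ charFn S x := by
  unfold charFn; split_ifs <;> norm_num

theorem charFn_le_one {X : Type} (S : Finset X) (x : X) : charFn S x ≤ 1 := by
  unfold charFn; split_ifs <;> norm_num

theorem charFn_of_mem {X : Type} {S : Finset X} {x : X} (h : x ∈ S) : charFn S x = 1 := by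
  unfold charFn; rw [if_pos h]

theorem charFn_of_notMem {X : Type} {S : Finset X} {x : X} (h : x ∉ S) : charFn S x = 0 := by
  unfold charFn; rw [if_neg h]

theorem mem_of_charFn_ne_zero {X : Type} {S : Finset X} {x : X} (h : charFn S x ≠ 0) : x ∈ S := by
  by_contra hx
  exact h (charFn_of_notMem hx)

theorem mem_intTranslate {S : Finset ℤ} {m n : ℤ} : n ∈ intTranslate S m ↔ n - m ∈ S := by
  unfold intTranslate
  rw [Finset.mem_map]
  constructor
  · rintro ⟨a, ha, rfl⟩
    simpa using ha
  · intro h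
    exact ⟨n - m, h, by simp⟩

theorem fourierTransform_eq_sum (F : Finset ℤ) (g : ℤ → ℝ) (hg : ∀ n, n ∉ F → g n = 0) (x : ℝ) :
    fourierTransform g x = ∑ n ∈ F, (g n : ℂ) * expNeg n x := by
  unfold fourierTransform
  rw [tsum_eq_sum (s := F) (fun n hn => by rw [hg n hn]; simp)]
  rfl

/-- A real supremum over an unbounded family has the default value `0`. Finite support supplies the
upper bound `∑ |g n|` that makes the supremum a true one. -/
theorem norm_fourierTransform_le_fourierSup (F : Finset ℤ) (g : ℤ → ℝ)
    (hg : ∀ n, n ∉ F → g n = 0) (x : ℝ) : ‖fourierTransform g x‖ ≤ fourierSup g := by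
  unfold fourierSup
  refine le_ciSup (f := fun x : ℝ => ‖fourierTransform g x‖) ⟨∑ n ∈ F, |g n|, ?_⟩ x
  rintro _ ⟨y, rfl⟩
  simp only
  rw [fourierTransform_eq_sum F g hg]
  refine (norm_sum_le _ _).trans (Finset.sum_le_sum fun n _ => ?_)
  rw [norm_mul, norm_expNeg, mul_one, Complex.norm_real, Real.norm_eq_abs]

/-- Most translates of the small Bohr set see a uniform piece of a uniform set. -/
theorem IsUniformAt.exists_good {d d' : ℕ} {α : ℝ} {Λ : BohrSet d} {M : BohrSet d'}
    {Q : Finset ℤ} (h : IsUniformAt α Λ M Q) {β : ℝ} (hβ : (Q.card : ℝ) = β * Λ.size) :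
    ∃ G : Finset ℤ, G ⊆ Λ.points ∧ (1 - α) * Λ.size ≤ G.card ∧
      ∀ n ∈ G, ∀ x : ℝ,
        ‖∑ m ∈ M.points, ((charFn Q (n - m) - β : ℝ) : ℂ) * expNeg m x‖
          ≤ α * M.points.card := by
  classical
  have hrel : relDensity Λ.points Q = β := by
    unfold relDensity
    rw [Finset.inter_eq_right.2 h.subset, hβ]
    exact mul_div_cancel_right₀ _ Λ.size_pos.ne'
  have hloc := h.fourier_local
  rw [hrel] at hloc
  set F : ℤ → ℤ → ℝ := fun m n => charFn (Q ∩ intTranslate M.points m) n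
    - β * charFn (intTranslate M.points m) n with hF
  refine ⟨Λ.points.filter fun m => ¬ (α * M.size ≤ fourierSup (F m)), Finset.filter_subset _ _,
    ?_, ?_⟩
  · have h1 := Finset.card_filter_add_card_filter_not (s := Λ.points)
      (fun m => α * M.size ≤ fourierSup (F m))
    have h2 : ((Λ.points.filter fun m => α * M.size ≤ fourierSup (F m)).card : ℝ)
        + ((Λ.points.filter fun m => ¬ (α * M.size ≤ fourierSup (F m))).card : ℝ) = Λ.size := by
      unfold BohrSet.size
      exact_mod_cast h1
    have h3 : ((Λ.points.filter fun m => α * M.size ≤ fourierSup (F m)).card : ℝ)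
        ≤ α * Λ.size := by
      convert hloc
    linarith
  · intro m hm x
    have hlt := not_le.1 (Finset.mem_filter.1 hm).2
    have hzero : ∀ n, n ∉ intTranslate M.points m → F m n = 0 := by
      intro n hn
      simp only [hF]
      rw [charFn_of_notMem hn, charFn_of_notMem fun h => hn (Finset.mem_inter.1 h).2]
      ring
    have h1 := norm_fourierTransform_le_fourierSup _ (F m) hzero (-x)
    rw [fourierTransform_eq_sum _ (F m) hzero] at h1
    -- The symmetry of `M` allows the substitution `n = m - u`, which reflects the window. The
    -- frequency `-x` compensates for the reflection, and the factor `expNeg m (-x)` has modulus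
    -- one.
    have h2 : ∑ n ∈ intTranslate M.points m, (F m n : ℂ) * expNeg n (-x)
        = expNeg m (-x) * ∑ u ∈ M.points, ((charFn Q (m - u) - β : ℝ) : ℂ) * expNeg u x := by
      rw [Finset.mul_sum]
      refine Finset.sum_bij' (fun n _ => m - n) (fun u _ => m - u) ?_ ?_ ?_ ?_ ?_
      · intro n hn
        have := M.neg_mem_points (mem_intTranslate.1 hn)
        rwa [neg_sub] at this
      · intro u hu
        rw [mem_intTranslate]
        have := M.neg_mem_points hu
        simpa using this
      · intro n _
        ring
      · intro u _
        ring
      · intro n hn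
        have e1 : F m n = charFn Q (m - (m - n)) - β := by
          simp only [hF]
          rw [charFn_of_mem hn, mul_one, sub_sub_cancel]
          congr 1
          by_cases hq : n ∈ Q
          · rw [charFn_of_mem hq, charFn_of_mem (Finset.mem_inter.2 ⟨hq, hn⟩)]
          · rw [charFn_of_notMem hq, charFn_of_notMem fun h => hq (Finset.mem_inter.1 h).1]
        have e2 : expNeg n (-x) = expNeg m (-x) * expNeg (m - n) x := by
          unfold expNeg
          rw [← Complex.exp_add]
          congr 1
          push_cast
          ring
        rw [e1, e2]
        ring
    rw [h2, norm_mul, norm_expNeg, one_mul] at h1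
    exact (h1.trans_lt hlt).le

/-- Translation by `t` is injective and carries the points in question into `Y' \ G`. -/
theorem card_shift_notMem_le (Y Y' G : Finset ℤ) (t : ℤ) (h : ∀ y ∈ Y, y + t ∈ Y') (hG : G ⊆ Y') :
    (((Y.filter fun y => y + t ∉ G).card : ℕ) : ℝ) ≤ Y'.card - G.card := by
  have h1 : (Y.filter fun y => y + t ∉ G).card ≤ (Y' \ G).card := by
    refine Finset.card_le_card_of_injOn (fun y => y + t) ?_ ?_
    · intro y hy
      have hy' := Finset.mem_filter.1 (Finset.mem_coe.1 hy)
      exact Finset.mem_coe.2 (Finset.mem_sdiff.2 ⟨h y hy'.1, hy'.2⟩)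
    · intro a _ b _ hab
      simpa using hab
  rw [← Nat.cast_sub (Finset.card_le_card hG), ← Finset.card_sdiff_of_subset hG]
  exact_mod_cast h1

/-- After exchanging the two sums, the previous count applies to each `t`. This is the first-moment
bound behind the claim that most base points see few bad windows. -/
theorem sum_card_shift_notMem_le (Y Y' G T : Finset ℤ) (c : ℤ)
    (h : ∀ y ∈ Y, ∀ t ∈ T, y + t + c ∈ Y') (hG : G ⊆ Y') :
    ∑ y ∈ Y, (((T.filter fun t => y + t + c ∉ G).card : ℕ) : ℝ) ≤ T.card * (Y'.card - G.card) := by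
  classical
  have h1 : ∑ y ∈ Y, (((T.filter fun t => y + t + c ∉ G).card : ℕ) : ℝ)
      = ∑ t ∈ T, (((Y.filter fun y => y + (t + c) ∉ G).card : ℕ) : ℝ) := by
    simp_rw [Finset.card_filter, Nat.cast_sum, ← add_assoc]
    rw [Finset.sum_comm]
  rw [h1]
  refine (Finset.sum_le_card_nsmul _ _ _ fun t ht => ?_).trans (le_of_eq (nsmul_eq_mul _ _))
  exact card_shift_notMem_le Y Y' G (t + c) (fun y hy => by rw [← add_assoc]; exact h y hy t ht) hG

theorem tsum_charFn_mul (W : Finset ℤ) (c : ℤ) (G : ℤ → ℝ) :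
    ∑' m : ℤ, charFn W (m - c) * G m = ∑ v ∈ W, G (v + c) := by
  rw [← (Equiv.addRight c).tsum_eq, tsum_eq_sum (s := W)]
  · refine Finset.sum_congr rfl fun v hv => ?_
    simp [charFn_of_mem hv]
  · intro v hv
    simp [charFn_of_notMem hv]

theorem sum_neg_eq (W : Finset ℤ) (hW : ∀ w ∈ W, -w ∈ W) (G : ℤ → ℝ) :
    ∑ w ∈ W, G (-w) = ∑ w ∈ W, G w :=
  Finset.sum_bij' (fun w _ => -w) (fun w _ => -w) hW hW (by simp) (by simp) (by simp)

/-- The inner sums in the rectilinear norm are box forms. -/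
theorem rectNorm4_eq (L₁ L₂ W : Finset ℤ) (hW : ∀ w ∈ W, -w ∈ W) (f : ℤ × ℤ → ℝ) :
    rectNorm4 L₁ L₂ W f
      = ∑ i ∈ L₁, ∑ j ∈ L₂, ∑' k : ℤ, boxForm W (fun x y => f (x, y)) (j - k) (-k - i) := by
  unfold rectNorm4
  refine Finset.sum_congr rfl fun i _ => Finset.sum_congr rfl fun j _ => tsum_congr fun k => ?_
  -- The substitution `r = w + (j - k)` turns the innermost sum into one over `W`. Likewise `m` and
  -- `u` become `v + (k + i)`, and the symmetry of `W` removes the sign from `-v`.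
  have h1 : ∀ m u : ℤ, charFn W (m - k - i) * charFn W (u - k - i) *
      |∑' r : ℤ, charFn W (k + r - j) * f (r, -m) * f (r, -u)| ^ 2
      = charFn W (m - (k + i)) * (charFn W (u - (k + i)) *
        (∑ w ∈ W, f (w + (j - k), -m) * f (w + (j - k), -u)) ^ 2) := by
    intro m u
    rw [← tsum_charFn_mul W (j - k) (fun r => f (r, -m) * f (r, -u)), sq_abs, mul_assoc,
      sub_sub, sub_sub]
    congr 4
    funext r
    rw [mul_assoc]
    congr 2
    ring
  simp_rw [h1, tsum_mul_left]
  rw [tsum_charFn_mul W (k + i) (fun m => ∑' u : ℤ, charFn W (u - (k + i)) *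
        (∑ w ∈ W, f (w + (j - k), -m) * f (w + (j - k), -u)) ^ 2)]
  unfold boxForm
  rw [← sum_neg_eq W hW (fun v => ∑ v' ∈ W, (∑ w ∈ W,
    f (j - k + w, -k - i + v) * f (j - k + w, -k - i + v')) ^ 2)]
  refine Finset.sum_congr rfl fun v _ => ?_
  rw [tsum_charFn_mul W (k + i) (fun u =>
    (∑ w ∈ W, f (w + (j - k), -(v + (k + i))) * f (w + (j - k), -u)) ^ 2),
    ← sum_neg_eq W hW (fun v' => (∑ w ∈ W,
      f (j - k + w, -k - i + -v) * f (j - k + w, -k - i + v')) ^ 2)]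
  refine Finset.sum_congr rfl fun v' _ => ?_
  congr 1
  refine Finset.sum_congr rfl fun w _ => ?_
  congr 3 <;> ring

/-- The rectilinear norm dominates the sum of the box forms over a rectangle, with the multiplicity
with which they occur in it. -/
theorem card_mul_sum_boxForm_le_rectNorm4 (L L₂ W S Y : Finset ℤ) (hW : ∀ w ∈ W, -w ∈ W)
    (f : ℤ × ℤ → ℝ) (hf : ∀ x y, f (x, y) ≠ 0 → x ∈ L)
    (h : ∀ x ∈ S, ∀ y ∈ Y, ∀ i ∈ L, x - (y + i) ∈ L₂) :
    (L.card : ℝ) * ∑ x ∈ S, ∑ y ∈ Y, boxForm W (fun x y => f (x, y)) x y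
      ≤ rectNorm4 L L₂ W f := by
  classical
  rw [rectNorm4_eq L L₂ W hW]
  set b := boxForm W (fun x y => f (x, y)) with hb
  have hb0 : ∀ x y, 0 ≤ b x y := boxForm_nonneg _ _
  have hbz : ∀ x y, b x y ≠ 0 → x ∈ (L ×ˢ W).image fun q => q.1 - q.2 := by
    intro x y hne
    by_contra hx
    refine hne ?_
    rw [hb]
    unfold boxForm
    refine Finset.sum_eq_zero fun v _ => Finset.sum_eq_zero fun v' _ => ?_
    have : ∑ w ∈ W, f (x + w, y + v) * f (x + w, y + v') = 0 := by
      refine Finset.sum_eq_zero fun w hw => ?_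
      have : f (x + w, y + v) = 0 := by
        by_contra h0
        exact hx (Finset.mem_image.2 ⟨(x + w, w), Finset.mem_product.2 ⟨hf _ _ h0, hw⟩, by simp⟩)
      rw [this, zero_mul]
    rw [this]
    norm_num
  -- The choice `k = -y - i` gives the base point `(j + (y + i), y)`, and distinct `y` give distinct
  -- `k`. Summability has to be shown, since a non-summable `tsum` is `0`; it follows from the
  -- finite support in the first coordinate.
  have hk : ∀ i j : ℤ, ∑ y ∈ Y, b (j + (y + i)) y ≤ ∑' k : ℤ, b (j - k) (-k - i) := by
    intro i j
    have hsum : Summable fun k : ℤ => b (j - k) (-k - i) := by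
      refine summable_of_ne_finset_zero
        (s := ((L ×ˢ W).image fun q => q.1 - q.2).image fun x => j - x) fun k hk => ?_
      by_contra hne
      exact hk (Finset.mem_image.2 ⟨j - k, hbz _ _ hne, by ring⟩)
    have h1 := hsum.sum_le_tsum (Y.image fun y => -y - i) (fun k _ => hb0 _ _)
    rw [Finset.sum_image (by intro a _ b _ hab; simpa using hab)] at h1
    refine le_trans (le_of_eq (Finset.sum_congr rfl fun y _ => ?_)) h1
    congr 1 <;> ring
  calc (L.card : ℝ) * ∑ x ∈ S, ∑ y ∈ Y, b x y
      = ∑ i ∈ L, ∑ y ∈ Y, ∑ x ∈ S, b x y := by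
        rw [Finset.sum_const, nsmul_eq_mul, Finset.sum_comm]
    -- For each `i ∈ L` the base point `(x, y)` is reached from `j = x - (y + i)`, which lies in
    -- `L₂`. Hence the multiplicity `|L|`.
    _ ≤ ∑ i ∈ L, ∑ y ∈ Y, ∑ j ∈ L₂, b (j + (y + i)) y := by
        refine Finset.sum_le_sum fun i hi => Finset.sum_le_sum fun y hy => ?_
        have h1 := sum_shift_le S L₂ (-(y + i)) (fun x hx => by
          rw [← sub_eq_add_neg]; exact h x hx y hy i hi) (fun j => b (j + (y + i)) y)
          (fun _ => hb0 _ _)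
        simpa only [neg_add_cancel_right] using h1
    _ = ∑ i ∈ L, ∑ j ∈ L₂, ∑ y ∈ Y, b (j + (y + i)) y :=
        Finset.sum_congr rfl fun i _ => Finset.sum_comm
    _ ≤ _ := Finset.sum_le_sum fun i _ => Finset.sum_le_sum fun j _ => hk i j

end

/-! ### Uniform sets as weights at the combined scale -/

noncomputable section

theorem BilinearBound.reindex {σ ι ι' : Type*} {S : Finset σ} {P : Finset ι} {P' : Finset ι'}
    {k : σ → ι' → ℝ} {η : ℝ} (hk : BilinearBound S P' k η) (e : ι ≃ ι')
    (he : ∀ p, p ∈ P ↔ e p ∈ P') : BilinearBound S P (fun s p => k s (e p)) η := by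
  intro h c hh hc
  have h1 := hk h (fun p => c (e.symm p)) hh (fun p => hc _)
  have h2 : ∑ s ∈ S, ∑ p ∈ P, k s (e p) * h s * c p
      = ∑ s ∈ S, ∑ p ∈ P', k s p * h s * c (e.symm p) :=
    Finset.sum_congr rfl fun s _ => Finset.sum_equiv e he fun p _ => by simp
  rw [h2]
  exact h1

/-- All cancellation comes from `M`; the coordinate in `T` is frozen and summed by the triangle
inequality. -/
theorem BilinearBound.prod {σ τ ι : Type*} {S : Finset σ} {T : Finset τ} {M : Finset ι}
    {k : σ → τ × ι → ℝ} {η : ℝ} (h : ∀ t ∈ T, BilinearBound S M (fun s m => k s (t, m)) η) :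
    BilinearBound S (T ×ˢ M) k (T.card * η) := by
  intro u c hu hc
  have h1 : ∑ s ∈ S, ∑ p ∈ T ×ˢ M, k s p * u s * c p
      = ∑ t ∈ T, ∑ s ∈ S, ∑ m ∈ M, k s (t, m) * u s * c (t, m) := by
    simp_rw [Finset.sum_product]
    rw [Finset.sum_comm]
  rw [h1]
  exact abs_sum_le_card_mul _ _ _ fun t ht => h t ht u (fun m => c (t, m)) hu fun m => hc _

/-- The kernel of a uniform function, averaged over additional shifts. -/
theorem bilinearBound_of_uniform {τ : Type*} (g : ℤ → ℝ) (hg : ∀ n, |g n| ≤ 1)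
    (M S S' G : Finset ℤ) (T : Finset τ) (ρ : τ → ℤ) (ω : ℝ) (hω : 0 < ω) (hω' : 2 * ω ^ 12 ≤ 1)
    (hG : ∀ n ∈ G, ∀ x : ℝ, ‖∑ m ∈ M, ((g (n - m) : ℝ) : ℂ) * expNeg m x‖ ≤ ω ^ 8 * M.card)
    (hM : ∀ s ∈ S, ∀ m ∈ M, s - m ∈ S') (hT : ∀ s ∈ S, ∀ t ∈ T, s - ρ t ∈ S')
    (hS' : (S'.card : ℝ) ≤ 2 * S.card) (c : ℤ) :
    BilinearBound S (T ×ˢ M) (fun s q => g (c + s - (ρ q.1 + q.2)))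
      ((T ×ˢ M).card * (2 * ω * S.card
        + (((S'.filter fun s => c + s ∉ G).card : ℕ) : ℝ) / ω ^ 3)) := by
  classical
  have h1 : ∀ t ∈ T, BilinearBound S M (fun s m => g (c + s - (ρ t + m)))
      (M.card * (2 * ω * S.card
        + (((S'.filter fun s => c + s ∉ G).card : ℕ) : ℝ) / ω ^ 3)) := by
    intro t ht h e hh he
    -- The extra shift moves the base point to `c - ρ t`. Since `S - ρ t` lies in `S'`, one count of
    -- bad points in `S'` serves all `t`.
    have hb : (((S.filter fun s => (c - ρ t) + s ∉ (G : Set ℤ)).card : ℕ) : ℝ)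
        ≤ (((S'.filter fun s => c + s ∉ G).card : ℕ) : ℝ) := by
      have : (S.filter fun s => (c - ρ t) + s ∉ (G : Set ℤ)).card
          ≤ (S'.filter fun s => c + s ∉ G).card := by
        refine Finset.card_le_card_of_injOn (fun s => s - ρ t) ?_ ?_
        · intro s hs
          have hs' := Finset.mem_filter.1 (Finset.mem_coe.1 hs)
          refine Finset.mem_coe.2 (Finset.mem_filter.2 ⟨hT s hs'.1 t ht, ?_⟩)
          have h2 := hs'.2
          rw [Finset.mem_coe] at h2
          convert h2 using 2
          ring
        · intro a _ b _ hab
          simpa using hab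
      exact_mod_cast this
    have h3 := abs_bilinear_le g hg M S S' (G : Set ℤ) ω hω hω' (fun n hn => hG n hn) (c - ρ t)
      hM hS' _ (le_of_eq_of_le (by congr!) hb) h e hh he
    refine le_of_eq_of_le ?_ h3
    congr 1
    refine Finset.sum_congr rfl fun s _ => Finset.sum_congr rfl fun m _ => ?_
    change g (c + s - (ρ t + m)) * h s * e m = _
    rw [show c + s - (ρ t + m) = c - ρ t + s - m by ring]
  have h2 := BilinearBound.prod (k := fun s q => g (c + s - (ρ q.1 + q.2))) h1
  convert h2 using 1
  rw [Finset.card_product]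
  push_cast
  ring

/-- The average of a uniform function over most windows is small. -/
theorem sum_abs_window_le {τ : Type*} (g : ℤ → ℝ) (hg : ∀ n, |g n| ≤ 1)
    (M Y Y' G : Finset ℤ) (T : Finset τ) (ρ : τ → ℤ) (α : ℝ) (hα : 0 ≤ α)
    (hG : ∀ n ∈ G, ∀ x : ℝ, ‖∑ m ∈ M, ((g (n - m) : ℝ) : ℂ) * expNeg m x‖ ≤ α * M.card)
    (hMneg : ∀ m ∈ M, -m ∈ M) (hT : ∀ y ∈ Y, ∀ t ∈ T, y + ρ t ∈ Y') (hGY : G ⊆ Y') :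
    ∑ y ∈ Y, |∑ q ∈ T ×ˢ M, g (y + (ρ q.1 + q.2))|
      ≤ (T ×ˢ M).card * (α * Y.card + (Y'.card - G.card)) := by
  classical
  have h1 : ∀ n, |∑ m ∈ M, g (n + m)| ≤ M.card * (α + if n ∉ G then 1 else 0) := by
    intro n
    by_cases hn : n ∈ G
    · have h2 := hG n hn 0
      have h3 : ∑ m ∈ M, ((g (n - m) : ℝ) : ℂ) * expNeg m 0
          = ((∑ m ∈ M, g (n + m) : ℝ) : ℂ) := by
        rw [← sum_neg_eq M hMneg (fun m => g (n + m))]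
        push_cast
        refine Finset.sum_congr rfl fun m _ => ?_
        simp [expNeg, sub_eq_add_neg]
      rw [h3, Complex.norm_real, Real.norm_eq_abs] at h2
      simp only [hn, not_true, if_false, add_zero]
      linarith
    · simp only [hn, not_false_iff, if_true]
      refine (abs_sum_le_card_mul M _ 1 fun m _ => hg _).trans ?_
      gcongr
      linarith
  have h4 : ∀ y ∈ Y, |∑ q ∈ T ×ˢ M, g (y + (ρ q.1 + q.2))|
      ≤ ∑ t ∈ T, M.card * (α + if y + ρ t ∉ G then 1 else 0) := by
    intro y _
    rw [Finset.sum_product]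
    refine (Finset.abs_sum_le_sum_abs _ _).trans (Finset.sum_le_sum fun t _ => ?_)
    simp_rw [← add_assoc]
    exact h1 _
  refine (Finset.sum_le_sum h4).trans ?_
  rw [Finset.sum_comm]
  refine (Finset.sum_le_card_nsmul _ _ (M.card * (α * Y.card + (Y'.card - G.card)))
    fun t ht => ?_).trans (le_of_eq ?_)
  · rw [← Finset.mul_sum]
    refine mul_le_mul_of_nonneg_left ?_ (Nat.cast_nonneg _)
    rw [Finset.sum_add_distrib, Finset.sum_const, nsmul_eq_mul, Finset.sum_boole, mul_comm]
    gcongr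
    exact card_shift_notMem_le Y Y' G (ρ t) (fun y hy => hT y hy t ht) hGY
  · rw [Finset.card_product, nsmul_eq_mul]
    push_cast
    ring

/-- The corner sum of a function with small box form on a product of two uniform sets. The sets
`S ⊆ S'` and `Y ⊆ Y'` are enlargements of `L` and `L₂`. -/
theorem cornerSum_pow_four_le_of_good (W M₁ M₂ : Finset ℤ) (hW : 0 < W.card) (hM₁ : 0 < M₁.card)
    (hM₂ : 0 < M₂.card) (hWneg : ∀ m ∈ W, -m ∈ W) (hM₁neg : ∀ m ∈ M₁, -m ∈ M₁)
    (hM₂neg : ∀ m ∈ M₂, -m ∈ M₂)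
    (L L₂ S S' Y Y' T : Finset ℤ) (hWT : W ⊆ T) (hM₁T : M₁ ⊆ T) (hM₂T : M₂ ⊆ T)
    (hLS : ∀ x ∈ L, ∀ t₁ ∈ T, ∀ t₂ ∈ T, ∀ t₃ ∈ T, x + t₁ + t₂ + t₃ ∈ S)
    (hSS' : ∀ x ∈ S, ∀ t₁ ∈ T, ∀ t₂ ∈ T, x + t₁ + t₂ ∈ S')
    (hSS : ∀ x ∈ S, ∀ t ∈ T, x + t ∈ S')
    (hL₂Y : ∀ x ∈ L₂, ∀ t₁ ∈ T, ∀ t₂ ∈ T, ∀ t₃ ∈ T, x + t₁ + t₂ + t₃ ∈ Y)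
    (hYY' : ∀ x ∈ Y, ∀ t₁ ∈ T, ∀ t₂ ∈ T, x + t₁ + t₂ ∈ Y')
    (hYSY' : ∀ y ∈ Y, ∀ s ∈ S', ∀ x ∈ S, y + s - x ∈ Y')
    (hS'card : (S'.card : ℝ) ≤ 2 * S.card)
    (f a : ℤ → ℤ → ℝ) (E₁ E₂ : Finset ℤ) (l : ℤ)
    (hf : ∀ x y, f x y ≠ 0 → x ∈ L ∧ y ∈ L₂) (hf1 : ∀ x y, |f x y| ≤ 1)
    (ha : ∀ x y, a x y ≠ 0 → x ∈ L ∧ y ∈ L₂) (hE₂ : E₂ ⊆ L₂)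
    (hae : ∀ x y, |a x y| ≤ charFn E₁ (x + l) * charFn E₂ y)
    (β₁ β₂ ω B K₁ K₂ : ℝ) (hβ₁ : 0 ≤ β₁) (hβ₁' : β₁ ≤ 1) (hβ₂ : 0 ≤ β₂) (hβ₂' : β₂ ≤ 1)
    (hω : 0 < ω) (hω' : 4 * ω ≤ 1)
    (hK₁ : ∑ x ∈ L, charFn E₁ (x + l) ≤ K₁) (hK₂ : ∑ y ∈ L₂, charFn E₂ y ≤ K₂)
    (G₁ G₂ : Finset ℤ)
    (hG₁ : ∀ n ∈ G₁, ∀ x : ℝ,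
      ‖∑ m ∈ M₁, ((charFn E₁ (n - m) - β₁ : ℝ) : ℂ) * expNeg m x‖ ≤ ω ^ 8 * M₁.card)
    (hG₂ : ∀ n ∈ G₂, ∀ x : ℝ,
      ‖∑ m ∈ M₂, ((charFn E₂ (n - m) - β₂ : ℝ) : ℂ) * expNeg m x‖ ≤ ω ^ 8 * M₂.card)
    (hbad₁ : (((S'.filter fun s => l + s ∉ G₁).card : ℕ) : ℝ) ≤ ω ^ 4 * S.card)
    (hG₂Y : G₂ ⊆ Y') (hbad₂ : (Y'.card : ℝ) - G₂.card ≤ 2 * ω ^ 8 * Y.card)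
    (hB : ∑ x ∈ S', ∑ y ∈ Y', boxForm W f x y ≤ (W.card : ℝ) ^ 4 * B) :
    cornerSum L L₂ f a ^ 4 ≤ (S.card * (K₁ * K₂)) ^ 2
      * ((S.card : ℝ) ^ 2 * Y.card * (β₁ ^ 2 * β₂ ^ 2 + 5 * (3 * ω)))
      * (β₁ ^ 2 * β₂ ^ 2 * S.card * B + 4 * (3 * ω) * (S.card : ℝ) ^ 2 * Y.card) := by
  classical
  have hω1 : ω ≤ 1 / 4 := by linarith
  have hω12 : 2 * ω ^ 12 ≤ 1 := by
    have : ω ^ 12 ≤ (1 / 4 : ℝ) ^ 12 := pow_le_pow_left₀ hω.le hω1 12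
    norm_num at this
    linarith
  have hbal : ∀ (E : Finset ℤ) (β : ℝ), 0 ≤ β → β ≤ 1 → ∀ n, |charFn E n - β| ≤ 1 := by
    intro E β h0 h1 n
    rw [abs_le]
    constructor <;> linarith [charFn_nonneg E n, charFn_le_one E n]
  have hWT' : ∀ w ∈ W, -w ∈ T := fun w hw => hWT (hWneg w hw)
  have hM₁T' : ∀ w ∈ M₁, -w ∈ T := fun w hw => hM₁T (hM₁neg w hw)
  have hM₂T' : ∀ w ∈ M₂, -w ∈ T := fun w hw => hM₂T (hM₂neg w hw)
  have hPc : ((W ×ˢ M₁ ×ˢ M₂).card : ℝ) = W.card * M₁.card * M₂.card := by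
    rw [Finset.card_product, Finset.card_product]
    push_cast
    ring
  refine cornerSum_pow_four_le_of_uniform W (M₁ ×ˢ M₂) (fun n => n.1 + n.2) hW
    (by rw [Finset.card_product]; positivity) L L₂ S S' Y Y' f a (fun x => charFn E₁ (x + l))
    (charFn E₂) hf hf1 ha (fun _ => charFn_nonneg _ _) (fun _ => charFn_nonneg _ _)
    (fun _ => charFn_le_one _ _) (fun _ => charFn_le_one _ _)
    (fun y hy => hE₂ (mem_of_charFn_ne_zero hy)) hae ?_ ?_ ?_ ?_ ?_ β₁ β₂ (3 * ω) B K₁ K₂ hβ₁ hβ₁'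
    hβ₂ hβ₂' (by positivity) hK₁ hK₂ ?_
    (fun x y => 2 * ω * S.card + (((S'.filter fun s => y - x + s ∉ G₂).card : ℕ) : ℝ) / ω ^ 3)
    ?_ ?_ ?_ hB
  · intro x hx w hw n hn
    have hn' := Finset.mem_product.1 hn
    have := hLS x hx _ (hWT' w hw) _ (hM₁T' _ hn'.1) _ (hM₂T' _ hn'.2)
    convert this using 1
    ring
  · intro x hx w hw n hn
    have hn' := Finset.mem_product.1 hn
    have := hLS x hx _ (hWT hw) _ (hM₁T hn'.1) _ (hM₂T hn'.2)
    convert this using 1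
    ring
  · intro x hx w hw n hn
    have hn' := Finset.mem_product.1 hn
    have := hL₂Y x hx _ (hWT' w hw) _ (hM₁T' _ hn'.1) _ (hM₂T' _ hn'.2)
    convert this using 1
    ring
  · intro x hx n hn
    have hn' := Finset.mem_product.1 hn
    rw [← add_assoc]
    exact hSS' x hx _ (hM₁T hn'.1) _ (hM₂T hn'.2)
  · intro x hx n hn
    have hn' := Finset.mem_product.1 hn
    rw [← add_assoc]
    exact hYY' x hx _ (hM₁T hn'.1) _ (hM₂T hn'.2)
  -- `M₁` gives the cancellation for `E₁`, while `W` and `M₂` are idle shifts; this explains the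
  -- reordering of the product. The error is `2 ω` from the good windows and `ω⁴ / ω³` from the bad
  -- ones, in all `3 ω`.
  · have h1 := bilinearBound_of_uniform (fun n => charFn E₁ n - β₁) (hbal E₁ β₁ hβ₁ hβ₁')
      M₁ S S' G₁ (W ×ˢ M₂) (fun t => t.1 + t.2) ω hω hω12 hG₁
      (fun s hs m hm => by rw [sub_eq_add_neg]; exact hSS s hs _ (hM₁T' m hm))
      (fun s hs t ht => by
        have ht' := Finset.mem_product.1 ht
        have := hSS' s hs _ (hWT' _ ht'.1) _ (hM₂T' _ ht'.2)
        convert this using 1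
        ring) hS'card l
    have h2 := h1.reindex (P := W ×ˢ M₁ ×ˢ M₂)
      ⟨fun p => ((p.1, p.2.2), p.2.1), fun q => (q.1.1, q.2, q.1.2), fun _ => rfl, fun _ => rfl⟩
      (by simp only [Finset.mem_product, Equiv.coe_fn_mk]; tauto)
    intro h c hh hc
    have h3 := h2 h c hh hc
    have h4 : (((W ×ˢ M₂) ×ˢ M₁).card : ℝ) = (W ×ˢ M₁ ×ˢ M₂).card := by
      rw [hPc, Finset.card_product, Finset.card_product]
      push_cast
      ring
    calc _ = _ := by
          congr 1
          refine Finset.sum_congr rfl fun s _ => Finset.sum_congr rfl fun p _ => ?_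
          simp only [Equiv.coe_fn_mk]
          rw [show s - (p.1 + (p.2.1 + p.2.2)) + l = l + s - (p.1 + p.2.2 + p.2.1) by ring]
      _ ≤ _ := h3
      _ ≤ ((W ×ˢ M₁ ×ˢ M₂).card : ℝ) * (2 * ω * S.card + (ω ^ 4 * S.card) / ω ^ 3) := by
          rw [h4]
          gcongr
      _ = _ := by
          field_simp
          ring
  · intro x _ y _
    have h1 := bilinearBound_of_uniform (fun n => charFn E₂ n - β₂) (hbal E₂ β₂ hβ₂ hβ₂')
      M₂ S S' G₂ (W ×ˢ M₁) (fun t => t.1 + t.2) ω hω hω12 hG₂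
      (fun s hs m hm => by rw [sub_eq_add_neg]; exact hSS s hs _ (hM₂T' m hm))
      (fun s hs t ht => by
        have ht' := Finset.mem_product.1 ht
        have := hSS' s hs _ (hWT' _ ht'.1) _ (hM₁T' _ ht'.2)
        convert this using 1
        ring) hS'card (y - x)
    have h2 := h1.reindex (P := W ×ˢ M₁ ×ˢ M₂)
      ⟨fun p => ((p.1, p.2.1), p.2.2), fun q => (q.1.1, q.1.2, q.2), fun _ => rfl, fun _ => rfl⟩
      (by simp only [Finset.mem_product, Equiv.coe_fn_mk]; tauto)
    intro h c hh hc
    have h3 := h2 h c hh hc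
    have h4 : (((W ×ˢ M₁) ×ˢ M₂).card : ℝ) = (W ×ˢ M₁ ×ˢ M₂).card := by
      rw [hPc, Finset.card_product, Finset.card_product]
      push_cast
      ring
    rw [h4] at h3
    refine le_of_eq_of_le ?_ h3
    congr 1
    refine Finset.sum_congr rfl fun s _ => Finset.sum_congr rfl fun p _ => ?_
    simp only [Equiv.coe_fn_mk]
    rw [show y + s - x - (p.1 + (p.2.1 + p.2.2)) = y - x + s - (p.1 + p.2.1 + p.2.2) by ring]
  -- The number of bad windows of `E₂` near an individual `y - x` is not controlled, only its
  -- average over `y`. Their contribution is `4 ω⁵ |S| |Y|`, which is at most `ω |S| |Y|`.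
  · have h1 : ∀ x ∈ S, ∑ y ∈ Y, (2 * ω * S.card
        + (((S'.filter fun s => y - x + s ∉ G₂).card : ℕ) : ℝ) / ω ^ 3)
        ≤ 3 * ω * S.card * Y.card := by
      intro x hx
      rw [Finset.sum_add_distrib, Finset.sum_const, nsmul_eq_mul, ← Finset.sum_div]
      have h2 := sum_card_shift_notMem_le Y Y' G₂ S' (-x)
        (fun y hy t ht => by rw [← sub_eq_add_neg]; exact hYSY' y hy t ht x hx) hG₂Y
      have h3 : ∑ y ∈ Y, (((S'.filter fun s => y - x + s ∉ G₂).card : ℕ) : ℝ)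
          ≤ (2 * S.card) * (2 * ω ^ 8 * Y.card) := by
        refine le_trans (le_of_eq ?_) (h2.trans ?_)
        · refine Finset.sum_congr rfl fun y _ => ?_
          congr 2
          refine Finset.filter_congr fun t _ => ?_
          rw [show y - x + t = y + t + -x by ring]
        · have h0 : 0 ≤ (Y'.card : ℝ) - G₂.card := by
            have : (G₂.card : ℝ) ≤ Y'.card := by exact_mod_cast Finset.card_le_card hG₂Y
            linarith
          exact mul_le_mul hS'card hbad₂ h0 (by positivity)
      have h4 : (2 * (S.card : ℝ)) * (2 * ω ^ 8 * Y.card) / ω ^ 3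
          ≤ ω * S.card * Y.card := by
        rw [div_le_iff₀ (by positivity)]
        have h5 : 4 * ω ^ 4 ≤ 1 := by
          have : ω ^ 4 ≤ (1 / 4 : ℝ) ^ 4 := pow_le_pow_left₀ hω.le hω1 4
          norm_num at this
          linarith
        calc (2 * (S.card : ℝ)) * (2 * ω ^ 8 * Y.card)
            = (4 * ω ^ 4) * (ω ^ 4 * (S.card * Y.card)) := by ring
          _ ≤ 1 * (ω ^ 4 * (S.card * Y.card)) := by gcongr
          _ = _ := by ring
      calc _ ≤ (Y.card : ℝ) * (2 * ω * S.card)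
            + (2 * S.card) * (2 * ω ^ 8 * Y.card) / ω ^ 3 := by gcongr
        _ ≤ (Y.card : ℝ) * (2 * ω * S.card) + ω * S.card * Y.card := by gcongr
        _ = _ := by ring
    refine (Finset.sum_le_card_nsmul _ _ _ h1).trans (le_of_eq ?_)
    rw [nsmul_eq_mul]
    ring
  · have h1 := sum_abs_window_le (fun n => charFn E₂ n - β₂) (hbal E₂ β₂ hβ₂ hβ₂')
      M₂ Y Y' G₂ (W ×ˢ M₁) (fun t => t.1 + t.2) (ω ^ 8) (by positivity) hG₂ hM₂neg
      (fun y hy t ht => by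
        have ht' := Finset.mem_product.1 ht
        rw [← add_assoc]
        exact hYY' y hy _ (hWT ht'.1) _ (hM₁T ht'.2)) hG₂Y
    have h4 : (((W ×ˢ M₁) ×ˢ M₂).card : ℝ) = (W ×ˢ M₁ ×ˢ M₂).card := by
      rw [hPc, Finset.card_product, Finset.card_product]
      push_cast
      ring
    have h5 : 3 * ω ^ 8 ≤ 3 * ω := by
      have : ω ^ 8 ≤ ω ^ 1 := pow_le_pow_of_le_one hω.le (by linarith) (by norm_num)
      linarith
    calc _ = ∑ y ∈ Y, |∑ q ∈ (W ×ˢ M₁) ×ˢ M₂, (charFn E₂ (y + (q.1.1 + q.1.2 + q.2)) - β₂)| := by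
          refine Finset.sum_congr rfl fun y _ => ?_
          congr 1
          refine Finset.sum_equiv
            ⟨fun p => ((p.1, p.2.1), p.2.2), fun q => (q.1.1, q.1.2, q.2), fun _ => rfl,
              fun _ => rfl⟩ (by simp only [Finset.mem_product, Equiv.coe_fn_mk]; tauto)
            fun p _ => ?_
          simp only [Equiv.coe_fn_mk]
          rw [add_assoc p.1]
      _ ≤ _ := h1
      _ ≤ ((W ×ˢ M₁ ×ˢ M₂).card : ℝ) * (ω ^ 8 * Y.card + 2 * ω ^ 8 * Y.card) := by
          rw [h4]
          gcongr
      _ = ((W ×ˢ M₁ ×ˢ M₂).card : ℝ) * (3 * ω ^ 8 * Y.card) := by ring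
      _ ≤ ((W ×ˢ M₁ ×ˢ M₂).card : ℝ) * (3 * ω * Y.card) := by gcongr
      _ = _ := by ring

end

/-! ### Density in strips and the main term -/

noncomputable section

/-- `X + t` lies in `X'` and misses just `|X'| - |X|` of its points. -/
theorem abs_sum_sub_sum_shift_le (X X' : Finset ℤ) (t : ℤ) (h : ∀ x ∈ X, x + t ∈ X')
    (g : ℤ → ℝ) (C : ℝ) (hg : ∀ n, |g n| ≤ C) :
    |∑ x ∈ X', g x - ∑ x ∈ X, g (x + t)| ≤ (X'.card - X.card) * C := by
  classical
  have hsub : X.image (fun x => x + t) ⊆ X' := by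
    intro y hy
    obtain ⟨x, hx, rfl⟩ := Finset.mem_image.1 hy
    exact h x hx
  have hinj : Set.InjOn (fun x : ℤ => x + t) X := fun a _ b _ hab => by simpa using hab
  rw [← Finset.sum_image (s := X) (g := fun x => x + t) (f := g) hinj,
    ← Finset.sum_sdiff hsub, add_sub_cancel_right]
  refine (abs_sum_le_card_mul _ _ C fun n _ => hg n).trans (le_of_eq ?_)
  rw [Finset.card_sdiff_of_subset hsub, Nat.cast_sub (Finset.card_le_card hsub),
    Finset.card_image_of_injOn hinj]

/-- The density of a uniform set on a translate of `L` most of whose windows are uniform. -/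
theorem abs_sum_balanced_le (g : ℤ → ℝ) (hg : ∀ n, |g n| ≤ 1) (M L S S' G : Finset ℤ)
    (hMc : 0 < M.card) (ω : ℝ) (hω : 0 < ω) (hω' : 2 * ω ^ 12 ≤ 1)
    (hG : ∀ n ∈ G, ∀ x : ℝ, ‖∑ m ∈ M, ((g (n - m) : ℝ) : ℂ) * expNeg m x‖ ≤ ω ^ 8 * M.card)
    (hLM : ∀ x ∈ L, ∀ m ∈ M, x + m ∈ S) (hM : ∀ s ∈ S, ∀ m ∈ M, s - m ∈ S') (hSS' : S ⊆ S')
    (hS' : (S'.card : ℝ) ≤ 2 * S.card) (l : ℤ)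
    (hbad : (((S'.filter fun s => l + s ∉ G).card : ℕ) : ℝ) ≤ ω ^ 4 * S.card) :
    |∑ x ∈ L, g (x + l)| ≤ 3 * ω * S.card + (S.card - L.card) := by
  classical
  have hM0 : (0 : ℝ) < M.card := by exact_mod_cast hMc
  -- With both test functions equal to `1`, the bilinear form is a sum over `m ∈ M` of sums of `g`
  -- over translates of `S`. Each differs from the sum over `L + l` by at most `|S| - |L|`.
  have h1 := abs_bilinear_le g hg M S S' (G : Set ℤ) ω hω hω' (fun n hn => hG n hn) l hM hS'
    (ω ^ 4 * S.card) (le_trans (by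
      have : (S.filter fun s => l + s ∉ (G : Set ℤ)).card
          ≤ (S'.filter fun s => l + s ∉ G).card := Finset.card_le_card (by
        intro s hs
        have hs' := Finset.mem_filter.1 hs
        exact Finset.mem_filter.2 ⟨hSS' hs'.1, fun h => hs'.2 (Finset.mem_coe.2 h)⟩)
      refine le_trans (le_of_eq ?_) (Nat.cast_le.2 this)
      congr!) hbad) (fun _ => 1) (fun _ => 1) (by simp) (by simp)
  simp only [mul_one] at h1
  have h2 : (M.card : ℝ) * |∑ x ∈ L, g (x + l)|
      ≤ |∑ s ∈ S, ∑ m ∈ M, g (l + s - m)| + M.card * (S.card - L.card) := by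
    have h3 : (M.card : ℝ) * ∑ x ∈ L, g (x + l) = ∑ s ∈ S, ∑ m ∈ M, g (l + s - m)
        - ∑ m ∈ M, (∑ s ∈ S, g (l + s - m) - ∑ x ∈ L, g (l + (x + m) - m)) := by
      rw [Finset.sum_sub_distrib, Finset.sum_comm (s := S), sub_sub_cancel]
      have : ∀ m ∈ M, ∑ x ∈ L, g (l + (x + m) - m) = ∑ x ∈ L, g (x + l) := fun m _ =>
        Finset.sum_congr rfl fun x _ => by congr 1; ring
      rw [Finset.sum_congr rfl this, Finset.sum_const, nsmul_eq_mul]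
    have h4 : (M.card : ℝ) * |∑ x ∈ L, g (x + l)| = |(M.card : ℝ) * ∑ x ∈ L, g (x + l)| := by
      rw [abs_mul, abs_of_pos hM0]
    rw [h4, h3]
    refine (abs_sub _ _).trans (add_le_add le_rfl ?_)
    refine abs_sum_le_card_mul _ _ _ fun m hm => ?_
    have := abs_sum_sub_sum_shift_le L S m (fun x hx => hLM x hx m hm)
      (fun s => g (l + s - m)) 1 (fun n => hg _)
    simpa using this
  have h5 : 2 * ω * S.card + ω ^ 4 * S.card / ω ^ 3 = 3 * ω * S.card := by
    field_simp
    ring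
  rw [h5] at h1
  have h6 : (M.card : ℝ) * |∑ x ∈ L, g (x + l)|
      ≤ M.card * (3 * ω * S.card + (S.card - L.card)) := by
    rw [mul_add]
    linarith
  exact le_of_mul_le_mul_left h6 hM0

/-- A lower bound for the number of pairs of points on a common antidiagonal. -/
theorem sq_sum_le_card_mul_diag (L L₂ Y : Finset ℤ) (a : ℤ → ℤ → ℝ)
    (ha : ∀ x y, a x y ≠ 0 → x ∈ L ∧ y ∈ L₂) (hY : ∀ x ∈ L, ∀ y ∈ L₂, y + x ∈ Y) :
    (∑ x ∈ L, ∑ y ∈ L₂, a x y) ^ 2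
      ≤ Y.card * ∑ x ∈ L, ∑ y ∈ L₂, ∑ s ∈ L, a s y * a x (y + s - x) := by
  -- The label `z = x + y` of the antidiagonal takes its values in `Y`. The points `(s, y)` and `(x,
  -- y + s - x)` share it, so the triple sum is a sum of squares over `z`.
  have h1 : ∑ x ∈ L, ∑ y ∈ L₂, a x y = ∑ z ∈ Y, ∑ x ∈ L, a x (z - x) := by
    rw [Finset.sum_comm (s := Y)]
    refine Finset.sum_congr rfl fun x hx => ?_
    simp_rw [sub_eq_add_neg]
    exact (sum_shift_eq Y L₂ (-x) (a x) (fun y hy => (ha x y hy).2)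
      (fun y hy => by rw [sub_neg_eq_add]; exact hY x hx y hy)).symm
  have h2 : ∑ x ∈ L, ∑ y ∈ L₂, ∑ s ∈ L, a s y * a x (y + s - x)
      = ∑ z ∈ Y, (∑ x ∈ L, a x (z - x)) ^ 2 := by
    simp_rw [sq, Finset.sum_mul_sum]
    rw [Finset.sum_comm (s := Y)]
    refine Finset.sum_congr rfl fun x _ => ?_
    rw [Finset.sum_comm, Finset.sum_comm (s := Y)]
    refine Finset.sum_congr rfl fun s hs => ?_
    rw [← sum_shift_eq Y L₂ (-s) (fun y => a s y * a x (y + s - x))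
      (fun y hy => (ha s y (left_ne_zero_of_mul hy)).2)
      (fun y hy => by rw [sub_neg_eq_add]; exact hY s hs y hy)]
    refine Finset.sum_congr rfl fun z _ => ?_
    rw [show z + -s + s - x = z - x by ring, show z + -s = z - s by ring, mul_comm]
  rw [h1, h2]
  exact sq_sum_le_card_mul_sum_sq

/-- The corner sum of a set `a` is bounded below by its main term plus the corner sum of its
balanced function. -/
theorem cornerSum_self_ge (L L₂ Y : Finset ℤ) (f a e : ℤ → ℤ → ℝ) (δ : ℝ) (hδ : 0 ≤ δ)
    (ha : ∀ x y, a x y ≠ 0 → x ∈ L ∧ y ∈ L₂) (hY : ∀ x ∈ L, ∀ y ∈ L₂, y + x ∈ Y)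
    (hf : ∀ x y, f x y = a x y - δ * e x y)
    (he : ∀ x y y' s, a s y ≠ 0 → a x y' ≠ 0 → e x y = 1) :
    δ * (∑ x ∈ L, ∑ y ∈ L₂, a x y) ^ 2 + Y.card * cornerSum L L₂ f a
      ≤ Y.card * cornerSum L L₂ a a := by
  have h1 : cornerSum L L₂ a a = cornerSum L L₂ f a
      + δ * ∑ x ∈ L, ∑ y ∈ L₂, ∑ s ∈ L, a s y * a x (y + s - x) := by
    unfold cornerSum
    simp_rw [Finset.mul_sum, ← Finset.sum_add_distrib]
    refine Finset.sum_congr rfl fun x _ => Finset.sum_congr rfl fun y _ =>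
      Finset.sum_congr rfl fun s _ => ?_
    rw [hf]
    by_cases h2 : a s y = 0
    · simp [h2]
    by_cases h3 : a x (y + s - x) = 0
    · simp [h3]
    rw [he x y _ s h2 h3]
    ring
  rw [h1]
  have h2 := sq_sum_le_card_mul_diag L L₂ Y a ha hY
  have h3 := mul_le_mul_of_nonneg_left h2 hδ
  linarith

/-- If a set has only degenerate corners, then the corner sum is its cardinality. -/
theorem cornerSum_self_of_forall_eq (L L₂ : Finset ℤ) (a : ℤ → ℤ → ℝ)
    (ha01 : ∀ x y, a x y = 0 ∨ a x y = 1)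
    (h : ∀ x y s, a x y ≠ 0 → a s y ≠ 0 → a x (y + s - x) ≠ 0 → s = x) :
    cornerSum L L₂ a a = ∑ x ∈ L, ∑ y ∈ L₂, a x y := by
  unfold cornerSum
  refine Finset.sum_congr rfl fun x hx => Finset.sum_congr rfl fun y _ => ?_
  rw [Finset.sum_eq_single_of_mem x hx]
  · rw [add_sub_cancel_right]
    rcases ha01 x y with h0 | h0 <;> simp [h0]
  · intro s _ hs
    by_contra hne
    exact hs (h x y s (left_ne_zero_of_mul (left_ne_zero_of_mul hne))
      (right_ne_zero_of_mul (left_ne_zero_of_mul hne)) (right_ne_zero_of_mul hne))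

/-- The number of points of `A` in the strip `(L + l) × L₂`. -/
def stripCount (L L₂ : Finset ℤ) (A : Finset (ℤ × ℤ)) (l : ℤ) : ℝ :=
  ∑ x ∈ L, ∑ y ∈ L₂, charFn A (x + l, y)

theorem stripCount_le (L L₂ : Finset ℤ) (A : Finset (ℤ × ℤ)) (l : ℤ) :
    stripCount L L₂ A l ≤ L.card * L₂.card := by
  unfold stripCount
  refine (Finset.sum_le_card_nsmul _ _ (L₂.card : ℝ) fun x _ => ?_).trans
    (le_of_eq (nsmul_eq_mul _ _))
  exact (Finset.sum_le_card_nsmul _ _ 1 fun y _ => charFn_le_one _ _).trans (by simp)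

theorem stripCount_le_mul (L L₂ E₁ E₂ : Finset ℤ) (A : Finset (ℤ × ℤ)) (hA : A ⊆ E₁ ×ˢ E₂)
    (l : ℤ) : stripCount L L₂ A l
      ≤ (∑ x ∈ L, charFn E₁ (x + l)) * ∑ y ∈ L₂, charFn E₂ y := by
  unfold stripCount
  rw [Finset.sum_mul_sum]
  refine Finset.sum_le_sum fun x _ => Finset.sum_le_sum fun y _ => ?_
  by_cases h : (x + l, y) ∈ A
  · have := Finset.mem_product.1 (hA h)
    rw [charFn_of_mem h, charFn_of_mem this.1, charFn_of_mem this.2, one_mul]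
  · rw [charFn_of_notMem h]
    exact mul_nonneg (charFn_nonneg _ _) (charFn_nonneg _ _)

theorem sum_charFn_eq_card {L E : Finset ℤ} (h : E ⊆ L) : ∑ y ∈ L, charFn E y = E.card := by
  classical
  rw [← Finset.sum_subset h (fun x _ hx => charFn_of_notMem hx),
    Finset.sum_congr rfl fun x hx => charFn_of_mem hx]
  simp

/-- On average over the translates, a strip contains the expected number of points. -/
theorem sum_stripCount_ge (L L₁ L₁' L₂ : Finset ℤ) (A : Finset (ℤ × ℤ)) (hA : A ⊆ L₁ ×ˢ L₂)
    (hL₁ : L₁ ⊆ L₁') (hL₁' : ∀ l ∈ L₁, ∀ x ∈ L, l + x ∈ L₁') :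
    L.card * (A.card - (L₁'.card - L₁.card) * L₂.card) ≤ ∑ l ∈ L₁, stripCount L L₂ A l := by
  classical
  unfold stripCount
  rw [Finset.sum_comm, ← nsmul_eq_mul]
  refine Finset.card_nsmul_le_sum _ _ _ fun x hx => ?_
  have h1 := abs_sum_sub_sum_shift_le L₁ L₁' x (fun l hl => hL₁' l hl x hx)
    (fun u => ∑ y ∈ L₂, charFn A (u, y)) L₂.card (fun n => by
      refine (abs_sum_le_card_mul _ _ 1 fun y _ => ?_).trans (by simp)
      rw [abs_of_nonneg (charFn_nonneg _ _)]
      exact charFn_le_one _ _)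
  have h2 : ∑ u ∈ L₁', ∑ y ∈ L₂, charFn A (u, y) = A.card := by
    rw [← Finset.sum_product', ← Finset.sum_subset
      (hA.trans (Finset.product_subset_product hL₁ (Finset.Subset.refl _)))
      (fun q _ hq => charFn_of_notMem hq), Finset.sum_congr rfl fun q hq => charFn_of_mem hq]
    simp
  rw [h2] at h1
  have h3 := (abs_le.1 h1).2
  simp only [add_comm x]
  linarith

/-- Some strip outside two small exceptional sets contains many points. -/
theorem exists_strip (L L₁ L₁' L₂ : Finset ℤ) (A : Finset (ℤ × ℤ)) (hA : A ⊆ L₁ ×ˢ L₂)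
    (hL₁ : L₁ ⊆ L₁') (hL₁' : ∀ l ∈ L₁, ∀ x ∈ L, l + x ∈ L₁') (hL₁pos : 0 < L₁.card)
    (hLpos : 0 < L.card) (hL₂pos : 0 < L₂.card)
    (κ ρ b δ : ℝ) (hb : 0 < b) (hδ : 0 < δ)
    (hκ : (L₁'.card : ℝ) ≤ (1 + κ) * L₁.card)
    (hcard : (A.card : ℝ) = δ * b * L₁.card * L₂.card)
    (bad₁ bad₂ : Finset ℤ) (hbad₁ : (bad₁.card : ℝ) ≤ 2 ^ (-7 : ℤ) * δ * L₁.card)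
    (hbad₂ : (bad₂.card : ℝ) ≤ ρ * L₁.card)
    (hup : ∀ l ∈ L₁, l ∉ bad₂ → stripCount L L₂ A l ≤ 2 * b * L.card * L₂.card)
    (hsmall : κ + ρ ≤ δ * b / 8) :
    ∃ l ∈ L₁, l ∉ bad₁ ∧ l ∉ bad₂ ∧ δ * b / 2 * L.card * L₂.card ≤ stripCount L L₂ A l := by
  classical
  by_contra hcon
  push Not at hcon
  have hp : (0 : ℝ) < L.card := by exact_mod_cast hLpos
  have hq : (0 : ℝ) < L₂.card := by exact_mod_cast hL₂pos
  have hr : (0 : ℝ) < L₁.card := by exact_mod_cast hL₁pos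
  -- The set `bad₁` is small compared with `δ` but perhaps not with `δ b`, so on it the bound `2 b
  -- |L| |L₂|` is needed; on the much smaller `bad₂` the trivial bound suffices. The total is at
  -- most `δ b (1/2 + 1/64)` plus `ρ`, short of the average `δ b - κ`.
  have h1 : ∀ l ∈ L₁, stripCount L L₂ A l ≤ δ * b / 2 * L.card * L₂.card
      + 2 * b * L.card * L₂.card * (if l ∈ bad₁ then 1 else 0)
      + L.card * L₂.card * (if l ∈ bad₂ then 1 else 0) := by
    intro l hl
    have hpos1 : 0 ≤ δ * b / 2 * L.card * L₂.card := by positivity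
    have hpos2 : 0 ≤ 2 * b * L.card * L₂.card := by positivity
    by_cases h2 : l ∈ bad₂
    · rw [if_pos h2]
      have := stripCount_le L L₂ A l
      have : 0 ≤ 2 * b * L.card * L₂.card * (if l ∈ bad₁ then (1 : ℝ) else 0) := by
        split_ifs <;> simp [hpos2]
      linarith
    · rw [if_neg h2]
      by_cases h3 : l ∈ bad₁
      · rw [if_pos h3]
        have := hup l hl h2
        linarith
      · rw [if_neg h3]
        have := hcon l hl h3 h2
        linarith
  have h2 := Finset.sum_le_sum h1
  rw [Finset.sum_add_distrib, Finset.sum_add_distrib, Finset.sum_const, nsmul_eq_mul,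
    ← Finset.mul_sum, ← Finset.mul_sum, Finset.sum_boole, Finset.sum_boole] at h2
  have h3 : (((L₁.filter fun l => l ∈ bad₁).card : ℕ) : ℝ) ≤ 2 ^ (-7 : ℤ) * δ * L₁.card :=
    le_trans (Nat.cast_le.2 (Finset.card_le_card fun l hl => (Finset.mem_filter.1 hl).2)) hbad₁
  have h4 : (((L₁.filter fun l => l ∈ bad₂).card : ℕ) : ℝ) ≤ ρ * L₁.card :=
    le_trans (Nat.cast_le.2 (Finset.card_le_card fun l hl => (Finset.mem_filter.1 hl).2)) hbad₂
  have h5 := sum_stripCount_ge L L₁ L₁' L₂ A hA hL₁ hL₁'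
  have h6 : (L₁'.card : ℝ) - L₁.card ≤ κ * L₁.card := by linarith
  have h7 : (L.card : ℝ) * (δ * b * L₁.card * L₂.card - κ * L₁.card * L₂.card)
      ≤ (L₁.card : ℝ) * (δ * b / 2 * L.card * L₂.card)
        + 2 * b * L.card * L₂.card * (2 ^ (-7 : ℤ) * δ * L₁.card)
        + L.card * L₂.card * (ρ * L₁.card) := by
    refine le_trans ?_ (h5.trans (h2.trans ?_))
    · rw [hcard]
      gcongr
    · gcongr
  have h8 : (L₁.card : ℝ) * L.card * L₂.card * (δ * b) ≤
      (L₁.card : ℝ) * L.card * L₂.card * (δ * b / 2 + δ * b / 64 + (κ + ρ)) := by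
    norm_num at h7
    linarith
  have h9 := le_of_mul_le_mul_left h8 (by positivity)
  have : 0 < δ * b := by positivity
  linarith

end

/-! ### Dirichlet's theorem, short windows and very dense sets -/

noncomputable section

theorem norm_coe_unitAddCircle_le (x : ℝ) : ‖(x : UnitAddCircle)‖ ≤ |x| := by
  rw [UnitAddCircle.norm_eq]
  simpa using round_le x 0

/-- Dirichlet's theorem on simultaneous approximation, for Bohr sets. -/
theorem exists_ne_zero_mem_bohrPoints {d : ℕ} (θ : Fin d → UnitAddCircle) (E : ℝ) (n K : ℕ)
    (hK : 0 < K) (hKE : 1 / (K : ℝ) ≤ E) (hn : K ^ d < n + 1) :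
    ∃ t : ℤ, t ≠ 0 ∧ t ∈ bohrPoints θ E n := by
  classical
  have hK' : (0 : ℝ) < K := by exact_mod_cast hK
  choose r hr using fun j => QuotientAddGroup.mk_surjective (θ j)
  have hfl : ∀ x : ℝ, ⌊(K : ℝ) * Int.fract x⌋₊ < K := fun x => by
    rw [Nat.floor_lt (mul_nonneg hK'.le (Int.fract_nonneg _))]
    exact mul_lt_of_lt_one_right hK' (Int.fract_lt_one _)
  -- Pigeonhole: the torus is cut into `K ^ d` boxes of side `1 / K`, and two of the `n + 1`
  -- multiples `0, …, n` of the generative vector share a box. Their difference is the required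
  -- integer.
  set φ : ℕ → Fin d → Fin K := fun m j => ⟨⌊(K : ℝ) * Int.fract (m * r j)⌋₊, hfl _⟩ with hφ
  obtain ⟨u, hu, v, hv, huv, he⟩ := Finset.exists_ne_map_eq_of_card_lt_of_maps_to
    (s := Finset.range (n + 1)) (t := (Finset.univ : Finset (Fin d → Fin K)))
    (by simpa using hn) (f := φ) (fun _ _ => Finset.mem_univ _)
  refine ⟨(u : ℤ) - v, by omega, ?_⟩
  rw [mem_bohrPoints]
  rw [Finset.mem_range] at hu hv
  refine ⟨by rw [abs_le]; constructor <;> omega, fun j => ?_⟩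
  have h1 : ⌊(K : ℝ) * Int.fract (u * r j)⌋₊ = ⌊(K : ℝ) * Int.fract (v * r j)⌋₊ := by
    have := congrFun he j
    simpa [hφ] using this
  have h2 : |Int.fract ((u : ℝ) * r j) - Int.fract ((v : ℝ) * r j)| < 1 / K := by
    have a1 := Nat.floor_le (mul_nonneg hK'.le (Int.fract_nonneg ((u : ℝ) * r j)))
    have a2 := Nat.lt_floor_add_one ((K : ℝ) * Int.fract ((u : ℝ) * r j))
    have a3 := Nat.floor_le (mul_nonneg hK'.le (Int.fract_nonneg ((v : ℝ) * r j)))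
    have a4 := Nat.lt_floor_add_one ((K : ℝ) * Int.fract ((v : ℝ) * r j))
    rw [h1] at a1 a2
    have h : ∀ z : ℝ, |z| * K = |K * z| := fun z => by rw [abs_mul, abs_of_pos hK', mul_comm]
    rw [lt_div_iff₀ hK', h, mul_sub, abs_lt]
    constructor <;> linarith
  have h3 : ((u : ℤ) - v) • θ j
      = ((Int.fract ((u : ℝ) * r j) - Int.fract ((v : ℝ) * r j) : ℝ) : UnitAddCircle) := by
    have e1 : Int.fract ((u : ℝ) * r j) - Int.fract ((v : ℝ) * r j)
        = ((u : ℤ) - v) • r j - ((⌊(u : ℝ) * r j⌋ - ⌊(v : ℝ) * r j⌋ : ℤ) : ℝ) := by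
      rw [← Int.self_sub_floor, ← Int.self_sub_floor, zsmul_eq_mul]
      push_cast
      ring
    rw [e1, ← hr j, AddCircle.coe_sub]
    have e2 : ((((⌊(u : ℝ) * r j⌋ - ⌊(v : ℝ) * r j⌋ : ℤ) : ℝ)) : UnitAddCircle) = 0 := by
      rw [AddCircle.coe_eq_zero_iff]
      exact ⟨⌊(u : ℝ) * r j⌋ - ⌊(v : ℝ) * r j⌋, by simp⟩
    rw [e2, sub_zero]
    rfl
  rw [h3]
  exact (norm_coe_unitAddCircle_le _).trans_lt (h2.trans_le hKE)

/-- A uniform set whose windows are short has density almost `0` or almost `1`. -/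
theorem density_extreme_of_card_le (E M : Finset ℤ) (β α n : ℝ) (c : ℤ)
    (hM : 0 < M.card) (hMn : (M.card : ℝ) ≤ n)
    (hc : ∀ x : ℝ, ‖∑ m ∈ M, ((charFn E (c - m) - β : ℝ) : ℂ) * expNeg m x‖ ≤ α * M.card) :
    β ^ 2 ≤ α ^ 2 * n ∨ (1 - β) ^ 2 ≤ α ^ 2 * n := by
  by_contra hcon
  push Not at hcon
  have h1 := sum_sq_le_of_fourier_le M (fun m => charFn E (c - m) - β) _ hc
  -- The balanced indicator takes only the values `1 - β` and `-β`. If both squares exceed `α² n`,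
  -- the sum of squares exceeds the bound `α² |M|²` that Parseval allows.
  have h2 : ∑ m ∈ M, α ^ 2 * n < ∑ m ∈ M, (charFn E (c - m) - β) ^ 2 := by
    refine Finset.sum_lt_sum_of_nonempty (Finset.card_pos.1 hM) fun m _ => ?_
    by_cases h : c - m ∈ E
    · rw [charFn_of_mem h]; exact hcon.2
    · rw [charFn_of_notMem h, zero_sub, neg_sq]; exact hcon.1
  rw [Finset.sum_const, nsmul_eq_mul] at h2
  have h3 : α ^ 2 * (M.card : ℝ) * M.card ≤ α ^ 2 * (M.card : ℝ) * n := by gcongr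
  have h4 : (α * (M.card : ℝ)) ^ 2 = α ^ 2 * (M.card : ℝ) * M.card := by ring
  linarith

theorem card_map_notMem_le {X : Type*} [DecidableEq X] (Y Y' A : Finset X) (φ : X → X)
    (hφ : Function.Injective φ) (h : ∀ y ∈ Y, φ y ∈ Y') (hA : A ⊆ Y') :
    (((Y.filter fun y => φ y ∉ A).card : ℕ) : ℝ) ≤ Y'.card - A.card := by
  have h1 : (Y.filter fun y => φ y ∉ A).card ≤ (Y' \ A).card := by
    refine Finset.card_le_card_of_injOn φ ?_ hφ.injOn
    intro y hy
    have hy' := Finset.mem_filter.1 (Finset.mem_coe.1 hy)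
    exact Finset.mem_coe.2 (Finset.mem_sdiff.2 ⟨h y hy'.1, hy'.2⟩)
  rw [← Nat.cast_sub (Finset.card_le_card hA), ← Finset.card_sdiff_of_subset hA]
  exact_mod_cast h1

/-- A set that fills most of a product contains a corner of every admissible side. -/
theorem exists_corner_of_dense (L₁ L₁' L₂ L₂' : Finset ℤ) (A : Finset (ℤ × ℤ))
    (hA : A ⊆ L₁ ×ˢ L₂) (hL₁ : L₁ ⊆ L₁') (hL₂ : L₂ ⊆ L₂') (t : ℤ)
    (h₁ : ∀ x ∈ L₁, x + t ∈ L₁') (h₂ : ∀ y ∈ L₂, y + t ∈ L₂')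
    (hL₁pos : 0 < L₁.card) (hL₂pos : 0 < L₂.card)
    (hc₁ : (L₁'.card : ℝ) ≤ 9 / 8 * L₁.card) (hc₂ : (L₂'.card : ℝ) ≤ 9 / 8 * L₂.card)
    (hAc : 7 / 8 * ((L₁.card : ℝ) * L₂.card) ≤ A.card) :
    ∃ k m : ℤ, (k, m) ∈ A ∧ (k + t, m) ∈ A ∧ (k, m + t) ∈ A := by
  classical
  by_contra hcon
  push Not at hcon
  have hp : (0 : ℝ) < L₁.card := by exact_mod_cast hL₁pos
  have hq : (0 : ℝ) < L₂.card := by exact_mod_cast hL₂pos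
  set X := L₁ ×ˢ L₂ with hX
  have b1 := card_map_notMem_le X X A id Function.injective_id (fun _ h => h) hA
  have b2 := card_map_notMem_le X (L₁' ×ˢ L₂) A (fun z => (z.1 + t, z.2))
    (fun a b hab => by
      simp only [Prod.mk.injEq, add_left_inj] at hab
      exact Prod.ext hab.1 hab.2)
    (fun z hz => by
      have hz' := Finset.mem_product.1 hz
      exact Finset.mem_product.2 ⟨h₁ _ hz'.1, hz'.2⟩)
    (hA.trans (Finset.product_subset_product hL₁ (Finset.Subset.refl _)))
  have b3 := card_map_notMem_le X (L₁ ×ˢ L₂') A (fun z => (z.1, z.2 + t))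
    (fun a b hab => by
      simp only [Prod.mk.injEq, add_left_inj] at hab
      exact Prod.ext hab.1 hab.2)
    (fun z hz => by
      have hz' := Finset.mem_product.1 hz
      exact Finset.mem_product.2 ⟨hz'.1, h₂ _ hz'.2⟩)
    (hA.trans (Finset.product_subset_product (Finset.Subset.refl _) hL₂))
  -- The three conditions fail on at most `1/8`, `1/4` and `1/4` of the product, the last two being
  -- `9/8 - 7/8`. These proportions add up to less than `1`.
  have hcover : X ⊆ (X.filter fun y => id y ∉ A) ∪
      ((X.filter fun z => (z.1 + t, z.2) ∉ A) ∪ X.filter fun z => (z.1, z.2 + t) ∉ A) := by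
    intro z hz
    simp only [Finset.mem_union, Finset.mem_filter, id]
    by_contra hne
    push Not at hne
    exact hcon z.1 z.2 (hne.1 hz) (hne.2.1 hz) (hne.2.2 hz)
  have hcard : (X.card : ℝ) ≤ ((X.filter fun y => id y ∉ A).card : ℝ)
      + (((X.filter fun z => (z.1 + t, z.2) ∉ A).card : ℝ)
        + ((X.filter fun z => (z.1, z.2 + t) ∉ A).card : ℝ)) := by
    have := (Finset.card_le_card hcover).trans ((Finset.card_union_le _ _).trans
      (Nat.add_le_add_left (Finset.card_union_le _ _) _))
    exact_mod_cast this
  rw [Finset.card_product] at b2 b3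
  have hXc : (X.card : ℝ) = L₁.card * L₂.card := by
    rw [hX, Finset.card_product]; push_cast; ring
  push_cast at b2 b3
  rw [hXc] at b1 hcard
  have c1 : (L₁'.card : ℝ) * L₂.card ≤ 9 / 8 * L₁.card * L₂.card := by gcongr
  have c2 : (L₁.card : ℝ) * L₂'.card ≤ L₁.card * (9 / 8 * L₂.card) := by gcongr
  have hpq : 0 < (L₁.card : ℝ) * L₂.card := by positivity
  nlinarith

/-- Every term of the box form is a square, so it is enough to keep `v = v' = 0`, and under that
square `w = 0`. -/
theorem pow_four_le_boxForm (W : Finset ℤ) (hW : (0 : ℤ) ∈ W) (f : ℤ → ℤ → ℝ) (x y : ℤ) :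
    f x y ^ 4 ≤ boxForm W f x y := by
  unfold boxForm
  have h1 : f x y ^ 2 ≤ ∑ w ∈ W, f (x + w) (y + 0) * f (x + w) (y + 0) := by
    have := Finset.single_le_sum (f := fun w => f (x + w) (y + 0) * f (x + w) (y + 0))
      (fun w _ => mul_self_nonneg _) hW
    simpa [sq] using this
  calc f x y ^ 4 = (f x y ^ 2) ^ 2 := by ring
    _ ≤ (∑ w ∈ W, f (x + w) (y + 0) * f (x + w) (y + 0)) ^ 2 := by gcongr
    _ ≤ ∑ v' ∈ W, (∑ w ∈ W, f (x + w) (y + 0) * f (x + w) (y + v')) ^ 2 :=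
        Finset.single_le_sum (f := fun v' =>
          (∑ w ∈ W, f (x + w) (y + 0) * f (x + w) (y + v')) ^ 2) (fun _ _ => sq_nonneg _) hW
    _ ≤ _ := Finset.single_le_sum (f := fun v => ∑ v' ∈ W,
          (∑ w ∈ W, f (x + w) (y + v) * f (x + w) (y + v')) ^ 2)
          (fun _ _ => Finset.sum_nonneg fun _ _ => sq_nonneg _) hW

end

/-! ### Frames of nested sets and the choice of a typical strip -/

noncomputable section

/-- Finite sets `L, W` of small shifts for the large sets `L₁, L₂`, together with slightly enlarged
and slightly shrunk copies of `L, L₁, L₂` whose cardinalities are the same up to a factor close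
to `1`. -/
structure LocalFrame (κ : ℝ) (L₁ L₂ L W : Finset ℤ) where
  T : Finset ℤ
  S : Finset ℤ
  S' : Finset ℤ
  Y : Finset ℤ
  Y' : Finset ℤ
  Yc : Finset ℤ
  L₁' : Finset ℤ
  W_sub : W ⊆ T
  T_sub : T ⊆ L
  zero_mem : 0 ∈ W
  W_neg : ∀ m ∈ W, -m ∈ W
  L_sub : L ⊆ S
  S_sub : S ⊆ S'
  L₂_sub : L₂ ⊆ Y
  Y_sub : Y ⊆ Y'
  Yc_sub : Yc ⊆ L₂
  L₁_sub : L₁ ⊆ L₁'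
  add_three_mem_S : ∀ x ∈ L, ∀ t₁ ∈ T, ∀ t₂ ∈ T, ∀ t₃ ∈ T, x + t₁ + t₂ + t₃ ∈ S
  add_two_mem_S' : ∀ x ∈ S, ∀ t₁ ∈ T, ∀ t₂ ∈ T, x + t₁ + t₂ ∈ S'
  add_mem_S : ∀ x ∈ L, ∀ t ∈ T, x + t ∈ S
  add_mem_S' : ∀ x ∈ S, ∀ t ∈ T, x + t ∈ S'
  add_three_mem_Y : ∀ x ∈ L₂, ∀ t₁ ∈ T, ∀ t₂ ∈ T, ∀ t₃ ∈ T, x + t₁ + t₂ + t₃ ∈ Y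
  add_mem_Y : ∀ x ∈ L, ∀ y ∈ L₂, y + x ∈ Y
  add_two_mem_Y' : ∀ x ∈ Y, ∀ t₁ ∈ T, ∀ t₂ ∈ T, x + t₁ + t₂ ∈ Y'
  add_sub_mem_Y' : ∀ y ∈ Y, ∀ s ∈ S', ∀ x ∈ S, y + s - x ∈ Y'
  sub_add_mem_L₂ : ∀ x ∈ S', ∀ y ∈ Yc, ∀ i ∈ L, x - (y + i) ∈ L₂
  add_mem_L₁' : ∀ l ∈ L₁, ∀ s ∈ S', l + s ∈ L₁'
  card_S' : (S'.card : ℝ) ≤ (1 + κ) * L.card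
  card_Y' : (Y'.card : ℝ) ≤ (1 + κ) * L₂.card
  card_L₁' : (L₁'.card : ℝ) ≤ (1 + κ) * L₁.card
  card_Yc : (1 - κ) * L₂.card ≤ Yc.card

/-- `G` is a set of almost all points of `X`, around each of which `E` has density `β` in a Fourier
sense at the scale of `M`. -/
structure IsGoodSet (α β : ℝ) (X M E G : Finset ℤ) : Prop where
  sub : G ⊆ X
  card_ge : (1 - α) * X.card ≤ G.card
  fourier_le : ∀ n ∈ G, ∀ x : ℝ,
    ‖∑ m ∈ M, ((charFn E (n - m) - β : ℝ) : ℂ) * expNeg m x‖ ≤ α * M.card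

section

variable {L₁ L₂ L W M₁ M₂ E₁ E₂ G₁ G₂ bad : Finset ℤ} {A : Finset (ℤ × ℤ)} {ω β₁ β₂ δ : ℝ}

theorem LocalFrame.card_S_le (F : LocalFrame (ω ^ 8) L₁ L₂ L W) :
    (F.S.card : ℝ) ≤ (1 + ω ^ 8) * L.card :=
  le_trans (by exact_mod_cast Finset.card_le_card F.S_sub) F.card_S'

theorem LocalFrame.card_Y_le (F : LocalFrame (ω ^ 8) L₁ L₂ L W) :
    (F.Y.card : ℝ) ≤ (1 + ω ^ 8) * L₂.card :=
  le_trans (by exact_mod_cast Finset.card_le_card F.Y_sub) F.card_Y'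

theorem LocalFrame.card_L_le (F : LocalFrame (ω ^ 8) L₁ L₂ L W) :
    (L.card : ℝ) ≤ F.S.card := by exact_mod_cast Finset.card_le_card F.L_sub

theorem LocalFrame.card_L₂_le (F : LocalFrame (ω ^ 8) L₁ L₂ L W) :
    (L₂.card : ℝ) ≤ F.Y.card := by exact_mod_cast Finset.card_le_card F.L₂_sub

theorem charFn_sub_abs_le {E : Finset ℤ} {β : ℝ} (h0 : 0 ≤ β) (h1 : β ≤ 1) (n : ℤ) :
    |charFn E n - β| ≤ 1 := by
  have := charFn_nonneg E n
  have := charFn_le_one E n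
  rw [abs_le]; constructor <;> linarith

theorem pow_le_self_of_small (hω : 0 < ω) (hω' : ω ≤ 2⁻¹ ^ 20) {n : ℕ} (hn : 2 ≤ n) :
    ω ^ n ≤ 2⁻¹ ^ 20 * ω := by
  have h1 : ω ≤ 1 := hω'.trans (by norm_num)
  calc ω ^ n ≤ ω ^ 2 := pow_le_pow_of_le_one hω.le h1 hn
    _ = ω * ω := by ring
    _ ≤ _ := by gcongr

/-- The density of `E₁` in a good translate of `L` is close to `β₁`. -/
theorem LocalFrame.abs_sum_charFn_sub_le (F : LocalFrame (ω ^ 8) L₁ L₂ L W) (hM₁T : M₁ ⊆ F.T)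
    (hM₁neg : ∀ m ∈ M₁, -m ∈ M₁) (hM₁ : 0 < M₁.card) (hω : 0 < ω) (hω' : ω ≤ 2⁻¹ ^ 20)
    (hβ₁ : 0 ≤ β₁) (hβ₁' : β₁ ≤ 1) {X : Finset ℤ} (hG : IsGoodSet (ω ^ 8) β₁ X M₁ E₁ G₁) (l : ℤ)
    (hl : (((F.S'.filter fun s => l + s ∉ G₁).card : ℕ) : ℝ) ≤ ω ^ 4 * F.S.card) :
    |∑ x ∈ L, charFn E₁ (x + l) - β₁ * L.card| ≤ 7 * ω * L.card := by
  have p8 := pow_le_self_of_small hω hω' (n := 8) (by norm_num)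
  have p12 := pow_le_self_of_small hω hω' (n := 12) (by norm_num)
  have hS := F.card_S_le
  have hS' := F.card_S'
  have hL := F.card_L_le
  have hp : (0 : ℝ) ≤ L.card := Nat.cast_nonneg _
  -- The constant `7` in the conclusion is `3 · 2 + 1`: `|S| ≤ 2 |L|`, and the boundary `|S| - |L|`
  -- is at most `ω |L|`.
  have h := abs_sum_balanced_le (fun n => charFn E₁ n - β₁) (charFn_sub_abs_le hβ₁ hβ₁') M₁ L
    F.S F.S' G₁ hM₁ ω hω (by norm_num at hω'; nlinarith) hG.fourier_le
    (fun x hx m hm => F.add_mem_S x hx m (hM₁T hm))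
    (fun s hs m hm => by
      have := F.add_mem_S' s hs (-m) (hM₁T (hM₁neg m hm))
      rwa [← sub_eq_add_neg] at this)
    F.S_sub (by norm_num at hω'; nlinarith) l hl
  have e : ∑ x ∈ L, (charFn E₁ (x + l) - β₁) = ∑ x ∈ L, charFn E₁ (x + l) - β₁ * L.card := by
    rw [Finset.sum_sub_distrib, Finset.sum_const, nsmul_eq_mul, mul_comm β₁]
  rw [e] at h
  refine h.trans ?_
  have h1 : (F.S.card : ℝ) ≤ 2 * L.card := by norm_num at hω'; nlinarith
  have h2 : ω ^ 8 * (L.card : ℝ) ≤ ω * L.card := by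
    gcongr; norm_num at p8; linarith
  have h3 : 3 * ω * (F.S.card : ℝ) ≤ 3 * ω * (2 * L.card) := by gcongr
  linarith

/-- There is a translate of `L` in which everything is typical and `A` has many points. -/
theorem LocalFrame.exists_good_strip (F : LocalFrame (ω ^ 8) L₁ L₂ L W) (hM₁T : M₁ ⊆ F.T)
    (hM₁neg : ∀ m ∈ M₁, -m ∈ M₁) (hM₁ : 0 < M₁.card)
    (hω : 0 < ω) (hω' : ω ≤ 2⁻¹ ^ 20) (hωb : ω ≤ 2⁻¹ ^ 20 * (δ * (β₁ * β₂))) (hδ : 0 < δ)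
    (hβ₁ : 0 < β₁) (hβ₁' : β₁ ≤ 1) (hβ₂ : 0 < β₂) (hβ₂' : β₂ ≤ 1) (hδ' : δ ≤ 1)
    (hL₁ : 0 < L₁.card) (hL₂ : 0 < L₂.card)
    (hE₁ : E₁ ⊆ L₁) (hE₂ : E₂ ⊆ L₂) (hA : A ⊆ E₁ ×ˢ E₂)
    (hE₁c : (E₁.card : ℝ) = β₁ * L₁.card) (hE₂c : (E₂.card : ℝ) = β₂ * L₂.card)
    (hAc : (A.card : ℝ) = δ * E₁.card * E₂.card)
    (hG : IsGoodSet (ω ^ 8) β₁ L₁ M₁ E₁ G₁)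
    (hbad : (bad.card : ℝ) ≤ 2 ^ (-7 : ℤ) * δ * L₁.card) :
    ∃ l ∈ L₁, l ∉ bad ∧
      (((F.S'.filter fun s => l + s ∉ G₁).card : ℕ) : ℝ) ≤ ω ^ 4 * F.S.card ∧
      δ * (β₁ * β₂) / 2 * L.card * L₂.card ≤ stripCount L L₂ A l := by
  classical
  have hS := F.card_S_le
  have hS' := F.card_S'
  have hL := F.card_L_le
  have p8 := pow_le_self_of_small hω hω' (n := 8) (by norm_num)
  have p4 := pow_le_self_of_small hω hω' (n := 4) (by norm_num)
  have hLne : 0 < L.card :=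
    Finset.card_pos.2 ⟨0, F.T_sub (F.W_sub F.zero_mem)⟩
  have hp : (0 : ℝ) < L.card := by exact_mod_cast hLne
  have hSpos : (0 : ℝ) < F.S.card := hp.trans_le hL
  have hp1 : (0 : ℝ) < L₁.card := by exact_mod_cast hL₁
  set bad₂ := L₁.filter fun l =>
    ¬ (((F.S'.filter fun s => l + s ∉ G₁).card : ℕ) : ℝ) ≤ ω ^ 4 * F.S.card with hbad₂
  -- Markov's inequality: over all `l` the bad windows number at most `4 ω⁸ |S| |L₁|`, and the
  -- threshold `ω⁴ |S|` leaves at most `4 ω⁴ |L₁|` exceptional `l`.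
  have hmarkov : (bad₂.card : ℝ) ≤ 4 * ω ^ 4 * L₁.card := by
    have h1 := sum_card_shift_notMem_le L₁ F.L₁' G₁ F.S' 0
      (fun y hy t ht => by simpa using F.add_mem_L₁' y hy t ht) (hG.sub.trans F.L₁_sub)
    simp only [add_zero] at h1
    have h2 : (bad₂.card : ℝ) * (ω ^ 4 * F.S.card)
        ≤ ∑ y ∈ L₁, (((F.S'.filter fun t => y + t ∉ G₁).card : ℕ) : ℝ) := by
      calc (bad₂.card : ℝ) * (ω ^ 4 * F.S.card)
          = ∑ _y ∈ bad₂, ω ^ 4 * (F.S.card : ℝ) := by rw [Finset.sum_const, nsmul_eq_mul]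
        _ ≤ ∑ y ∈ bad₂, (((F.S'.filter fun t => y + t ∉ G₁).card : ℕ) : ℝ) :=
            Finset.sum_le_sum fun y hy => (not_le.1 (Finset.mem_filter.1 hy).2).le
        _ ≤ _ := Finset.sum_le_sum_of_subset_of_nonneg (Finset.filter_subset _ _)
            fun _ _ _ => Nat.cast_nonneg _
    have h3 : (F.L₁'.card : ℝ) - G₁.card ≤ 2 * ω ^ 8 * L₁.card := by
      have := F.card_L₁'
      have := hG.card_ge
      linarith
    have h4 : (F.S'.card : ℝ) * ((F.L₁'.card : ℝ) - G₁.card)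
        ≤ (2 * F.S.card) * (2 * ω ^ 8 * L₁.card) := by
      have h5 : (F.S'.card : ℝ) ≤ 2 * F.S.card := by norm_num at hω'; nlinarith
      calc _ ≤ (F.S'.card : ℝ) * (2 * ω ^ 8 * L₁.card) := by gcongr
        _ ≤ _ := by gcongr
    have h6 : (bad₂.card : ℝ) * (ω ^ 4 * F.S.card)
        ≤ 4 * ω ^ 4 * L₁.card * (ω ^ 4 * F.S.card) := by
      calc _ ≤ _ := h2.trans (h1.trans h4)
        _ = _ := by ring
    exact le_of_mul_le_mul_right h6 (by positivity)
  obtain ⟨l, hl, hl1, hl2, hl3⟩ := exists_strip L L₁ F.L₁' L₂ A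
    (hA.trans (Finset.product_subset_product hE₁ hE₂)) F.L₁_sub
    (fun l hl x hx => F.add_mem_L₁' l hl x (F.S_sub (F.L_sub hx))) hL₁ hLne hL₂
    (ω ^ 8) (4 * ω ^ 4) (β₁ * β₂) δ (by positivity) hδ F.card_L₁'
    (by rw [hAc, hE₁c, hE₂c]; ring) bad bad₂ hbad hmarkov
    (fun l hl hl2 => by
      have hl2' : (((F.S'.filter fun s => l + s ∉ G₁).card : ℕ) : ℝ) ≤ ω ^ 4 * F.S.card := by
        by_contra h
        exact hl2 (Finset.mem_filter.2 ⟨hl, h⟩)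
      have h1 := F.abs_sum_charFn_sub_le hM₁T hM₁neg hM₁ hω hω' hβ₁.le hβ₁' hG l hl2'
      have h2 := stripCount_le_mul L L₂ E₁ E₂ A hA l
      rw [sum_charFn_eq_card hE₂, hE₂c] at h2
      refine h2.trans ?_
      have h3 : ∑ x ∈ L, charFn E₁ (x + l) ≤ 2 * β₁ * L.card := by
        have h4 : 7 * ω ≤ β₁ := by
          have : δ * (β₁ * β₂) ≤ β₁ := by
            calc δ * (β₁ * β₂) ≤ 1 * (β₁ * 1) := by gcongr
              _ = β₁ := by ring
          norm_num at hωb; linarith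
        have h5 : 7 * ω * (L.card : ℝ) ≤ β₁ * L.card := by gcongr
        have := (abs_le.1 h1).2
        linarith
      calc (∑ x ∈ L, charFn E₁ (x + l)) * (β₂ * L₂.card)
          ≤ 2 * β₁ * L.card * (β₂ * L₂.card) := by gcongr
        _ = _ := by ring)
    (by norm_num at p8 p4 hωb hω'; nlinarith)
  refine ⟨l, hl, hl1, ?_, hl3⟩
  by_contra h
  exact hl2 (Finset.mem_filter.2 ⟨hl, h⟩)

/-- The sum of the local box norms over almost all base points. -/
theorem LocalFrame.sum_boxForm_core_le {κ : ℝ} (F : LocalFrame κ L₁ L₂ L W) (f : ℤ × ℤ → ℝ)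
    (l : ℤ) (R : ℝ)
    (h : rectNorm4 L L₂ W (localize f L l) ≤ L.card * R) :
    ∑ x ∈ F.S', ∑ y ∈ F.Yc, boxForm W (fun x y => localize f L l (x, y)) x y ≤ R := by
  have hLne : 0 < L.card := Finset.card_pos.2 ⟨0, F.T_sub (F.W_sub F.zero_mem)⟩
  have hp : (0 : ℝ) < L.card := by exact_mod_cast hLne
  have h1 := card_mul_sum_boxForm_le_rectNorm4 L L₂ W F.S' F.Yc F.W_neg (localize f L l)
    (fun x y hxy => mem_of_charFn_ne_zero (right_ne_zero_of_mul hxy)) F.sub_add_mem_L₂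
  exact le_of_mul_le_mul_left (h1.trans h) hp

/-- The rectilinear norm controls only the base points with `y ∈ Yc`. The rest, `Y' \ Yc`, has at
most `2 κ |L₂|` elements, and there the trivial bound `|W|⁴` suffices. -/
theorem LocalFrame.sum_boxForm_le {κ : ℝ} (F : LocalFrame κ L₁ L₂ L W) (hκ : κ ≤ 1) (f : ℤ → ℤ → ℝ)
    (hf : ∀ x y, |f x y| ≤ 1) (R : ℝ)
    (h : ∑ x ∈ F.S', ∑ y ∈ F.Yc, boxForm W f x y ≤ (W.card : ℝ) ^ 4 * R) :
    ∑ x ∈ F.S', ∑ y ∈ F.Y', boxForm W f x y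
      ≤ (W.card : ℝ) ^ 4 * (R + 4 * κ * (L.card * L₂.card)) := by
  classical
  have hsub := F.Yc_sub.trans (F.L₂_sub.trans F.Y_sub)
  have h1 : ∀ x, ∑ y ∈ F.Y', boxForm W f x y
      = ∑ y ∈ F.Yc, boxForm W f x y + ∑ y ∈ F.Y' \ F.Yc, boxForm W f x y := fun x => by
    rw [add_comm, Finset.sum_sdiff hsub]
  simp only [h1]
  rw [Finset.sum_add_distrib]
  have h2 : ∑ x ∈ F.S', ∑ y ∈ F.Y' \ F.Yc, boxForm W f x y
      ≤ F.S'.card * (((F.Y' \ F.Yc).card : ℝ) * (W.card : ℝ) ^ 4) := by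
    calc _ ≤ ∑ x ∈ F.S', ∑ y ∈ F.Y' \ F.Yc, (W.card : ℝ) ^ 4 := by
          gcongr; exact boxForm_le W f hf _ _
      _ = _ := by simp [nsmul_eq_mul]
  have h3 : ((F.Y' \ F.Yc).card : ℝ) ≤ 2 * κ * L₂.card := by
    rw [Finset.card_sdiff_of_subset hsub, Nat.cast_sub (Finset.card_le_card hsub)]
    have := F.card_Y'
    have := F.card_Yc
    linarith
  have h4 : (F.S'.card : ℝ) ≤ 2 * L.card := by
    refine F.card_S'.trans ?_
    gcongr; linarith
  have h5 : (F.S'.card : ℝ) * (((F.Y' \ F.Yc).card : ℝ) * (W.card : ℝ) ^ 4)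
      ≤ 2 * L.card * ((2 * κ * L₂.card) * (W.card : ℝ) ^ 4) := by gcongr
  calc _ ≤ (W.card : ℝ) ^ 4 * R + 2 * L.card * ((2 * κ * L₂.card) * (W.card : ℝ) ^ 4) := by
        linarith
    _ = _ := by ring

end

end

/-! ### The corner count of the balanced function in a typical strip -/

noncomputable section

section

variable {L₁ L₂ L W M₁ M₂ E₁ E₂ G₁ G₂ bad : Finset ℤ} {A : Finset (ℤ × ℤ)} {ω β₁ β₂ δ : ℝ}

/-- All quantities are at most `1`, so exponents may be lowered. One bound on `ω` thus provides
every smallness condition used below. -/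
theorem small_of_le_pow (hb : 0 < β₁) (hb' : β₁ ≤ 1) (hδ : 0 < δ) (hδ' : δ ≤ 1)
    (h : ω ≤ 2⁻¹ ^ 250 * δ ^ 12 * β₁ ^ 6) {i j : ℕ} (hi : i ≤ 12) (hj : j ≤ 6) :
    ω ≤ 2⁻¹ ^ 250 * (δ ^ i * β₁ ^ j) := by
  have h1 : δ ^ 12 ≤ δ ^ i := pow_le_pow_of_le_one hδ.le hδ' hi
  have h2 : β₁ ^ 6 ≤ β₁ ^ j := pow_le_pow_of_le_one hb.le hb' hj
  calc ω ≤ 2⁻¹ ^ 250 * (δ ^ 12 * β₁ ^ 6) := by rw [← mul_assoc]; exact h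
    _ ≤ _ := by gcongr

theorem abs_localize_balanced_le {E₁ E₂ L : Finset ℤ} {A : Finset (ℤ × ℤ)} (hA : A ⊆ E₁ ×ˢ E₂)
    (l : ℤ) (s : ℤ × ℤ) : |localize (balanced E₁ E₂ A) L l s| ≤ 1 := by
  have hc : (A.card : ℝ) / ((E₁.card : ℝ) * (E₂.card : ℝ)) ≤ 1 := by
    refine div_le_one_of_le₀ ?_ (by positivity)
    have := Finset.card_le_card hA
    rw [Finset.card_product] at this
    exact_mod_cast this
  have hc0 : 0 ≤ (A.card : ℝ) / ((E₁.card : ℝ) * (E₂.card : ℝ)) := by positivity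
  unfold localize balanced
  rw [abs_mul, abs_of_nonneg (charFn_nonneg L _)]
  refine mul_le_one₀ ?_ (charFn_nonneg _ _) (charFn_le_one _ _)
  have h1 := charFn_nonneg A (s.1 + l, s.2)
  have h2 := charFn_le_one A (s.1 + l, s.2)
  have h3 := charFn_nonneg (E₁ ×ˢ E₂) (s.1 + l, s.2)
  have h4 := charFn_le_one (E₁ ×ˢ E₂) (s.1 + l, s.2)
  rw [abs_le]
  constructor <;> nlinarith

/-- Here `p, q, s, y` stand for `|L|, |L₂|, |S|, |Y|`. Bounding the three factors separately gives
`2⁻⁸⁹ (δ³ b² p² q)⁴`. The exponent `12` of `δ` in `α` is what makes this a fourth power of a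
quantity comparable with the main term. -/
theorem corner_bound_arith {p q s y : ℝ} (hβ₁ : 0 ≤ β₁) (hβ₂ : 0 ≤ β₂) (hδ : 0 < δ) (hω : 0 ≤ ω)
    (hp : 0 ≤ p) (hq : 0 ≤ q) (hs0 : 0 ≤ s) (hs : s ≤ 2 * p) (hy0 : 0 ≤ y) (hy : y ≤ 2 * q)
    (w2 : ω ≤ 2⁻¹ ^ 250 * (δ ^ 0 * (β₁ * β₂) ^ 2))
    (w3 : ω ≤ 2⁻¹ ^ 250 * (δ ^ 12 * (β₁ * β₂) ^ 4)) :
    (s * (2 * β₁ * p * (β₂ * q))) ^ 2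
      * (s ^ 2 * y * (β₁ ^ 2 * β₂ ^ 2 + 5 * (3 * ω)))
      * (β₁ ^ 2 * β₂ ^ 2 * s * (2 * (2⁻¹ ^ 100 * δ ^ 12) * (β₁ * β₂) ^ 2 * p * q)
        + 4 * (3 * ω) * s ^ 2 * y)
      ≤ (2⁻¹ ^ 22 * δ ^ 3 * (β₁ * β₂) ^ 2 * p ^ 2 * q) ^ 4 := by
  obtain ⟨b, hb⟩ : ∃ b, b = β₁ * β₂ := ⟨_, rfl⟩
  obtain ⟨α, hα⟩ : ∃ α : ℝ, α = 2⁻¹ ^ 100 * δ ^ 12 := ⟨_, rfl⟩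
  have hb0 : 0 ≤ b := by rw [hb]; positivity
  have hα0 : 0 ≤ α := by rw [hα]; positivity
  have e2 : β₁ ^ 2 * β₂ ^ 2 = b ^ 2 := by rw [hb]; ring
  have e3 : 2 * β₁ * p * (β₂ * q) = 2 * b * p * q := by rw [hb]; ring
  rw [← hb, ← hα, e2, e3]
  rw [← hb] at w2 w3
  have k1 : s * (2 * b * p * q) ≤ 4 * b * p ^ 2 * q := by
    calc _ ≤ 2 * p * (2 * b * p * q) := by gcongr
      _ = _ := by ring
  have k2 : s ^ 2 * y * (b ^ 2 + 5 * (3 * ω)) ≤ 16 * b ^ 2 * p ^ 2 * q := by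
    have : b ^ 2 + 5 * (3 * ω) ≤ 2 * b ^ 2 := by
      have := sq_nonneg b
      norm_num at w2; linarith
    calc _ ≤ (2 * p) ^ 2 * (2 * q) * (2 * b ^ 2) := by gcongr
      _ = _ := by ring
  have k3 : b ^ 2 * s * (2 * α * b ^ 2 * p * q) + 4 * (3 * ω) * s ^ 2 * y
      ≤ 8 * α * b ^ 4 * p ^ 2 * q := by
    have h1 : 96 * ω ≤ 4 * α * b ^ 4 := by
      have : 0 ≤ δ ^ 12 * b ^ 4 := by positivity
      rw [hα]; norm_num at w3 ⊢; linarith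
    calc _ ≤ b ^ 2 * (2 * p) * (2 * α * b ^ 2 * p * q)
          + 4 * (3 * ω) * (2 * p) ^ 2 * (2 * q) := by gcongr
      _ = 4 * α * b ^ 4 * (p ^ 2 * q) + 96 * ω * (p ^ 2 * q) := by ring
      _ ≤ 4 * α * b ^ 4 * (p ^ 2 * q) + 4 * α * b ^ 4 * (p ^ 2 * q) := by gcongr
      _ = _ := by ring
  calc _ ≤ (4 * b * p ^ 2 * q) ^ 2 * (16 * b ^ 2 * p ^ 2 * q) * (8 * α * b ^ 4 * p ^ 2 * q) := by
        gcongr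
    _ = 2⁻¹ ^ 89 * (δ ^ 3 * b ^ 2 * p ^ 2 * q) ^ 4 := by rw [hα]; ring
    _ ≤ 2⁻¹ ^ 88 * (δ ^ 3 * b ^ 2 * p ^ 2 * q) ^ 4 :=
        mul_le_mul_of_nonneg_right (by norm_num) (by positivity)
    _ = _ := by ring

/-- The corner count of the balanced function in a typical strip is small. -/
theorem LocalFrame.cornerSum_pow_four_le (F : LocalFrame (ω ^ 8) L₁ L₂ L W) (hM₁T : M₁ ⊆ F.T)
    (hM₂T : M₂ ⊆ F.T) (hM₁neg : ∀ m ∈ M₁, -m ∈ M₁) (hM₁ : 0 < M₁.card)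
    (hM₂neg : ∀ m ∈ M₂, -m ∈ M₂) (hM₂ : 0 < M₂.card)
    (hω : 0 < ω) (hωb : ω ≤ 2⁻¹ ^ 250 * δ ^ 12 * (β₁ * β₂) ^ 6) (hδ : 0 < δ)
    (hβ₁ : 0 < β₁) (hβ₁' : β₁ ≤ 1) (hβ₂ : 0 < β₂) (hβ₂' : β₂ ≤ 1) (hδ' : δ ≤ 1)
    (hE₂ : E₂ ⊆ L₂) (hA : A ⊆ E₁ ×ˢ E₂) (hE₂c : (E₂.card : ℝ) = β₂ * L₂.card)
    (hG₁ : IsGoodSet (ω ^ 8) β₁ L₁ M₁ E₁ G₁) (hG₂ : IsGoodSet (ω ^ 8) β₂ L₂ M₂ E₂ G₂) (l : ℤ)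
    (hl : (((F.S'.filter fun s => l + s ∉ G₁).card : ℕ) : ℝ) ≤ ω ^ 4 * F.S.card)
    (hrect : rectNorm4 L L₂ W (localize (balanced E₁ E₂ A) L l)
      ≤ 2⁻¹ ^ 100 * δ ^ 12 * β₁ ^ 2 * β₂ ^ 2 * (W.card : ℝ) ^ 4 * (L.card : ℝ) ^ 2 * L₂.card) :
    cornerSum L L₂ (fun x y => localize (balanced E₁ E₂ A) L l (x, y))
      (fun x y => charFn A (x + l, y) * charFn L x) ^ 4
      ≤ (2⁻¹ ^ 22 * δ ^ 3 * (β₁ * β₂) ^ 2 * (L.card : ℝ) ^ 2 * L₂.card) ^ 4 := by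
  classical
  have hb : 0 < β₁ * β₂ := by positivity
  have hb' : β₁ * β₂ ≤ 1 := mul_le_one₀ hβ₁' hβ₂.le hβ₂'
  have w20 : ω ≤ 2⁻¹ ^ 20 := by
    have := small_of_le_pow hb hb' hδ hδ' hωb (i := 0) (j := 0) (by norm_num) (by norm_num)
    norm_num at this ⊢; linarith
  have w1 : ω ≤ 1 := w20.trans (by norm_num)
  have w2 := small_of_le_pow hb hb' hδ hδ' hωb (i := 0) (j := 2) (by norm_num) (by norm_num)
  have w3 := small_of_le_pow hb hb' hδ hδ' hωb (i := 12) (j := 4) (by norm_num) (by norm_num)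
  have w4 := small_of_le_pow hb hb' hδ hδ' hωb (i := 12) (j := 2) (by norm_num) (by norm_num)
  have w5 := small_of_le_pow hb hb' hδ hδ' hωb (i := 0) (j := 1) (by norm_num) (by norm_num)
  have p8 := pow_le_self_of_small hω w20 (n := 8) (by norm_num)
  set b := β₁ * β₂ with hbdef
  set p : ℝ := (L.card : ℝ) with hp
  set q : ℝ := (L₂.card : ℝ) with hq
  have hp0 : 0 ≤ p := Nat.cast_nonneg _
  have hq0 : 0 ≤ q := Nat.cast_nonneg _
  have w8 : ω ^ 8 ≤ 2⁻¹ := by norm_num at p8 w20 ⊢; linarith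
  have hS : (F.S.card : ℝ) ≤ 2 * p := F.card_S_le.trans (by gcongr; linarith)
  have hY : (F.Y.card : ℝ) ≤ 2 * q := F.card_Y_le.trans (by gcongr; linarith)
  have hLS := F.card_L_le
  have hLY := F.card_L₂_le
  have hWne : 0 < W.card := Finset.card_pos.2 ⟨0, F.zero_mem⟩
  have hfle : ∀ x y, |localize (balanced E₁ E₂ A) L l (x, y)| ≤ 1 := fun x y =>
    abs_localize_balanced_le hA l (x, y)
  set α : ℝ := 2⁻¹ ^ 100 * δ ^ 12 with hα
  have hα0 : 0 < α := by positivity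
  -- The factor `2` leaves room for the boundary of `Y'`, whose share `4 ω⁸` is at most `α b²`.
  have hbox : ∑ x ∈ F.S', ∑ y ∈ F.Y',
      boxForm W (fun x y => localize (balanced E₁ E₂ A) L l (x, y)) x y
        ≤ (W.card : ℝ) ^ 4 * (2 * α * b ^ 2 * p * q) := by
    have h1 := F.sum_boxForm_core_le (balanced E₁ E₂ A) l
      ((W.card : ℝ) ^ 4 * (α * b ^ 2 * p * q)) (hrect.trans_eq (by rw [hbdef]; ring))
    refine (F.sum_boxForm_le (by linarith) _ hfle _ h1).trans ?_
    have h2 : 4 * ω ^ 8 ≤ α * b ^ 2 := by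
      have : 2⁻¹ ^ 250 * (δ ^ 12 * b ^ 2) ≤ α * b ^ 2 := by
        rw [hα, ← mul_assoc]; gcongr ?_ * _ * _; norm_num
      norm_num at p8; linarith
    have h3 : 4 * ω ^ 8 * (p * q) ≤ α * b ^ 2 * (p * q) := by gcongr
    gcongr
    linarith
  have hdens := F.abs_sum_charFn_sub_le hM₁T hM₁neg hM₁ hω w20 hβ₁.le hβ₁' hG₁ l hl
  have hbβ : b ≤ β₁ := mul_le_of_le_one_right hβ₁.le hβ₂'
  have hK₁ : ∑ x ∈ L, charFn E₁ (x + l) ≤ 2 * β₁ * p := by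
    have h5 : 7 * ω * p ≤ β₁ * p := by gcongr; norm_num at w5; linarith
    have := (abs_le.1 hdens).2
    linarith
  have key := cornerSum_pow_four_le_of_good W M₁ M₂ hWne hM₁ hM₂ F.W_neg hM₁neg hM₂neg L L₂
    F.S F.S' F.Y F.Y' F.T F.W_sub hM₁T hM₂T F.add_three_mem_S F.add_two_mem_S' F.add_mem_S'
    F.add_three_mem_Y F.add_two_mem_Y' F.add_sub_mem_Y'
    (F.card_S'.trans (by nlinarith))
    (fun x y => localize (balanced E₁ E₂ A) L l (x, y))
    (fun x y => charFn A (x + l, y) * charFn L x) E₁ E₂ l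
    (fun x y h => by
      refine ⟨mem_of_charFn_ne_zero (right_ne_zero_of_mul h), ?_⟩
      by_contra hy
      apply left_ne_zero_of_mul h
      have hy2 : y ∉ E₂ := fun h => hy (hE₂ h)
      have h1 : (x + l, y) ∉ E₁ ×ˢ E₂ := fun h => hy2 (Finset.mem_product.1 h).2
      simp [balanced, charFn_of_notMem h1, charFn_of_notMem fun h => h1 (hA h)])
    hfle
    (fun x y h => ⟨mem_of_charFn_ne_zero (right_ne_zero_of_mul h),
      hE₂ (Finset.mem_product.1 (hA (mem_of_charFn_ne_zero (left_ne_zero_of_mul h)))).2⟩)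
    hE₂
    (fun x y => by
      rw [abs_of_nonneg (mul_nonneg (charFn_nonneg _ _) (charFn_nonneg _ _))]
      by_cases h : (x + l, y) ∈ A
      · have := Finset.mem_product.1 (hA h)
        rw [charFn_of_mem h, charFn_of_mem this.1, charFn_of_mem this.2]
        simpa using charFn_le_one L x
      · rw [charFn_of_notMem h, zero_mul]
        exact mul_nonneg (charFn_nonneg _ _) (charFn_nonneg _ _))
    β₁ β₂ ω (2 * α * b ^ 2 * p * q) (2 * β₁ * p) (β₂ * q) hβ₁.le hβ₁' hβ₂.le hβ₂' hω
    (by norm_num at w20; linarith) hK₁ (by rw [sum_charFn_eq_card hE₂, hE₂c])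
    G₁ G₂ hG₁.fourier_le hG₂.fourier_le hl (hG₂.sub.trans (F.L₂_sub.trans F.Y_sub))
    (by
      have h1 := F.card_Y'
      have h2 := hG₂.card_ge
      have h3 : ω ^ 8 * q ≤ ω ^ 8 * F.Y.card := by gcongr
      linarith) hbox
  exact key.trans (corner_bound_arith hβ₁.le hβ₂.le hδ hω.le hp0 hq0 (Nat.cast_nonneg _) hS
    (Nat.cast_nonneg _) hY w2 w3)

end

end

/-! ### The consequence of having trivial corners only -/

noncomputable section

section

variable {L₁ L₂ L W M₁ M₂ E₁ E₂ G₁ G₂ bad : Finset ℤ} {A : Finset (ℤ × ℤ)} {ω β₁ β₂ δ : ℝ}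

theorem balanced_eq (hδ : (A.card : ℝ) = δ * E₁.card * E₂.card) (h₁ : 0 < E₁.card)
    (h₂ : 0 < E₂.card) (s : ℤ × ℤ) :
    balanced E₁ E₂ A s = charFn A s - δ * charFn (E₁ ×ˢ E₂) s := by
  have h₁' : (0 : ℝ) < E₁.card := by exact_mod_cast h₁
  have h₂' : (0 : ℝ) < E₂.card := by exact_mod_cast h₂
  unfold balanced
  rw [hδ, mul_assoc, mul_div_cancel_right₀ _ (by positivity)]

/-- If the corner count of the balanced function is small and the strip contains trivial corners
only, then the strip is thin. -/
theorem LocalFrame.card_le_of_forall_eq (F : LocalFrame (ω ^ 8) L₁ L₂ L W) (hω : 0 ≤ ω)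
    (hω' : ω ≤ 1)
    {b : ℝ} (hb : 0 < b) (hδ : 0 < δ) (hL₂ : 0 < L₂.card) (hE₂ : E₂ ⊆ L₂) (hA : A ⊆ E₁ ×ˢ E₂)
    (hAc : (A.card : ℝ) = δ * E₁.card * E₂.card) (hE₁c : 0 < E₁.card) (hE₂c : 0 < E₂.card) (l : ℤ)
    (hstrip : δ * b / 2 * L.card * L₂.card ≤ stripCount L L₂ A l)
    (hC : cornerSum L L₂ (fun x y => localize (balanced E₁ E₂ A) L l (x, y))
      (fun x y => charFn A (x + l, y) * charFn L x) ^ 4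
      ≤ (2⁻¹ ^ 22 * δ ^ 3 * b ^ 2 * (L.card : ℝ) ^ 2 * L₂.card) ^ 4)
    (hno : ∀ k m t : ℤ, (k, m) ∈ A → (k + t, m) ∈ A → (k, m + t) ∈ A → t = 0) :
    δ ^ 2 * b * L.card ≤ 8 := by
  set a : ℤ → ℤ → ℝ := fun x y => charFn A (x + l, y) * charFn L x with ha
  set f : ℤ → ℤ → ℝ := fun x y => localize (balanced E₁ E₂ A) L l (x, y) with hf
  have ha0 : ∀ x y, a x y ≠ 0 → (x + l, y) ∈ A ∧ x ∈ L := fun x y h =>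
    ⟨mem_of_charFn_ne_zero (left_ne_zero_of_mul h), mem_of_charFn_ne_zero (right_ne_zero_of_mul h)⟩
  have hsum : ∑ x ∈ L, ∑ y ∈ L₂, a x y = stripCount L L₂ A l := by
    unfold stripCount
    refine Finset.sum_congr rfl fun x hx => Finset.sum_congr rfl fun y _ => ?_
    rw [ha]; simp only; rw [charFn_of_mem hx, mul_one]
  have hdiag : cornerSum L L₂ a a = stripCount L L₂ A l := by
    rw [← hsum]
    refine cornerSum_self_of_forall_eq L L₂ a (fun x y => ?_) fun x y s h1 h2 h3 => ?_
    · by_cases h : a x y = 0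
      · exact Or.inl h
      · have := ha0 x y h
        right; rw [ha]; simp only; rw [charFn_of_mem this.1, charFn_of_mem this.2, mul_one]
    · have := hno (x + l) y (s - x) (ha0 _ _ h1).1
        (by have := (ha0 _ _ h2).1; rwa [show x + l + (s - x) = s + l by ring])
        (by have := (ha0 _ _ h3).1; rwa [← add_sub_assoc])
      omega
  have hmain := cornerSum_self_ge L L₂ F.Y f a
    (fun x y => charFn (E₁ ×ˢ E₂) (x + l, y) * charFn L x) δ hδ.le
    (fun x y h => ⟨(ha0 x y h).2, hE₂ (Finset.mem_product.1 (hA (ha0 x y h).1)).2⟩)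
    F.add_mem_Y
    (fun x y => by
      rw [hf, ha]
      simp only [localize]
      rw [balanced_eq hAc hE₁c hE₂c]
      ring)
    -- Because `E₁ × E₂` is a product, the vertex inherits its first coordinate from one of the two
    -- other points and its second from the other one.
    (fun x y y' s h1 h2 => by
      have e1 := Finset.mem_product.1 (hA (ha0 _ _ h1).1)
      have e2 := Finset.mem_product.1 (hA (ha0 _ _ h2).1)
      have e3 : (x + l, y) ∈ E₁ ×ˢ E₂ := Finset.mem_product.2 ⟨e2.1, e1.2⟩
      rw [charFn_of_mem e3, charFn_of_mem (ha0 _ _ h2).2, mul_one])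
  rw [hsum, hdiag] at hmain
  have hY : (F.Y.card : ℝ) ≤ 2 * L₂.card :=
    F.card_Y_le.trans (by have := pow_le_one₀ hω hω' (n := 8); gcongr; linarith)
  have hp : (0 : ℝ) < L.card := by
    exact_mod_cast Finset.card_pos.2 ⟨0, F.T_sub (F.W_sub F.zero_mem)⟩
  have hq : (0 : ℝ) < L₂.card := by exact_mod_cast hL₂
  have hy0 : (0 : ℝ) ≤ F.Y.card := Nat.cast_nonneg _
  have hCabs : |cornerSum L L₂ f a| ≤ 2⁻¹ ^ 22 * δ ^ 3 * b ^ 2 * (L.card : ℝ) ^ 2 * L₂.card :=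
    (pow_le_pow_iff_left₀ (abs_nonneg _) (by positivity) four_ne_zero).1
      (by rwa [Even.pow_abs (by decide)])
  generalize (L.card : ℝ) = p at *
  generalize (L₂.card : ℝ) = q at *
  generalize (F.Y.card : ℝ) = y at *
  generalize cornerSum L L₂ f a = C at *
  generalize stripCount L L₂ A l = D at *
  have hD : 0 < D := lt_of_lt_of_le (by positivity) hstrip
  have h1 : (δ * b / 2 * p * q) ^ 2 ≤ D ^ 2 := by gcongr
  -- The error term is at most half of the main term `δ D²`, by the lower bound for `D`.
  have h2 : y * |C| ≤ 2⁻¹ * (δ * D ^ 2) := by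
    calc y * |C| ≤ 2 * q * (2⁻¹ ^ 22 * δ ^ 3 * b ^ 2 * p ^ 2 * q) := by gcongr
      _ = 2⁻¹ ^ 19 * (δ * (δ * b / 2 * p * q) ^ 2) := by ring
      _ ≤ 2⁻¹ ^ 19 * (δ * D ^ 2) := by gcongr
      _ ≤ _ := by gcongr; norm_num
  have h3 : -(y * |C|) ≤ y * C := by
    have := neg_abs_le C
    nlinarith
  have h4 : y * D ≤ 2 * q * D := by gcongr
  -- From `δ D² + y C ≤ y D` there remains `δ D² / 2 ≤ 2 q D`. Dividing by `D` and inserting the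
  -- lower bound for `D` bounds `p`.
  have h5 : D * (δ * D) ≤ D * (4 * q) := by nlinarith
  have h6 := le_of_mul_le_mul_left h5 hD
  have h7 : δ * (δ * b / 2 * p * q) ≤ δ * D := by gcongr
  have h8 : δ ^ 2 * b * p * q ≤ 8 * q := by linarith
  exact le_of_mul_le_mul_right h8 hq
end

end

/-! ### The dichotomy: a corner, or a set of density near one -/

noncomputable section

section

variable {L₁ L₂ L W M₁ M₂ E₁ E₂ G₁ G₂ bad : Finset ℤ} {A : Finset (ℤ × ℤ)} {ω β₁ β₂ δ : ℝ}

/-- A uniform set has density close to `1` if its windows are short. -/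
theorem IsGoodSet.one_sub_le {X M E G : Finset ℤ} {β p : ℝ} (hG : IsGoodSet (ω ^ 8) β X M E G)
    (hX : 0 < X.card) (hM : 0 < M.card) (hMp : (M.card : ℝ) ≤ p) (hω : 0 < ω) (hω' : ω ≤ 2⁻¹ ^ 20)
    (hωp : ω * p ≤ 1) (hωβ : ω < β) (hβ : β ≤ 1) : 1 - β ≤ 2⁻¹ ^ 20 := by
  have hw1 : ω ≤ 1 := hω'.trans (by norm_num)
  have hX' : (0 : ℝ) < X.card := by exact_mod_cast hX
  have hGne : 0 < G.card := by
    have h1 := hG.card_ge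
    have h2 : ω ^ 8 ≤ 2⁻¹ ^ 20 * ω := pow_le_self_of_small hω hω' (by norm_num)
    have h3 : (0 : ℝ) < G.card := lt_of_lt_of_le (mul_pos (by norm_num at h2; linarith) hX') h1
    exact_mod_cast h3
  obtain ⟨c, hc⟩ := Finset.card_pos.1 hGne
  have hsmall : (ω ^ 8) ^ 2 * p ≤ ω ^ 2 := by
    calc (ω ^ 8) ^ 2 * p = ω ^ 15 * (ω * p) := by ring
      _ ≤ ω ^ 15 * 1 := by gcongr
      _ ≤ ω ^ 2 := by
        rw [mul_one]; exact pow_le_pow_of_le_one hω.le hw1 (by norm_num)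
  -- The first alternative would give `β ≤ ω`, contrary to `ω < β`; the second gives `1 - β ≤ ω`.
  rcases density_extreme_of_card_le E M β (ω ^ 8) p c hM hMp (hG.fourier_le c hc) with h | h
  · nlinarith
  · have : (1 - β) ≤ ω := (pow_le_pow_iff_left₀ (by linarith) hω.le two_ne_zero).1 (h.trans hsmall)
    linarith

/-- On `E₁ × E₂` the balanced function takes only the values `1 - δ` and `-δ`. -/
theorem min_pow_four_le_balanced (hAc : (A.card : ℝ) = δ * E₁.card * E₂.card)
    (h₁ : 0 < E₁.card) (h₂ : 0 < E₂.card) (hδ : 0 ≤ δ) (hδ' : δ ≤ 1) (s : ℤ × ℤ)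
    (hs : s ∈ E₁ ×ˢ E₂) : min δ (1 - δ) ^ 4 ≤ balanced E₁ E₂ A s ^ 4 := by
  have h0 : 0 ≤ min δ (1 - δ) := le_min hδ (by linarith)
  rw [balanced_eq hAc h₁ h₂, charFn_of_mem hs]
  by_cases h : s ∈ A
  · rw [charFn_of_mem h, mul_one]
    gcongr; exact min_le_right _ _
  · rw [charFn_of_notMem h, mul_one, zero_sub, Even.neg_pow (by decide)]
    gcongr; exact min_le_left _ _

/-- If `L` is short, `E₁` and `E₂` are nearly everything, and the local rectilinear norm of the
balanced function is small, then `A` is nearly everything. -/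
theorem LocalFrame.one_sub_density_le (F : LocalFrame (ω ^ 8) L₁ L₂ L W) (hω : 0 < ω)
    (hω' : ω ≤ 2⁻¹ ^ 20) (hβ₁ : β₁ ≤ 1) (hβ₂ : β₂ ≤ 1)
    (hβ₁' : 1 - β₁ ≤ 2⁻¹ ^ 20) (hβ₂' : 1 - β₂ ≤ 2⁻¹ ^ 20) (hδ : 0 < δ) (hδ' : δ ≤ 1)
    (hL₂ : 0 < L₂.card) (hE₂ : E₂ ⊆ L₂)
    (hAc : (A.card : ℝ) = δ * E₁.card * E₂.card) (hE₁c : 0 < E₁.card)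
    (hE₂c : (E₂.card : ℝ) = β₂ * L₂.card) (l : ℤ)
    (hdens : |∑ x ∈ L, charFn E₁ (x + l) - β₁ * L.card| ≤ 7 * ω * L.card)
    (hrect : rectNorm4 L L₂ W (localize (balanced E₁ E₂ A) L l)
      ≤ 2⁻¹ ^ 100 * δ ^ 12 * β₁ ^ 2 * β₂ ^ 2 * (W.card : ℝ) ^ 4 * (L.card : ℝ) ^ 2 * L₂.card)
    (hp : δ ^ 2 * (β₁ * β₂) * L.card ≤ 8) : 1 - δ ≤ 2⁻¹ ^ 20 := by
  classical
  have hp0 : (0 : ℝ) < L.card := by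
    exact_mod_cast Finset.card_pos.2 ⟨0, F.T_sub (F.W_sub F.zero_mem)⟩
  have hq0 : (0 : ℝ) < L₂.card := by exact_mod_cast hL₂
  have p8 := pow_le_self_of_small hω hω' (n := 8) (by norm_num)
  have hE₂pos : 0 < E₂.card := by
    have : (0 : ℝ) < E₂.card := by
      rw [hE₂c]; exact mul_pos (by norm_num at hβ₂'; linarith) hq0
    exact_mod_cast this
  have hcore := F.sum_boxForm_core_le (balanced E₁ E₂ A) l
      ((W.card : ℝ) ^ 4 * (2⁻¹ ^ 100 * δ ^ 12 * β₁ ^ 2 * β₂ ^ 2 * L.card * L₂.card))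
      (hrect.trans_eq (by ring))
  have hμ0 : 0 ≤ min δ (1 - δ) := le_min hδ.le (by linarith)
  -- Each box form is bounded below by the fourth power of the function at its base point, and only
  -- base points in `E₁ × E₂` (after the shift by `l`) are kept.
  have hlow : min δ (1 - δ) ^ 4 * ((∑ x ∈ L, charFn E₁ (x + l)) * ∑ y ∈ F.Yc, charFn E₂ y)
      ≤ ∑ x ∈ F.S', ∑ y ∈ F.Yc,
        boxForm W (fun x y => localize (balanced E₁ E₂ A) L l (x, y)) x y := by
    calc min δ (1 - δ) ^ 4 * ((∑ x ∈ L, charFn E₁ (x + l)) * ∑ y ∈ F.Yc, charFn E₂ y)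
        = ∑ x ∈ L, ∑ y ∈ F.Yc, min δ (1 - δ) ^ 4 * (charFn E₁ (x + l) * charFn E₂ y) := by
          rw [Finset.sum_mul_sum, Finset.mul_sum]
          exact Finset.sum_congr rfl fun _ _ => Finset.mul_sum _ _ _
      _ ≤ ∑ x ∈ L, ∑ y ∈ F.Yc,
          boxForm W (fun x y => localize (balanced E₁ E₂ A) L l (x, y)) x y := by
          refine Finset.sum_le_sum fun x hx => Finset.sum_le_sum fun y _ => ?_
          refine le_trans ?_ (pow_four_le_boxForm W F.zero_mem _ x y)
          have hz : (0 : ℝ) ≤ localize (balanced E₁ E₂ A) L l (x, y) ^ 4 := by positivity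
          by_cases h1 : x + l ∈ E₁
          · by_cases h2 : y ∈ E₂
            · rw [charFn_of_mem h1, charFn_of_mem h2, mul_one, mul_one]
              simp only [localize, charFn_of_mem hx, mul_one]
              exact min_pow_four_le_balanced hAc hE₁c hE₂pos hδ.le hδ' _
                (Finset.mem_product.2 ⟨h1, h2⟩)
            · rwa [charFn_of_notMem h2, mul_zero, mul_zero]
          · rwa [charFn_of_notMem h1, zero_mul, mul_zero]
      _ ≤ _ := Finset.sum_le_sum_of_subset_of_nonneg (F.L_sub.trans F.S_sub)
          fun _ _ _ => Finset.sum_nonneg fun _ _ => boxForm_nonneg _ _ _ _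
  have hx : 2⁻¹ * (L.card : ℝ) ≤ ∑ x ∈ L, charFn E₁ (x + l) := by
    have h1 := (abs_le.1 hdens).1
    have h2 : 7 * ω * (L.card : ℝ) ≤ 2⁻¹ ^ 10 * L.card := by
      gcongr; norm_num at hω' ⊢; linarith
    have h3 : (1 - 2⁻¹ ^ 20) * (L.card : ℝ) ≤ β₁ * L.card := by gcongr; linarith
    norm_num at h2 h3
    linarith
  have hy : 2⁻¹ * (L₂.card : ℝ) ≤ ∑ y ∈ F.Yc, charFn E₂ y := by
    have h1 : ∑ y ∈ L₂ \ F.Yc, charFn E₂ y + ∑ y ∈ F.Yc, charFn E₂ y = β₂ * L₂.card := by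
      rw [Finset.sum_sdiff F.Yc_sub, sum_charFn_eq_card hE₂, hE₂c]
    have h2 : ∑ y ∈ L₂ \ F.Yc, charFn E₂ y ≤ L₂.card - F.Yc.card := by
      calc _ ≤ ∑ y ∈ L₂ \ F.Yc, (1 : ℝ) := Finset.sum_le_sum fun _ _ => charFn_le_one _ _
        _ = _ := by
          rw [Finset.sum_const, nsmul_eq_mul, mul_one, Finset.card_sdiff_of_subset F.Yc_sub,
            Nat.cast_sub (Finset.card_le_card F.Yc_sub)]
    have h3 := F.card_Yc
    have h4 : ω ^ 8 * (L₂.card : ℝ) ≤ 2⁻¹ ^ 10 * L₂.card := by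
      gcongr; norm_num at p8 hω' ⊢; linarith
    have h5 : (1 - 2⁻¹ ^ 20) * (L₂.card : ℝ) ≤ β₂ * L₂.card := by gcongr; linarith
    norm_num at h4 h5
    linarith
  have hWL : (W.card : ℝ) ≤ L.card := by
    exact_mod_cast Finset.card_le_card (F.W_sub.trans F.T_sub)
  have hall := hlow.trans hcore
  have hβ₁0 : 0 ≤ β₁ := by norm_num at hβ₁'; linarith
  have hβ₂0 : 0 ≤ β₂ := by norm_num at hβ₂'; linarith
  have hp16 : δ ^ 2 * (L.card : ℝ) ≤ 16 := by
    have h1 : (2⁻¹ : ℝ) ≤ β₁ * β₂ := by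
      norm_num at hβ₁' hβ₂'; nlinarith
    have h2 : δ ^ 2 * 2⁻¹ * (L.card : ℝ) ≤ δ ^ 2 * (β₁ * β₂) * L.card := by gcongr
    linarith
  generalize (∑ x ∈ L, charFn E₁ (x + l)) = X at *
  generalize (∑ y ∈ F.Yc, charFn E₂ y) = Z at *
  generalize (L.card : ℝ) = p at *
  generalize (L₂.card : ℝ) = q at *
  generalize hμ : min δ (1 - δ) = μ at *
  have e1 : μ ^ 4 * ((2⁻¹ * p) * (2⁻¹ * q)) ≤ μ ^ 4 * (X * Z) := by
    have hX0 : 0 ≤ X := le_trans (by positivity) hx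
    gcongr
  have e2 : (W.card : ℝ) ^ 4 * (2⁻¹ ^ 100 * δ ^ 12 * β₁ ^ 2 * β₂ ^ 2 * p * q)
      ≤ p ^ 4 * (2⁻¹ ^ 100 * δ ^ 12 * 1 * 1 * p * q) := by
    have hc : (0 : ℝ) ≤ 2⁻¹ ^ 100 * δ ^ 12 := by positivity
    have h1 : β₁ ^ 2 ≤ 1 := pow_le_one₀ hβ₁0 hβ₁
    have h2 : β₂ ^ 2 ≤ 1 := pow_le_one₀ hβ₂0 hβ₂
    generalize (2⁻¹ ^ 100 * δ ^ 12 : ℝ) = c at hc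
    gcongr
  -- Eight of the twelve factors `δ` pay for `p⁴`, through `δ² p ≤ 16`; the remaining `δ⁴` is needed
  -- to exclude that `δ` itself is the minimum.
  have e3 : p ^ 4 * (2⁻¹ ^ 100 * δ ^ 12 * 1 * 1 * p * q)
      ≤ 2⁻¹ ^ 100 * δ ^ 4 * 16 ^ 4 * (p * q) := by
    calc _ = 2⁻¹ ^ 100 * δ ^ 4 * (δ ^ 2 * p) ^ 4 * (p * q) := by ring
      _ ≤ _ := by gcongr
  have e4 : μ ^ 4 * (p * q) ≤ (2⁻¹ ^ 20 * δ) ^ 4 * (p * q) := by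
    have h1 : (2⁻¹ ^ 20 * δ) ^ 4 = 2⁻¹ ^ 80 * δ ^ 4 := by ring
    have h2 : 2⁻¹ ^ 100 * δ ^ 4 * 16 ^ 4 * (p * q) = 2⁻¹ ^ 84 * (δ ^ 4 * (p * q)) := by ring
    have h3 : 0 < δ ^ 4 * (p * q) := by positivity
    rw [h1, mul_assoc (2⁻¹ ^ 80)]
    rw [h2] at e3
    have e5 := (e1.trans hall).trans (e2.trans e3)
    norm_num at e5 ⊢
    linarith
  have e6 : μ ≤ 2⁻¹ ^ 20 * δ :=
    (pow_le_pow_iff_left₀ hμ0 (by positivity) four_ne_zero).1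
      (le_of_mul_le_mul_right e4 (by positivity))
  -- The minimum cannot be `δ`, as `δ ≤ 2⁻²⁰ δ` is impossible for `δ > 0`.
  rcases min_choice δ (1 - δ) with h | h
  · rw [hμ] at h; rw [h] at e6; norm_num at e6; linarith
  · rw [hμ] at h; rw [h] at e6; norm_num at e6 ⊢; linarith

/-- A rectilinearly uniform set contains a corner or is nearly everything. -/
theorem LocalFrame.exists_corner_or_dense (F : LocalFrame (ω ^ 8) L₁ L₂ L W) (hM₁T : M₁ ⊆ F.T)
    (hM₂T : M₂ ⊆ F.T) (hM₁neg : ∀ m ∈ M₁, -m ∈ M₁) (hM₁ : 0 < M₁.card)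
    (hM₂neg : ∀ m ∈ M₂, -m ∈ M₂) (hM₂ : 0 < M₂.card)
    (hω : 0 < ω) (hωb : ω ≤ 2⁻¹ ^ 250 * δ ^ 12 * (β₁ * β₂) ^ 6) (hδ : 0 < δ)
    (hβ₁ : 0 < β₁) (hβ₁' : β₁ ≤ 1) (hβ₂ : 0 < β₂) (hβ₂' : β₂ ≤ 1) (hδ' : δ ≤ 1)
    (hL₁ : 0 < L₁.card) (hL₂ : 0 < L₂.card)
    (hE₁ : E₁ ⊆ L₁) (hE₂ : E₂ ⊆ L₂) (hA : A ⊆ E₁ ×ˢ E₂)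
    (hE₁c : (E₁.card : ℝ) = β₁ * L₁.card) (hE₂c : (E₂.card : ℝ) = β₂ * L₂.card)
    (hAc : (A.card : ℝ) = δ * E₁.card * E₂.card)
    (hG₁ : IsGoodSet (ω ^ 8) β₁ L₁ M₁ E₁ G₁) (hG₂ : IsGoodSet (ω ^ 8) β₂ L₂ M₂ E₂ G₂)
    (hbad : (bad.card : ℝ) ≤ 2 ^ (-7 : ℤ) * δ * L₁.card)
    (hrect : ∀ l ∈ L₁, l ∉ bad → rectNorm4 L L₂ W (localize (balanced E₁ E₂ A) L l)
      ≤ 2⁻¹ ^ 100 * δ ^ 12 * β₁ ^ 2 * β₂ ^ 2 * (W.card : ℝ) ^ 4 * (L.card : ℝ) ^ 2 * L₂.card) :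
    (∃ k m t : ℤ, t ≠ 0 ∧ (k, m) ∈ A ∧ (k + t, m) ∈ A ∧ (k, m + t) ∈ A) ∨
      7 / 8 * ((L₁.card : ℝ) * L₂.card) ≤ A.card := by
  by_cases hex : ∃ k m t : ℤ, t ≠ 0 ∧ (k, m) ∈ A ∧ (k + t, m) ∈ A ∧ (k, m + t) ∈ A
  · exact Or.inl hex
  right
  have hno : ∀ k m t : ℤ, (k, m) ∈ A → (k + t, m) ∈ A → (k, m + t) ∈ A → t = 0 :=
    fun k m t h1 h2 h3 => by_contra fun h => hex ⟨k, m, t, h, h1, h2, h3⟩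
  have hb : 0 < β₁ * β₂ := by positivity
  have hb' : β₁ * β₂ ≤ 1 := mul_le_one₀ hβ₁' hβ₂.le hβ₂'
  have hp1 : (0 : ℝ) < L₁.card := by exact_mod_cast hL₁
  have hq0 : (0 : ℝ) < L₂.card := by exact_mod_cast hL₂
  have hLne : 0 < L.card := Finset.card_pos.2 ⟨0, F.T_sub (F.W_sub F.zero_mem)⟩
  have w20 : ω ≤ 2⁻¹ ^ 20 := by
    have := small_of_le_pow hb hb' hδ hδ' hωb (i := 0) (j := 0) (by norm_num) (by norm_num)
    norm_num at this ⊢; linarith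
  have w1 := small_of_le_pow hb hb' hδ hδ' hωb (i := 1) (j := 1) (by norm_num) (by norm_num)
  have w2 := small_of_le_pow hb hb' hδ hδ' hωb (i := 2) (j := 1) (by norm_num) (by norm_num)
  have w3 := small_of_le_pow hb hb' hδ hδ' hωb (i := 0) (j := 1) (by norm_num) (by norm_num)
  have hE₁pos : 0 < E₁.card := by
    have : (0 : ℝ) < E₁.card := by rw [hE₁c]; positivity
    exact_mod_cast this
  have hE₂pos : 0 < E₂.card := by
    have : (0 : ℝ) < E₂.card := by rw [hE₂c]; positivity
    exact_mod_cast this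
  have hωb' : ω ≤ 2⁻¹ ^ 20 * (δ * (β₁ * β₂)) := by
    have : 0 < δ * (β₁ * β₂) := by positivity
    norm_num at w1 ⊢; linarith
  obtain ⟨l, hl, hl1, hl2, hl3⟩ := F.exists_good_strip hM₁T hM₁neg hM₁ hω w20 hωb' hδ hβ₁ hβ₁'
    hβ₂ hβ₂' hδ' hL₁ hL₂ hE₁ hE₂ hA hE₁c hE₂c hAc hG₁ hbad
  have hC := F.cornerSum_pow_four_le hM₁T hM₂T hM₁neg hM₁ hM₂neg hM₂ hω hωb hδ hβ₁ hβ₁' hβ₂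
    hβ₂' hδ' hE₂ hA hE₂c hG₁ hG₂ l hl2 (hrect l hl hl1)
  -- From here on `L` is known to be short, and with it `M₁`, `M₂` and `W`.
  have hp8 := F.card_le_of_forall_eq hω.le (w20.trans (by norm_num)) hb hδ hL₂ hE₂ hA hAc hE₁pos
    hE₂pos l hl3 hC hno
  have hωp : ω * (L.card : ℝ) ≤ 1 := by
    calc ω * (L.card : ℝ) ≤ 2⁻¹ ^ 250 * (δ ^ 2 * (β₁ * β₂) ^ 1) * L.card := by gcongr
      _ = 2⁻¹ ^ 250 * (δ ^ 2 * (β₁ * β₂) * L.card) := by ring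
      _ ≤ 2⁻¹ ^ 250 * 8 := by gcongr
      _ ≤ 1 := by norm_num
  have hlt : ω < β₁ * β₂ := by norm_num at w3; linarith
  have h₁ := hG₁.one_sub_le hL₁ hM₁
    (by exact_mod_cast Finset.card_le_card (hM₁T.trans F.T_sub)) hω w20 hωp
    (hlt.trans_le (mul_le_of_le_one_right hβ₁.le hβ₂')) hβ₁'
  have h₂ := hG₂.one_sub_le hL₂ hM₂
    (by exact_mod_cast Finset.card_le_card (hM₂T.trans F.T_sub)) hω w20 hωp
    (hlt.trans_le (mul_le_of_le_one_left hβ₂.le hβ₁')) hβ₂'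
  have h₃ := F.one_sub_density_le hω w20 hβ₁' hβ₂' h₁ h₂ hδ hδ' hL₂ hE₂ hAc hE₁pos hE₂c l
    (F.abs_sum_charFn_sub_le hM₁T hM₁neg hM₁ hω w20 hβ₁.le hβ₁' hG₁ l hl2) (hrect l hl hl1) hp8
  have h4 : (7 / 8 : ℝ) ≤ δ * (β₁ * β₂) := by
    norm_num at h₁ h₂ h₃
    have : (15 / 16 : ℝ) ≤ β₁ * β₂ := by nlinarith
    nlinarith
  calc 7 / 8 * ((L₁.card : ℝ) * L₂.card) ≤ δ * (β₁ * β₂) * ((L₁.card : ℝ) * L₂.card) := by gcongr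
    _ = _ := by rw [hAc, hE₁c, hE₂c]; ring

end

end

/-! ### Local frames from attendants, and a small nonzero shift -/

noncomputable section

/-- Nested attendants of a pair of regular Bohr sets provide a local frame. -/
theorem exists_localFrame {d d₁ d₂ : ℕ} (hd : 0 < d) {κ ε : ℝ} (hκ : 0 < κ) (hκ' : κ < 1)
    (hε : 12 * ε < κ / (100 * d)) {Λ₁ Λ₂ Λ' Λ'' : BohrSet d} (hΛ₁ : Λ₁.IsRegular)
    (hΛ₂ : Λ₂.IsRegular) (hle : Λ₁ ≤ Λ₂) (h' : BohrSet.IsAttendant ε Λ₁ Λ')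
    (h'' : BohrSet.IsAttendant ε Λ' Λ'') {M₁ : BohrSet d₁} {M₂ : BohrSet d₂}
    (hM₁ : BohrSet.IsAttendant ((2 : ℝ) ^ (-10 : ℤ) * ε ^ 2) Λ₁ M₁)
    (hM₂ : BohrSet.IsAttendant ((2 : ℝ) ^ (-10 : ℤ) * ε ^ 2) Λ₁ M₂) :
    ∃ F : LocalFrame κ Λ₁.points Λ₂.points Λ'.points Λ''.points,
      M₁.points ⊆ F.T ∧ M₂.points ⊆ F.T := by
  obtain ⟨hθ, hε12, hN12⟩ := hle
  have hε0 := h'.pos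
  have hd1 : (1 : ℝ) ≤ d := by exact_mod_cast hd
  have hε1 : 12 * ε ≤ 1 := by
    have : κ / (100 * d) ≤ 1 := by
      rw [div_le_one (by positivity)]; linarith
    linarith
  have p1 := Λ₁.ε_pos
  have p2 := Λ₂.ε_pos
  have p' := Λ'.ε_pos
  have q1 : (0 : ℝ) < Λ₁.N := by exact_mod_cast Λ₁.N_pos
  have q2 : (0 : ℝ) < Λ₂.N := by exact_mod_cast Λ₂.N_pos
  have q' : (0 : ℝ) < Λ'.N := by exact_mod_cast Λ'.N_pos
  have hN12' : (Λ₁.N : ℝ) ≤ Λ₂.N := by exact_mod_cast hN12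
  have e2 : Λ₂.points = bohrPoints Λ₁.θ Λ₂.ε Λ₂.N := by rw [hθ]; rfl
  have e' : Λ'.points = bohrPoints Λ₁.θ Λ'.ε Λ'.N := by rw [← h'.θ_eq]; rfl
  have e'' : Λ''.points = bohrPoints Λ₁.θ Λ''.ε Λ''.N := by rw [← h'.θ_eq, ← h''.θ_eq]; rfl
  have e1 : Λ₁.points = bohrPoints Λ₁.θ Λ₁.ε Λ₁.N := rfl
  -- `(E, n)` bounds the width and length of `Λ'` and measures the enlargements of `Λ₁` and `Λ₂`.
  -- `(r, k)` belongs to the shift set `T` and measures those of `Λ'`. Lengths are integers, hence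
  -- the floors.
  obtain ⟨E, hE⟩ : ∃ E, E = ε * Λ₁.ε := ⟨_, rfl⟩
  obtain ⟨n, hn⟩ : ∃ n, n = ⌊ε * Λ₁.N⌋₊ := ⟨_, rfl⟩
  obtain ⟨r, hr⟩ : ∃ r, r = ε * Λ'.ε := ⟨_, rfl⟩
  obtain ⟨k, hk⟩ : ∃ k, k = ⌊ε * Λ'.N⌋₊ := ⟨_, rfl⟩
  have hE0 : 0 < E := by rw [hE]; positivity
  have hr0 : 0 < r := by rw [hr]; positivity
  have hnr : (n : ℝ) ≤ ε * Λ₁.N := by rw [hn]; exact Nat.floor_le (by positivity)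
  have hkr : (k : ℝ) ≤ ε * Λ'.N := by rw [hk]; exact Nat.floor_le (by positivity)
  have a1 : Λ'.ε ≤ E := by rw [hE]; exact h'.ε_le
  have a2 : Λ'.N ≤ n := by rw [hn]; exact Nat.le_floor h'.N_le
  have a3 : 6 * r ≤ Λ'.ε := by
    rw [hr]
    calc 6 * (ε * Λ'.ε) = (6 * ε) * Λ'.ε := by ring
      _ ≤ 1 * Λ'.ε := by gcongr; linarith
      _ = _ := one_mul _
  have a4 : 6 * k ≤ Λ'.N := by
    have : (6 : ℝ) * k ≤ Λ'.N := by
      calc 6 * (k : ℝ) ≤ 6 * (ε * Λ'.N) := by gcongr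
        _ = (6 * ε) * Λ'.N := by ring
        _ ≤ 1 * Λ'.N := by gcongr; linarith
        _ = _ := one_mul _
    exact_mod_cast this
  have a5 : Λ''.ε ≤ r := by rw [hr]; exact h''.ε_le
  have a6 : Λ''.N ≤ k := by rw [hk]; exact Nat.le_floor h''.N_le
  have a7 : 12 * n ≤ Λ₂.N := by
    have : (12 : ℝ) * n ≤ Λ₂.N := by
      calc 12 * (n : ℝ) ≤ 12 * (ε * Λ₁.N) := by gcongr
        _ = (12 * ε) * Λ₁.N := by ring
        _ ≤ 1 * Λ₁.N := by gcongr
        _ ≤ _ := by rw [one_mul]; exact hN12'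
    exact_mod_cast this
  -- An attendant of parameter `2⁻¹⁰ ε²` fits into `T`, since the width and length of `Λ'` are at
  -- least `ε / 2` times those of `Λ₁`. The extra frequencies of `M` only make it smaller.
  have hMsub : ∀ {d' : ℕ} {M : BohrSet d'},
      BohrSet.IsAttendant ((2 : ℝ) ^ (-10 : ℤ) * ε ^ 2) Λ₁ M →
      M.points ⊆ bohrPoints Λ₁.θ r k := by
    intro d' M hM
    refine hM.points_subset.trans (bohrPoints_mono ?_ ?_)
    · have h1 := hM.ε_le
      have h2 := h'.le_ε
      rw [hr]
      have h3 : ε * (ε * Λ₁.ε / 2) ≤ ε * Λ'.ε := by gcongr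
      have : 0 < ε ^ 2 * Λ₁.ε := by positivity
      norm_num at h1
      nlinarith
    · have h1 := hM.N_le
      have h2 := h'.le_N
      rw [hk]
      refine Nat.le_floor ?_
      have h3 : ε * (ε * Λ₁.N / 2) ≤ ε * Λ'.N := by gcongr
      have : 0 < ε ^ 2 * Λ₁.N := by positivity
      norm_num at h1
      nlinarith
  have c1 : 12 * E < κ / (100 * d) * Λ₁.ε := by
    rw [hE, ← mul_assoc]; gcongr
  have c2 : 12 * (n : ℝ) < κ / (100 * d) * Λ₁.N := by
    calc 12 * (n : ℝ) ≤ 12 * (ε * Λ₁.N) := by gcongr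
      _ = (12 * ε) * Λ₁.N := by ring
      _ < _ := by gcongr
  have c3 : 12 * E < κ / (100 * d) * Λ₂.ε := c1.trans_le (by gcongr)
  have c4 : 12 * (n : ℝ) < κ / (100 * d) * Λ₂.N := c2.trans_le (by gcongr)
  have c5 : 6 * r < κ / (100 * d) * Λ'.ε := by
    calc 6 * r = (6 * ε) * Λ'.ε := by rw [hr]; ring
      _ < _ := by gcongr; linarith
  have c6 : 6 * (k : ℝ) < κ / (100 * d) * Λ'.N := by
    calc 6 * (k : ℝ) ≤ 6 * (ε * Λ'.N) := by gcongr
      _ = (6 * ε) * Λ'.N := by ring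
      _ < _ := by gcongr; linarith
  have neg : ∀ {x e m}, x ∈ bohrPoints Λ₁.θ e m → -x ∈ bohrPoints Λ₁.θ e m := bohrPoints_neg
  refine ⟨{
    T := bohrPoints Λ₁.θ r k
    S := bohrPoints Λ₁.θ (Λ'.ε + 3 * r) (Λ'.N + 3 * k)
    S' := bohrPoints Λ₁.θ (Λ'.ε + 6 * r) (Λ'.N + 6 * k)
    Y := bohrPoints Λ₁.θ (Λ₂.ε + 4 * E) (Λ₂.N + 4 * n)
    -- `Y` uses `4 E`, and `S` and `S'` lie within `2 E` each, so `Y + S' - S` needs `8 E`. The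
    -- margin `12 E` is ample, also for `Yc`, where `3 E` is needed.
    Y' := bohrPoints Λ₁.θ (Λ₂.ε + 12 * E) (Λ₂.N + 12 * n)
    Yc := bohrPoints Λ₁.θ (Λ₂.ε - 12 * E) (Λ₂.N - 12 * n)
    L₁' := bohrPoints Λ₁.θ (Λ₁.ε + 2 * E) (Λ₁.N + 2 * n)
    W_sub := by rw [e'']; exact bohrPoints_mono a5 a6
    T_sub := by rw [e']; exact bohrPoints_mono (by linarith) (by omega)
    zero_mem := bohrPoints_zero_mem Λ''.ε_pos
    W_neg := fun m hm => Λ''.neg_mem_points hm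
    L_sub := by rw [e']; exact bohrPoints_mono (by linarith) (by omega)
    S_sub := bohrPoints_mono (by linarith) (by omega)
    L₂_sub := by rw [e2]; exact bohrPoints_mono (by linarith) (by omega)
    Y_sub := bohrPoints_mono (by linarith) (by omega)
    Yc_sub := by rw [e2]; exact bohrPoints_mono (by linarith) (by omega)
    L₁_sub := by rw [e1]; exact bohrPoints_mono (by linarith) (by omega)
    add_three_mem_S := fun x hx t₁ h₁ t₂ h₂ t₃ h₃ => by
      rw [e'] at hx
      exact bohrPoints_mono (by linarith) (by omega)
        (bohrPoints_add (bohrPoints_add (bohrPoints_add hx h₁) h₂) h₃)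
    add_two_mem_S' := fun x hx t₁ h₁ t₂ h₂ =>
      bohrPoints_mono (by linarith) (by omega) (bohrPoints_add (bohrPoints_add hx h₁) h₂)
    add_mem_S := fun x hx t₁ h₁ => by
      rw [e'] at hx
      exact bohrPoints_mono (by linarith) (by omega) (bohrPoints_add hx h₁)
    add_mem_S' := fun x hx t₁ h₁ =>
      bohrPoints_mono (by linarith) (by omega) (bohrPoints_add hx h₁)
    add_three_mem_Y := fun x hx t₁ h₁ t₂ h₂ t₃ h₃ => by
      rw [e2] at hx
      exact bohrPoints_mono (by linarith) (by omega)
        (bohrPoints_add (bohrPoints_add (bohrPoints_add hx h₁) h₂) h₃)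
    add_mem_Y := fun x hx y hy => by
      rw [e'] at hx
      rw [e2] at hy
      exact bohrPoints_mono (by linarith) (by omega) (bohrPoints_add hy hx)
    add_two_mem_Y' := fun x hx t₁ h₁ t₂ h₂ =>
      bohrPoints_mono (by linarith) (by omega) (bohrPoints_add (bohrPoints_add hx h₁) h₂)
    add_sub_mem_Y' := fun y hy s hs x hx => by
      rw [sub_eq_add_neg]
      exact bohrPoints_mono (by linarith) (by omega)
        (bohrPoints_add (bohrPoints_add hy hs) (neg hx))
    sub_add_mem_L₂ := fun x hx y hy i hi => by
      rw [e'] at hi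
      rw [e2, sub_eq_add_neg]
      exact bohrPoints_mono (by linarith) (by omega)
        (bohrPoints_add hx (neg (bohrPoints_add hy hi)))
    add_mem_L₁' := fun l hl s hs => by
      rw [e1] at hl
      exact bohrPoints_mono (by linarith) (by omega) (bohrPoints_add hl hs)
    card_S' := by
      have := h'.regular.card_le hκ hκ' (e := 6 * r) (n := 6 * k) (by positivity) c5
        (by push_cast; exact c6)
      rwa [h'.θ_eq] at this
    card_Y' := by
      have := hΛ₂.card_le hκ hκ' (e := 12 * E) (n := 12 * n) (by positivity) c3
        (by push_cast; exact c4)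
      rwa [← hθ] at this
    card_L₁' := hΛ₁.card_le hκ hκ' (e := 2 * E) (n := 2 * n) (by positivity) (by linarith)
        (by push_cast; linarith [Nat.cast_nonneg (α := ℝ) n])
    card_Yc := by
      have := hΛ₂.le_card hκ hκ' (e := 12 * E) (n := 12 * n) (by positivity) a7 c3
        (by push_cast; exact c4)
      rwa [← hθ] at this }, hMsub hM₁, hMsub hM₂⟩

/-- A Bohr set of slightly smaller width and length contains a nonzero integer, if its length is
large in terms of its width. -/
theorem exists_ne_zero_mem_bohrPoints_of_log {d : ℕ} (hd : 0 < d) (θ : Fin d → UnitAddCircle)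
    {η ε : ℝ} {N n : ℕ} (hη : 0 < η) (hε : 0 < ε) (hNpos : 0 < N)
    (hN : (2 : ℝ) ^ 10 * (d : ℝ) * Real.log (1 / (η * ε)) ≤ Real.log (N : ℝ))
    (hεN : 1 ≤ ε ^ 2 * N) (hn : ε * N < n + 1) (hn1 : 1 ≤ n) :
    ∃ t : ℤ, t ≠ 0 ∧ t ∈ bohrPoints θ (ε * η) n := by
  have hN' : (0 : ℝ) < N := by exact_mod_cast hNpos
  have hE : 0 < ε * η := by positivity
  -- The width of a Bohr set is not bounded above. Norms on the circle are at most `1/2`, so for a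
  -- large width `t = 1` will do; otherwise `z = 1 / (ε η) ≥ 2`.
  by_cases hhalf : 2⁻¹ < ε * η
  · refine ⟨1, one_ne_zero, ?_⟩
    rw [mem_bohrPoints]
    refine ⟨by rw [abs_one]; exact_mod_cast hn1, fun j => ?_⟩
    have := AddCircle.norm_le_half_period 1 one_ne_zero (x := (1 : ℤ) • θ j)
    refine lt_of_le_of_lt this ?_
    norm_num at hhalf ⊢
    exact hhalf
  rw [not_lt] at hhalf
  set z : ℝ := 1 / (ε * η) with hz
  have hz2 : 2 ≤ z := by
    rw [hz, le_div_iff₀ hE]; linarith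
  have hz0 : 0 < z := by linarith
  have hNz : z ^ (2 ^ 10 * d) ≤ N := by
    rw [← Real.log_le_log_iff (by positivity) hN', Real.log_pow]
    rw [mul_comm η ε] at hN
    have e : ((2 ^ 10 * d : ℕ) : ℝ) = 2 ^ 10 * d := by push_cast; ring
    rw [e]
    exact hN
  -- The bound `1 ≤ ε² N` gives `N ≤ (ε N)²`, so `ε N` is at least the square root of `N`; the
  -- exponent `2 ^ 10 * d` has room to spare.
  have hεNz : z ^ (2 * d) ≤ ε * N := by
    have h1 : (z ^ (2 * d)) ^ 2 ≤ (ε * N) ^ 2 := by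
      calc (z ^ (2 * d)) ^ 2 = z ^ (4 * d) := by rw [← pow_mul]; congr 1; ring
        _ ≤ z ^ (2 ^ 10 * d) := pow_le_pow_right₀ (by linarith) (by omega)
        _ ≤ N := hNz
        _ = 1 * N := (one_mul _).symm
        _ ≤ ε ^ 2 * N * N := by gcongr
        _ = _ := by ring
    exact (pow_le_pow_iff_left₀ (by positivity) (by positivity) two_ne_zero).1 h1
  have hfl : (⌊z⌋₊ : ℝ) ≤ z := Nat.floor_le hz0.le
  have hfl' : z < ⌊z⌋₊ + 1 := Nat.lt_floor_add_one z
  -- `K = ⌊z⌋ + 1` exceeds `z`, so `1 / K ≤ ε η`; and `K ≤ z + 1 ≤ z²` because `z ≥ 2`, so `K ^ d`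
  -- is at most `z ^ (2 d)`.
  refine exists_ne_zero_mem_bohrPoints θ (ε * η) n (⌊z⌋₊ + 1) (Nat.succ_pos _) ?_ ?_
  · push_cast
    have h1 : 1 / ((⌊z⌋₊ : ℝ) + 1) ≤ 1 / z := by gcongr
    refine h1.trans_eq ?_
    rw [hz, one_div_one_div]
  · have h1 : ((⌊z⌋₊ : ℝ) + 1) ^ d < n + 1 := by
      calc ((⌊z⌋₊ : ℝ) + 1) ^ d ≤ (z ^ 2) ^ d := by gcongr; nlinarith
        _ = z ^ (2 * d) := by rw [← pow_mul]
        _ ≤ ε * N := hεNz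
        _ < _ := hn
    exact_mod_cast h1

end

/-! ### Conclusion -/

theorem relDensity_eq {Λ Q : Finset ℤ} {β : ℝ} (h : Q ⊆ Λ) (hΛ : 0 < Λ.card)
    (hβ : (Q.card : ℝ) = β * Λ.card) : relDensity Λ Q = β := by
  have hΛ' : (0 : ℝ) < Λ.card := by exact_mod_cast hΛ
  unfold relDensity
  rw [Finset.inter_eq_right.2 h, hβ, mul_div_cancel_right₀ _ hΛ'.ne']

theorem density_mem_Icc {x c n : ℝ} (hc : c = x * n) (hn : 0 < n) (h0 : 0 ≤ c) (h1 : c ≤ n) :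
    0 ≤ x ∧ x ≤ 1 := by
  rw [hc] at h0 h1
  exact ⟨nonneg_of_mul_nonneg_left h0 hn, le_of_mul_le_mul_right (by linarith) hn⟩

theorem theorem3p15 {d d₁ d₂ : ℕ} (hd : 0 < d)
    (Λ₁ Λ₂ : BohrSet d) (hΛ₁ : Λ₁.IsRegular) (hΛ₂ : Λ₂.IsRegular) (hle : Λ₁ ≤ Λ₂)
    (E₁ E₂ : Finset ℤ) (hE₁ : E₁ ⊆ Λ₁.points) (hE₂ : E₂ ⊆ Λ₂.points)
    (A : Finset (ℤ × ℤ)) (hA : A ⊆ E₁ ×ˢ E₂)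
    (β₁ β₂ δ : ℝ)
    (hβ₁ : (E₁.card : ℝ) = β₁ * Λ₁.size) (hβ₂ : (E₂.card : ℝ) = β₂ * Λ₂.size)
    (hδ : (A.card : ℝ) = δ * (E₁.card : ℝ) * (E₂.card : ℝ))
    (α₀ ε : ℝ)
    (hα₀ : α₀ = (2 : ℝ) ^ (-2000 : ℤ) * δ ^ 96 * β₁ ^ 48 * β₂ ^ 48)
    (hε : ε = ((2 : ℝ) ^ (-100 : ℤ) * α₀ ^ 2) / (100 * (d : ℝ)))
    -- the sets `E₁` and `E₂` are `(α₀, 2⁻¹⁰ε²)`-uniform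
    (M₁ : BohrSet d₁) (M₂ : BohrSet d₂)
    (hM₁ : BohrSet.IsAttendant ((2 : ℝ) ^ (-10 : ℤ) * ε ^ 2) Λ₁ M₁)
    (hM₂ : BohrSet.IsAttendant ((2 : ℝ) ^ (-10 : ℤ) * ε ^ 2) Λ₁ M₂)
    (hU₁ : IsUniformAt α₀ Λ₁ M₁ E₁) (hU₂ : IsUniformAt α₀ Λ₂ M₂ E₂)
    (Λ' Λ'' : BohrSet d)
    (hrect : IsRectUniform ((2 : ℝ) ^ (-100 : ℤ) * δ ^ 12) ((2 : ℝ) ^ (-7 : ℤ) * δ) ε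
      Λ₁ Λ₂ Λ' Λ'' E₁ E₂ A)
    (hN : (2 : ℝ) ^ 10 * (d : ℝ) * Real.log (1 / (Λ₁.ε * ε)) ≤ Real.log (Λ₁.N : ℝ)) :
    ∃ k m t : ℤ, t ≠ 0 ∧ (k, m) ∈ A ∧ (k + t, m) ∈ A ∧ (k, m + t) ∈ A := by
  -- `ω` is the eighth root of `α₀`, the form in which the bilinear estimates use the uniformity
  -- constant.
  obtain ⟨ω, hω⟩ : ∃ ω : ℝ, ω = 2⁻¹ ^ 250 * δ ^ 12 * (β₁ * β₂) ^ 6 := ⟨_, rfl⟩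
  have hα₀ω : α₀ = ω ^ 8 := by
    have e : (2 : ℝ) ^ (-2000 : ℤ) = (2⁻¹ ^ 250) ^ 8 := by
      rw [← pow_mul, inv_pow, ← zpow_natCast, ← zpow_neg]; rfl
    rw [hα₀, hω, e]; ring
  have hε0 : 0 < ε := hrect.attendant.pos
  -- An attendant exists for positive `ε` only, so `α₀ ≠ 0`. This excludes the degenerate densities
  -- `δ = 0`, `β₁ = 0` and `β₂ = 0`.
  have hω0 : ω ≠ 0 := by
    rintro rfl
    rw [hα₀ω] at hε
    norm_num at hε
    exact hε0.ne' hε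
  have hδ0 : δ ≠ 0 := by rintro rfl; exact hω0 (by rw [hω]; ring)
  have hβ₁0 : β₁ ≠ 0 := by rintro rfl; exact hω0 (by rw [hω]; ring)
  have hβ₂0 : β₂ ≠ 0 := by rintro rfl; exact hω0 (by rw [hω]; ring)
  obtain ⟨b₁, hβ₁1⟩ := density_mem_Icc hβ₁ Λ₁.size_pos (Nat.cast_nonneg _)
    (Nat.cast_le.2 (Finset.card_le_card hE₁))
  obtain ⟨b₂, hβ₂1⟩ := density_mem_Icc hβ₂ Λ₂.size_pos (Nat.cast_nonneg _)
    (Nat.cast_le.2 (Finset.card_le_card hE₂))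
  have hβ₁p : 0 < β₁ := lt_of_le_of_ne b₁ hβ₁0.symm
  have hβ₂p : 0 < β₂ := lt_of_le_of_ne b₂ hβ₂0.symm
  have hE₁p : (0 : ℝ) < E₁.card := by rw [hβ₁]; exact mul_pos hβ₁p Λ₁.size_pos
  have hE₂p : (0 : ℝ) < E₂.card := by rw [hβ₂]; exact mul_pos hβ₂p Λ₂.size_pos
  obtain ⟨b₃, hδ1⟩ := density_mem_Icc (x := δ) (c := A.card) (n := (E₁.card : ℝ) * E₂.card)
    (by rw [hδ]; ring) (by positivity) (Nat.cast_nonneg _)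
    (by
      have := Finset.card_le_card hA
      rw [Finset.card_product] at this
      exact_mod_cast this)
  have hδp : 0 < δ := lt_of_le_of_ne b₃ hδ0.symm
  have hb0 : 0 < β₁ * β₂ := mul_pos hβ₁p hβ₂p
  have hωp : 0 < ω := by rw [hω]; positivity
  have w20 : ω ≤ 2⁻¹ ^ 20 := by
    have := small_of_le_pow hb0 (mul_le_one₀ hβ₁1 hβ₂p.le hβ₂1) hδp hδ1 hω.le (i := 0) (j := 0)
      (by norm_num) (by norm_num)
    norm_num at this ⊢; linarith
  have w8 : ω ^ 8 ≤ 8⁻¹ := by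
    have := pow_le_self_of_small hωp w20 (n := 8) (by norm_num)
    norm_num at this w20 ⊢; linarith
  have hd' : (0 : ℝ) < 100 * d := by
    have : (0 : ℝ) < d := by exact_mod_cast hd
    positivity
  -- As `ε` contains `α₀² = ω¹⁶`, it lies far below the regularity threshold `κ / (100 d)` at `κ =
  -- ω⁸`.
  have hε12 : 12 * ε < ω ^ 8 / (100 * d) := by
    rw [hε, hα₀ω, ← mul_div_assoc]
    gcongr
    have : 0 < ω ^ 8 := by positivity
    generalize ω ^ 8 = κ at *
    norm_num at w8 ⊢
    nlinarith
  rw [hα₀ω] at hU₁ hU₂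
  obtain ⟨F, hM₁T, hM₂T⟩ := exists_localFrame hd (κ := ω ^ 8) (by positivity)
    (w8.trans_lt (by norm_num)) hε12 hΛ₁ hΛ₂ hle hrect.attendant hrect.attendant' hM₁ hM₂
  obtain ⟨G₁, hG₁s, hG₁c, hG₁⟩ := hU₁.exists_good hβ₁
  obtain ⟨G₂, hG₂s, hG₂c, hG₂⟩ := hU₂.exists_good hβ₂
  obtain ⟨bad, hbad, hgood⟩ : ∃ bad : Finset ℤ,
      (bad.card : ℝ) ≤ (2 : ℝ) ^ (-7 : ℤ) * δ * Λ₁.size ∧ ∀ l ∈ Λ₁.points, l ∉ bad →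
        rectNorm4 Λ'.points Λ₂.points Λ''.points (localize (balanced E₁ E₂ A) Λ'.points l)
          ≤ (2 : ℝ) ^ (-100 : ℤ) * δ ^ 12 * (relDensity Λ₁.points E₁) ^ 2
            * (relDensity Λ₂.points E₂) ^ 2 * Λ''.size ^ 4 * Λ'.size ^ 2 * Λ₂.size :=
    ⟨_, hrect.card_le, fun l hl h => not_lt.1 fun h' => h (Finset.mem_filter.2 ⟨hl, h'⟩)⟩
  have e100 : (2 : ℝ) ^ (-100 : ℤ) = 2⁻¹ ^ 100 := by norm_num
  rw [relDensity_eq hE₁ Λ₁.card_points_pos hβ₁, relDensity_eq hE₂ Λ₂.card_points_pos hβ₂,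
    e100] at hgood
  rcases F.exists_corner_or_dense hM₁T hM₂T (fun m hm => M₁.neg_mem_points hm) M₁.card_points_pos
    (fun m hm => M₂.neg_mem_points hm) M₂.card_points_pos hωp hω.le hδp hβ₁p hβ₁1 hβ₂p hβ₂1 hδ1
    Λ₁.card_points_pos Λ₂.card_points_pos hE₁ hE₂ hA hβ₁ hβ₂ hδ ⟨hG₁s, hG₁c, hG₁⟩
    ⟨hG₂s, hG₂c, hG₂⟩ hbad hgood with h | hdense
  · exact h
  have q1 : (0 : ℝ) < Λ₁.N := by exact_mod_cast Λ₁.N_pos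
  have p1 := Λ₁.ε_pos
  -- The length of `M₁` is a positive integer and at most `2⁻¹⁰ ε² N₁`.
  have hεN : 1 ≤ ε ^ 2 * Λ₁.N := by
    have h1 := hM₁.N_le
    have h2 : (1 : ℝ) ≤ M₁.N := by exact_mod_cast M₁.N_pos
    norm_num at h1
    linarith
  have hn : (⌊ε * Λ₁.N⌋₊ : ℝ) ≤ ε * Λ₁.N := Nat.floor_le (by positivity)
  obtain ⟨t, ht0, ht⟩ := exists_ne_zero_mem_bohrPoints_of_log hd Λ₁.θ Λ₁.ε_pos hε0 Λ₁.N_pos hN hεN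
    (Nat.lt_floor_add_one _)
    (Nat.le_floor (by
      have h1 := hrect.attendant.N_le
      have h2 : (1 : ℝ) ≤ Λ'.N := by exact_mod_cast Λ'.N_pos
      push_cast
      linarith))
  obtain ⟨hθ, hle₁, hle₂⟩ := hle
  have hle₂' : (Λ₁.N : ℝ) ≤ Λ₂.N := by exact_mod_cast hle₂
  have hε1 : ε < ω ^ 8 / (100 * d) := by linarith
  have hκ1 : ω ^ 8 < 1 := w8.trans_lt (by norm_num)
  -- The shift `t` lies in the Bohr set of width `ε ε₁` and length `⌊ε N₁⌋`, so regularity shows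
  -- that translation by `t` keeps both sets inside enlargements by a factor at most `1 + ω⁸ ≤ 9/8`.
  have c1 := hΛ₁.card_le (κ := ω ^ 8) (by positivity) hκ1 (e := ε * Λ₁.ε) (n := ⌊ε * Λ₁.N⌋₊)
    (by positivity) (by gcongr) (hn.trans_lt (by gcongr))
  have c2 := hΛ₂.card_le (κ := ω ^ 8) (by positivity) hκ1 (e := ε * Λ₁.ε) (n := ⌊ε * Λ₁.N⌋₊)
    (by positivity)
    (lt_of_lt_of_le (b := ω ^ 8 / (100 * d) * Λ₁.ε) (by gcongr) (by gcongr))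
    (hn.trans_lt (lt_of_lt_of_le (b := ω ^ 8 / (100 * d) * Λ₁.N) (by gcongr) (by gcongr)))
  have s1 := Λ₁.size_pos
  have s2 := Λ₂.size_pos
  have pE : 0 ≤ ε * Λ₁.ε := by positivity
  obtain ⟨k, m, h1, h2, h3⟩ := exists_corner_of_dense Λ₁.points _ Λ₂.points _ A
    (hA.trans (Finset.product_subset_product hE₁ hE₂))
    (bohrPoints_mono (by linarith) (Nat.le_add_right _ _))
    (bohrPoints_mono (by linarith) (Nat.le_add_right _ _)) t
    (fun x hx => bohrPoints_add hx ht) (fun y hy => bohrPoints_add hy (by rwa [← hθ]))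
    Λ₁.card_points_pos Λ₂.card_points_pos
    (c1.trans (mul_le_mul_of_nonneg_right (by linarith) s1.le))
    (c2.trans (mul_le_mul_of_nonneg_right (by linarith) s2.le)) hdense
  exact ⟨k, m, t, ht0, h1, h2, h3⟩
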